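/- **Setting.** Let $\overline{\mathcal H}=(\mathbb C\times\mathbb R)\cup\{\infty\}$ be the one-point compactified Heisenberg space, identified with the null lines of $\langle z,w\rangle=\bar w^tJz$ on $\mathbb C^3$, $J=\begin{pmatrix}0&0&1\\0&1&0\\1&0&0\end{pmatrix}$, by $(z,t)\mapsto[\tfrac{it-|z|^2}{2},z,1]$, $\infty\mapsto[1,0,0]$, with its action of $PU(2,1)$. For points $P\ne Q$ let $[P,Q]$ be the segment from $P$ to $Q$ of the positively oriented $\mathbb C$-circle through $P,Q$, and put $[P^+,Q,R]=\bigcup_{Y\in[Q,R]}[P,Y]$ and $[P^-,Q,R]=\bigcup_{Y\in[Q,R]}[Y,P]$. Let $\omega=-\frac12(1+i\sqrt3)$, $P_1=(1,\sqrt3)$, $P_2=(-\omega,\sqrt3)$, $P_3=(0,0)$, $P_4=\infty$, and $$G_1=\begin{pmatrix}-\omega&0&0\\1&1&0\\-\bar\omega&\omega&-\omega\end{pmatrix},\ G_2=\begin{pmatrix}1&1&\omega\\0&-\bar\omega&\bar\omega\\0&0&1\end{pmatrix},\ G_3=\begin{pmatrix}1&0&0\\0&-\omega&0\\0&0&1\end{pmatrix},\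 G_4=\begin{pmatrix}0&0&-\omega\\0&-\bar\omega&0\\-\omega&0&1-\bar\omega\end{pmatrix}.$$ The standard tetrahedra $\mathfrak T_A$, $\mathfrak T_B$ have the vertices $P_1,\dots,P_4$, the faces $[P_4^-,P_1,P_2]$, $[P_4^-,P_3,P_1]$, $[P_4^-,P_3,P_2]$ and the bottom face $[P_2^-,P_3,P_1]$ (type $A$) or $[P_3^+,P_1,P_2]$ (type $B$); they are the closed balls bounded by these faces above the bottom face. For $k\in\mathbb Z$ the slab $\mathfrak S_k$, with vertices $P_1,P_2,P_4$, is the closed ball bounded by $[P_4^+,P_1,P_2]$, $[P_4^-,P_1,P_2]$ and the bigons $B'=\{(1+re^{-i\pi/6},s)\}\cup\{\infty\}$ and $B_k=\{(-\omega+re^{i\pi(1-2k)/6},s)\}\cup\{\infty\}$ ($r\ge0$, $s\in\mathbb R$), on the side containing $(\tfrac32,\sqrt3)$. Let $f\in SL(2,\mathbb Z)$ have two distinct positive real eigenvalues, i.e. $\operatorname{tr}f>2$, and let $w=w_0\cdots w_{m-1}$ be a flip sequence of $f$: after conjugation of $f$, the flips $w_0,\dots,w_{m-1}\in\{\mathcal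 R,\mathcal L\}$, performed in this order, change the ideal triangulation of the once-punctured torus with slopes $0,1,\infty$ into its image under $f$, the edges of smallest and of largest slope corresponding to each other under $f$ (here $\mathcal R$ removes the edge of largest and $\mathcal L$ the edge of smallest slope, and another edge is inserted). Indices are taken mod $m$. The cell decomposition $\mathcal D_f$ of the punctured torus bundle $M_f$, with its geometric realisation, consists of the following ideal cells (vertices removed): for each $j$ a tetrahedron $\hat\sigma_j$ with vertices $1,2,3,4$, realised by $\mathfrak T_B$ if $w_{j-1}=\mathcal R$ and by $\mathfrak T_A$ if $w_{j-1}=\mathcal L$ (vertex $i$ at $P_i$); for each $j$ with $w_j=\mathcal R$ (then $\hat\sigma_j$ is written $\hat\sigma_j^{\mathcal R}$) a slab $\hat\sigma_j^S$ with vertices $1,2,4$, realised by $\mathfrak S_{k}$, where $k$ is the number of letters $\mathcal L$ between the cyclically preceding letter $\mathcal R$ and $w_j$; its edges $(14),(24)$ are realised by $[P_1,P_4],[P_2,P_4]$ and its edges $(41),(42)$ by $[P_4,P_1],[P_4,P_2]$. The cells are glued by the following face pairings: - if $w_j=\mathcal L$: $\hat\sigma_j(134)\to\hat\sigma_{j+1}(132)$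 by $G_1$ and $\hat\sigma_j(124)\to\hat\sigma_{j+1}(324)$ by $G_2$; - if $w_j=\mathcal R$: $\hat\sigma_j(134)\to\hat\sigma_{j+1}(234)$ by $G_3$; $\hat\sigma_j(124)$ to the triangle of $\hat\sigma_j^S$ with edges $(12),(14),(24)$ by the identity; the triangle of $\hat\sigma_j^S$ with edges $(12),(41),(42)$ to $\hat\sigma_{j+1}(123)$ by $G_4$; and, if $l$ letters $\mathcal L$ lie between $w_j$ and the cyclically next letter $\mathcal R$, the bigon $B'$ of $\hat\sigma_j^S$ to the bigon $B_l$ of $\hat\sigma^S_{j+l+1}$ by $G_2^{\,l}G_3$. Let $\hat\pi$ be the quotient map from the disjoint union of the ideal cells. The valence of an edge $e$ of $\mathcal D_f$ is the number of edges of ideal cells that $\hat\pi$ maps onto $e$. Charts of the branched CR structure are the continuous maps from open subsets of $M_f$ to $\overline{\mathcal H}$ which on each cell are locally the realisation followed by an element of $PU(2,1)$. The ramification order around $e$ is the integer $N\ge1$ such that every point of $e$ has an open neighbourhood $U$ with a chart $\phi$ on $U$ and a homeomorphism $h$ of $U$ onto an open subset of $\mathbb C\times\mathbb R$ that maps $e\cap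 U$ exactly to the part of $h(U)$ on the $t$-axis, and $\phi=\xi_N\circ h$ with $\xi_N(z,t)=(z^N,t)$. **Lemma.** Let $w_j=\mathcal R$ and $e_j=\hat\pi(\hat\sigma_j^{\mathcal R}(14))$. Then the valence of $e_j$ in $\mathcal D_f$ is $n_j+4$ for some integer $n_j\ge0$, and the ramification order around $e_j$ exists, is unique, and equals $$\left\lceil\frac{n_j+5}{6}\right\rceil .$$ -/

import Mathlib

namespace TorusBundleCR

open Complex Matrix Topology Filter

noncomputable section

/-! ### Flip sequences of once-punctured torus bundles -/

/-- The two kinds of edge flips: right (`R`) and left (`L`). -/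
inductive Flip
  | R
  | L
  deriving DecidableEq

/-- A straight positive ideal triangulation of the once-punctured torus `(ℝ² ∖ ℤ²) / ℤ²`, recorded
by direction vectors `(x, y)` (slope `y / x`) of its edges of smallest slope (`lo`) and of largest
slope (`hi`). By the Farey sum rule the third edge has direction `lo + hi`. -/
@[ext] structure PosTriangulation where
  lo : Fin 2 → ℤ
  hi : Fin 2 → ℤ

/-- The standard positive ideal triangulation, with slopes `0, 1, ∞`. -/
def PosTriangulation.std : PosTriangulation := ⟨![1, 0], ![0, 1]⟩

/-- A right flip removes the edge of largest slope (the slopes become those of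
`lo, 2 lo + hi, lo + hi`), a left flip the edge of smallest slope (the slopes become those of
`lo + hi, lo + 2 hi, hi`). -/
def PosTriangulation.flip (T : PosTriangulation) : Flip → PosTriangulation
  | Flip.R => ⟨T.lo, T.lo + T.hi⟩
  | Flip.L => ⟨T.lo + T.hi, T.hi⟩

/-- The triangulation obtained from the standard positive one by the first `i` flips
`w 0, …, w (i - 1)` of the cyclic word `w`. -/
def flipped {m : ℕ} (w : ZMod m → Flip) : ℕ → PosTriangulation
  | 0 => PosTriangulation.std
  | i + 1 => (flipped w i).flip (w i)

/-- `w 0, …, w (m - 1)` is a flip sequence of the mapping class `f ∈ SL(2, ℤ)`: after conjugating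
`f`, the flips transform the standard positive triangulation into its image under `f`
(the edges of smallest and of largest slope corresponding to each other under `f`). -/
def IsFlipSequence (f : SpecialLinearGroup (Fin 2) ℤ) {m : ℕ} (w : ZMod m → Flip) : Prop :=
  ∃ g : SpecialLinearGroup (Fin 2) ℤ, IsConj f g ∧
    flipped w m = ⟨(g : Matrix (Fin 2) (Fin 2) ℤ) *ᵥ PosTriangulation.std.lo,
      (g : Matrix (Fin 2) (Fin 2) ℤ) *ᵥ PosTriangulation.std.hi⟩

/-! ### The CR sphere in the Heisenberg model -/

/-- The one-point compactification of Heisenberg space `ℂ × ℝ`. -/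
abbrev CR : Type := OnePoint (ℂ × ℝ)

/-- The Hermitian form of signature `(2, 1)`. -/
def formJ : Matrix (Fin 3) (Fin 3) ℂ := !![0, 0, 1; 0, 1, 0; 1, 0, 0]

/-- `⟨z, w⟩ = w̄ᵗ J z`. -/
def herm (z w : Fin 3 → ℂ) : ℂ := star w ⬝ᵥ (formJ *ᵥ z)

/-- The matrices in `U(2, 1)`. -/
def IsU21 (A : Matrix (Fin 3) (Fin 3) ℂ) : Prop := Aᴴ * formJ * A = formJ

/-- The standard null vector representing a point of the CR sphere (the inverse of stereographic
projection). -/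
def lift : CR → Fin 3 → ℂ
  | OnePoint.infty => ![1, 0, 0]
  | OnePoint.some (z, t) => ![(I * t - (‖z‖ : ℂ) ^ 2) / 2, z, 1]

open Classical in
/-- The point of the CR sphere represented by a non-zero null vector `v` (stereographic
projection): for `v = (x, y, 1)` the number `2 x + |y|²` is `i t` with `t = Im (2 x)`. -/
def proj (v : Fin 3 → ℂ) : CR :=
  if v 2 = 0 then OnePoint.infty else OnePoint.some (v 1 / v 2, (2 * (v 0 / v 2)).im)

/-- The action of a matrix on the CR sphere. For `A` in `U(2, 1)` this is the CR transformation
represented by `A`. -/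
def act (A : Matrix (Fin 3) (Fin 3) ℂ) (P : CR) : CR := proj (A *ᵥ lift P)

/-- The closed oriented edge `[P, Q]`: the segment from `P` to `Q` of the positively oriented
`ℂ`-circle through `P` and `Q`. The null vectors in the span of lifts `p`, `q` are, up to
scaling, `q` and `p + i s ⟨p, q⟩ q` with `s` real, and positive `s` describe `[P, Q]`. -/
def edge (P Q : CR) : Set CR :=
  {X | ∃ s : ℝ, 0 ≤ s ∧ X = proj (lift P + (I * s * herm (lift P) (lift Q)) • lift Q)} ∪ {Q}

/-- The marked triangle `[P⁺, Q, R]`. -/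
def triPlus (P Q R : CR) : Set CR := {X | ∃ Y ∈ edge Q R, X ∈ edge P Y}

/-- The marked triangle `[P⁻, Q, R]`. -/
def triMinus (P Q R : CR) : Set CR := {X | ∃ Y ∈ edge Q R, X ∈ edge Y P}

/-- The cube root of unity `ω = -(1 + i √3) / 2`. -/
def om : ℂ := -(1 / 2) * (1 + I * (√3 : ℝ))

def P₁ : CR := OnePoint.some (1, √3)
def P₂ : CR := OnePoint.some (-om, √3)
def P₃ : CR := OnePoint.some (0, 0)
def P₄ : CR := OnePoint.infty

def G₁ : Matrix (Fin 3) (Fin 3) ℂ := !![-om, 0, 0; 1, 1, 0; -star om, om, -om]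
def G₂ : Matrix (Fin 3) (Fin 3) ℂ := !![1, 1, om; 0, -star om, star om; 0, 0, 1]
def G₃ : Matrix (Fin 3) (Fin 3) ℂ := !![1, 0, 0; 0, -om, 0; 0, 0, 1]
def G₄ : Matrix (Fin 3) (Fin 3) ℂ := !![0, 0, -om; 0, -star om, 0; -om, 0, 1 - star om]

/-! ### Geometric cells -/

/-- The two standard symmetric tetrahedra. -/
inductive TetType
  | A
  | B

/-- The face of the standard tetrahedron with vertices `P₁, P₂, P₃`. -/
def bottomFace : TetType → Set CR
  | TetType.A => triMinus P₂ P₃ P₁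
  | TetType.B => triPlus P₃ P₁ P₂

/-- The standard symmetric tetrahedron of type `A` or `B`: the closed ball bounded by its four
marked triangles which lies above the bottom face. It is the union of the vertical rays from
points of the bottom face up to `P₄ = ∞`. -/
def tetrahedron (T : TetType) : Set CR := {X | ∃ Y ∈ bottomFace T, X ∈ edge Y P₄}

/-- The bigon `B'`, together with its two boundary edges and its vertices. -/
def bigon' : Set CR :=
  {X | ∃ r s : ℝ, 0 ≤ r ∧ X = OnePoint.some (1 + r * exp (-(Real.pi / 6) * I), s)} ∪ {P₄}

/-- The bigon `B_k`, together with its two boundary edges and its vertices. -/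
def bigon (k : ℕ) : Set CR :=
  {X | ∃ r s : ℝ, 0 ≤ r ∧
    X = OnePoint.some (-om + r * exp (Real.pi / 6 * (1 - 2 * (k : ℝ)) * I), s)} ∪ {P₄}

/-- The projection of the slab `𝔖_k` to the `z`-plane. It is the closed region to the outer side of
the curve formed by the ray that is the projection of `B'` (from `1`, direction `e^{-iπ/6}`), the
short arc of the unit circle from `1` to `-ω`, and the ray that is the projection of `B_k`
(from `-ω`, direction `e^{iπ(1-2k)/6}`).
For `k ≡ 1` mod 6 the two rays are parallel and the region is the half-strip between them, outside
the unit circle (after rotation by `e^{iπ/6}`, between the lines `Im = 1/2` and `Im = 1`). In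
general one adds the sector at `-ω` swept counterclockwise from the direction
`e^{-iπ/6}` to the direction `e^{iπ(1-2k)/6}`, of angle `((1 - k) mod 6) π / 3`. -/
def slabBase (k : ℕ) : Set ℂ :=
  {z | 1 ≤ ‖z‖ ∧ 0 ≤ (exp (Real.pi / 6 * I) * z).re ∧
      1 / 2 ≤ (exp (Real.pi / 6 * I) * z).im ∧ (exp (Real.pi / 6 * I) * z).im ≤ 1} ∪
  {z | ∃ r θ : ℝ, 0 ≤ r ∧ 0 ≤ θ ∧ θ ≤ (((1 - (k : ℤ)) % 6 : ℤ) : ℝ) * (Real.pi / 3) ∧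
      z = -om + r * exp ((θ - Real.pi / 6) * I)}

/-- The slab `𝔖_k`: the closed ball bounded by `[P₄⁺, P₁, P₂]`, `[P₄⁻, P₁, P₂]`, `B'` and `B_k`
(all of them unions of vertical lines or vertical rays) on the outer side. -/
def slab (k : ℕ) : Set CR := {X | ∃ z ∈ slabBase k, ∃ t : ℝ, X = OnePoint.some (z, t)} ∪ {P₄}

/-! ### The ideal cell decomposition and its geometric realisation

Throughout, `w : ZMod m → Flip` is a cyclic word. The tetrahedron with index `j` is of type `w j`,
i.e. the next tetrahedron `j + 1` is layered on it by a flip `w j`. -/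

section

variable {m : ℕ} (w : ZMod m → Flip)

/-- The number of letters `L` that follow position `j` before the next letter `R`. -/
def gap (j : ZMod m) : ℕ := sInf {n : ℕ | w (j + n + 1) = Flip.R}

/-- The number of letters `L` that precede position `j` after the previous letter `R`. -/
def backGap (j : ZMod m) : ℕ := sInf {n : ℕ | w (j - n - 1) = Flip.R}

/-- The `3`-cells: one tetrahedron for every index, and one slab for every index of type `R`. -/
inductive Cell
  | tet (j : ZMod m)
  | slab (j : ZMod m) (hj : w j = Flip.R)

/-- The tetrahedron `j` is realised by the standard tetrahedron of type `B` if it layers on cells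
of type `R`, and of type `A` if it layers on a cell of type `L`. -/
def tetType (j : ZMod m) : TetType :=
  match w (j - 1) with
  | Flip.R => TetType.B
  | Flip.L => TetType.A

variable {w}

/-- The geometric realisation of a `3`-cell. The vertex labelled `i` is realised by `P i`. -/
def Cell.realisation : Cell w → Set CR
  | Cell.tet j => tetrahedron (tetType w j)
  | Cell.slab j _ => TorusBundleCR.slab (backGap w j)

/-- The realisation of a `3`-cell with the ideal vertices removed. -/
def Cell.ideal (c : Cell w) : Set CR :=
  match c with
  | Cell.tet _ => c.realisation \ {P₁, P₂, P₃, P₄}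
  | Cell.slab _ _ => c.realisation \ {P₁, P₂, P₄}

variable (w)

/-- `Pairing w c F G c' F'`: the face `F` of the cell `c` is paired with the face `F'` of `c'`,
and the pairing is realised by the CR transformation `G`. -/
inductive Pairing : Cell w → Set CR → Matrix (Fin 3) (Fin 3) ℂ → Cell w → Set CR → Prop
  /-- type `L`, face `(134)` to face `(132)` of the next tetrahedron -/
  | left₁ (j : ZMod m) (hj : w j = Flip.L) :
      Pairing (Cell.tet j) (triMinus P₄ P₃ P₁) G₁ (Cell.tet (j + 1)) (triMinus P₂ P₃ P₁)
  /-- type `L`, face `(124)` to face `(324)` of the next tetrahedron -/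
  | left₂ (j : ZMod m) (hj : w j = Flip.L) :
      Pairing (Cell.tet j) (triMinus P₄ P₁ P₂) G₂ (Cell.tet (j + 1)) (triMinus P₄ P₃ P₂)
  /-- type `R`, face `(134)` to face `(234)` of the next tetrahedron -/
  | right₁ (j : ZMod m) (hj : w j = Flip.R) :
      Pairing (Cell.tet j) (triMinus P₄ P₃ P₁) G₃ (Cell.tet (j + 1)) (triMinus P₄ P₃ P₂)
  /-- type `R`, the triangle of the slab with edges `(12), (41), (42)` to the face `(123)` of the
  next tetrahedron -/
  | right₂ (j : ZMod m) (hj : w j = Flip.R) :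
      Pairing (Cell.slab j hj) (triPlus P₄ P₁ P₂) G₄ (Cell.tet (j + 1)) (triPlus P₃ P₁ P₂)
  /-- type `R`, the face `(124)` of the tetrahedron to the triangle of its slab with edges
  `(12), (14), (24)` -/
  | inner (j : ZMod m) (hj : w j = Flip.R) :
      Pairing (Cell.tet j) (triMinus P₄ P₁ P₂) 1 (Cell.slab j hj) (triMinus P₄ P₁ P₂)
  /-- the bigon of a slab with vertices `1, 4` to the bigon with vertices `2, 4` of the next
  slab -/
  | bigon (j k : ZMod m) (hj : w j = Flip.R) (hk : w k = Flip.R) (h : k = j + gap w j + 1) :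
      Pairing (Cell.slab j hj) bigon' (G₂ ^ gap w j * G₃)
        (Cell.slab k hk) (TorusBundleCR.bigon (gap w j))

/-- The disjoint union of the (geometrically realised) ideal `3`-cells. -/
abbrev Pieces : Type := Σ c : Cell w, c.ideal

/-- The identification of points by face pairings. -/
def Glue (x y : Pieces w) : Prop :=
  ∃ F G F', Pairing w x.1 F G y.1 F' ∧ (x.2 : CR) ∈ F ∧ (y.2 : CR) ∈ F' ∧ (y.2 : CR) = act G x.2

/-- The once-punctured torus bundle with its ideal cell decomposition `𝒟_f`: the quotient of the
disjoint union of the ideal cells by the face pairings, with the quotient topology. -/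
def Bundle : Type := Quot (Glue w)

instance : TopologicalSpace (Bundle w) := inferInstanceAs (TopologicalSpace (Quot (Glue w)))

/-- The quotient map `π̂`. -/
def piHat (x : Pieces w) : Bundle w := Quot.mk _ x

/-- The edges of a tetrahedron. -/
inductive TetEdge
  | e12 | e13 | e14 | e23 | e24 | e34

/-- The edges of a slab. -/
inductive SlabEdge
  | e12 | e14 | e24 | e41 | e42

/-- The realisation of an edge of a tetrahedron. -/
def TetEdge.realisation : TetEdge → Set CR
  | e12 => edge P₁ P₂
  | e13 => edge P₃ P₁
  | e14 => edge P₁ P₄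
  | e23 => edge P₃ P₂
  | e24 => edge P₂ P₄
  | e34 => edge P₃ P₄

/-- The realisation of an edge of a slab. -/
def SlabEdge.realisation : SlabEdge → Set CR
  | e12 => edge P₁ P₂
  | e14 => edge P₁ P₄
  | e24 => edge P₂ P₄
  | e41 => edge P₄ P₁
  | e42 => edge P₄ P₂

/-- The edges of the `3`-cells, before gluing. -/
inductive CellEdge
  | tet (j : ZMod m) (e : TetEdge)
  | slab (j : ZMod m) (hj : w j = Flip.R) (e : SlabEdge)

variable {w}

/-- The image in the bundle of an (ideal) edge of a `3`-cell. -/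
def CellEdge.image : CellEdge w → Set (Bundle w)
  | CellEdge.tet j e => piHat w '' {x | x.1 = Cell.tet j ∧ (x.2 : CR) ∈ e.realisation}
  | CellEdge.slab j hj e => piHat w '' {x | x.1 = Cell.slab j hj ∧ (x.2 : CR) ∈ e.realisation}

/-- The valence of an edge `e` of the bundle: the number of edges of `3`-cells whose image
is `e`. -/
def valence (e : Set (Bundle w)) : ℕ := Nat.card {ε : CellEdge w // ε.image = e}

/-- The charts of the branched CR structure: continuous maps `φ` on an open set `U` into the CR
sphere which on each `3`-cell are locally the composition of the geometric realisation of this cell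
with a CR transformation. -/
def IsChart (U : Set (Bundle w)) (φ : Bundle w → CR) : Prop :=
  IsOpen U ∧ ContinuousOn φ U ∧
    ∀ (c : Cell w) (x : c.ideal), piHat w ⟨c, x⟩ ∈ U →
      ∃ A, IsU21 A ∧ ∀ᶠ y in 𝓝 x, φ (piHat w ⟨c, y⟩) = act A y

/-- The standard CR branching map `(z, t) ↦ (z ^ N, t)`. -/
def branchingMap (N : ℕ) (p : ℂ × ℝ) : ℂ × ℝ := (p.1 ^ N, p.2)

/-- The branched CR structure has ramification order `N` around the edge `e`: every point of `e`
has a neighbourhood with a chart that is identified with the standard branching map of order `N`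
by a homeomorphism of the neighbourhood onto an open set of Heisenberg space which maps `e` to the
`t`-axis. -/
def HasRamificationOrder (e : Set (Bundle w)) (N : ℕ) : Prop :=
  0 < N ∧ ∀ p ∈ e, ∃ (U : Set (Bundle w)) (φ : Bundle w → CR) (h : Bundle w → ℂ × ℝ),
    p ∈ U ∧ IsChart U φ ∧ IsOpenEmbedding (U.domRestrict h) ∧
    (∀ x ∈ U, φ x = OnePoint.some (branchingMap N (h x))) ∧
    (∀ x ∈ U, x ∈ e ↔ (h x).1 = 0)

end

end

end TorusBundleCR

namespace TorusBundleCR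

open Complex Matrix Topology Filter

noncomputable section

/-! ### The Hermitian form and the action on the CR sphere -/

/-! Let l be the number of letters L between w_j and the next letter R; this l is n_j. One turn
around e_j meets exactly l + 4 edges of cells: the edge (24) of the slab at the next R, the edges
(14) of slab j and of tetrahedron j, and the edges (24) of the tetrahedra j + 1, …, j + l + 1, the
last of which is glued back to the first slab. All of them are vertical rays over 1 or -ω, above
height √3.

Use cylindrical coordinates r, θ and a Heisenberg height t centred at these rays. Then `G₃` carries
the line over 1 to the line over -ω and adds π/3 to θ, while `G₂` preserves the line over -ω and
subtracts π/3; r and t never change. So the geometry near e_j is an addition of angles. In the tube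
r < 1/10, t > √3 + 8 r the bottom faces are out of reach, and each cell is determined by its
projection to the z-plane, a sector bounded by straight rays or arcs of unit circles. At distance r
an arc deviates from its tangent by ψ = arcsin (r/2); these corrections cancel in the sum. The total
angle is (((1 - l) mod 6) + l + 5) π/3. The first term fills l + 5 up to the next multiple of 6, so
the total is 2πN with N = ⌈(l + 5)/6⌉ (`exists_isTotalAngle`).

Since gluing preserves the developed angle Θ up to 2πN (`InWedge.glue`, `InWedge.glue_symm`) and
identifies all points with equal developed coordinates (`InWedge.piHat_eq_of_angleEq`), the map to
(r^{1/N} e^{iΘ/N}, t) descends to the bundle. It is an open embedding by the compactness criterion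
`isOpenEmbedding_of_param`, and its branched image is a chart. The same bookkeeping of wedges gives
the valence (`valence_eq`).

For uniqueness, a chart near a point of e_j is a CR transformation of the developed coordinates on
each wedge. Neighbouring wedges share axis points and a point off the axis, which forces their
transformations to act equally (`act_eq_act_of_axis`). Hence any two charts have the same fibres
near the edge, and counting the N points of a fibre compares the two orders (`le_of_branchingMap`).
-/

theorem herm_eq (z w : Fin 3 → ℂ) :
    herm z w = star (w 0) * z 2 + star (w 1) * z 1 + star (w 2) * z 0 := by
  simp [herm, formJ, dotProduct, mulVec, Fin.sum_univ_three]

theorem formJ_mul_self : formJ * formJ = 1 := by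
  ext i j
  fin_cases i <;> fin_cases j <;> simp [formJ, Matrix.mul_apply, Fin.sum_univ_three]

theorem proj_of_ne {v : Fin 3 → ℂ} (h : v 2 ≠ 0) :
    proj v = OnePoint.some (v 1 / v 2, (2 * (v 0 / v 2)).im) := by
  simp [proj, h]

theorem proj_of_eq {v : Fin 3 → ℂ} (h : v 2 = 0) : proj v = OnePoint.infty := by
  simp [proj, h]

theorem proj_smul {c : ℂ} (hc : c ≠ 0) (v : Fin 3 → ℂ) : proj (c • v) = proj v := by
  by_cases h : v 2 = 0
  · rw [proj_of_eq h, proj_of_eq (by simp [h])]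
  · rw [proj_of_ne h, proj_of_ne (by simp [h, hc])]
    simp [mul_div_mul_left _ _ hc]

theorem proj_lift (P : CR) : proj (lift P) = P := by
  induction P using OnePoint.rec with
  | infty => simp [proj, lift]
  | coe p =>
    obtain ⟨z, t⟩ := p
    have h : lift ((z, t) : ℂ × ℝ) = ![(I * t - (‖z‖ : ℂ) ^ 2) / 2, z, 1] := rfl
    rw [h, proj_of_ne (by simp)]
    have : ((‖z‖ : ℂ) ^ 2).im = 0 := by norm_cast
    simp [mul_div_cancel₀, this]

theorem herm_lift (P : CR) : herm (lift P) (lift P) = 0 := by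
  induction P using OnePoint.rec with
  | infty => simp [herm_eq, lift]
  | coe p =>
    obtain ⟨z, t⟩ := p
    have h : lift ((z, t) : ℂ × ℝ) = ![(I * t - (‖z‖ : ℂ) ^ 2) / 2, z, 1] := rfl
    rw [h, herm_eq]
    have h2 := Complex.conj_mul' z
    simp only [cons_val_zero, cons_val_one, cons_val, star_one, one_mul, mul_one, star_def,
      map_div₀, map_sub, map_mul, conj_I, conj_ofReal, map_pow, h2, map_ofNat]
    ring

theorem lift_ne_zero (P : CR) : lift P ≠ 0 := by
  induction P using OnePoint.rec with
  | infty => exact fun h => by simpa [lift] using congrFun h 0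
  | coe p => exact fun h => by simpa [lift] using congrFun h 2

/-- Nullity determines the real part of `v 0 / v 2`, the one datum that `proj` discards, from `v 1 /
v 2`; if `v 2 = 0` it forces `v 1 = 0`. So a null vector is recovered from its point up to scale. -/
theorem exists_smul_lift {v : Fin 3 → ℂ} (h : herm v v = 0) (hv : v ≠ 0) :
    ∃ c : ℂ, c ≠ 0 ∧ v = c • lift (proj v) := by
  rw [herm_eq] at h
  by_cases h2 : v 2 = 0
  · have h1 : v 1 = 0 := by simpa [h2] using h
    refine ⟨v 0, fun h0 => hv ?_, ?_⟩
    · ext i; fin_cases i <;> simp [h0, h1, h2]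
    · rw [proj_of_eq h2]
      ext i; fin_cases i <;> simp [lift, h1, h2]
  · refine ⟨v 2, h2, ?_⟩
    rw [proj_of_ne h2]
    have key : (I * ((2 * (v 0 / v 2)).im : ℝ) - (‖v 1 / v 2‖ : ℂ) ^ 2) / 2 = v 0 / v 2 := by
      have e : star (v 0 / v 2) + star (v 1 / v 2) * (v 1 / v 2) + v 0 / v 2 = 0 := by
        have h2' : (starRingEnd ℂ) (v 2) ≠ 0 := by simpa using h2
        simp only [star_def, map_div₀] at h ⊢
        field_simp
        linear_combination h
      have e' := Complex.conj_mul' (v 1 / v 2)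
      simp only [star_def] at e
      rw [e'] at e
      have e2 : (‖v 1 / v 2‖ : ℂ) ^ 2 = -(2 * (v 0 / v 2)).re := by
        have := congrArg re e
        rw [← ofReal_pow] at this ⊢
        simp only [add_re, conj_re, ofReal_re, zero_re, mul_re, re_ofNat, im_ofNat, zero_mul,
          sub_zero] at this ⊢
        norm_cast
        linarith
      rw [e2]
      have := Complex.re_add_im (2 * (v 0 / v 2))
      linear_combination this / 2
    ext i
    fin_cases i
    · change v 0 = v 2 * ((I * ((2 * (v 0 / v 2)).im : ℝ) - (‖v 1 / v 2‖ : ℂ) ^ 2) / 2)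
      rw [key]; field_simp
    · change v 1 = v 2 * (v 1 / v 2)
      field_simp
    · change v 2 = v 2 * 1
      simp

namespace IsU21

variable {A B : Matrix (Fin 3) (Fin 3) ℂ}

theorem herm_mulVec (h : IsU21 A) (v w : Fin 3 → ℂ) : herm (A *ᵥ v) (A *ᵥ w) = herm v w := by
  have h' : Aᴴ * formJ * A = formJ := h
  unfold herm
  rw [star_mulVec, ← dotProduct_mulVec, mulVec_mulVec, mulVec_mulVec, h']

theorem mul (hA : IsU21 A) (hB : IsU21 B) : IsU21 (A * B) := by
  have hA' : Aᴴ * formJ * A = formJ := hA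
  have hB' : Bᴴ * formJ * B = formJ := hB
  unfold IsU21
  calc (A * B)ᴴ * formJ * (A * B) = Bᴴ * (Aᴴ * formJ * A) * B := by
        simp only [conjTranspose_mul, Matrix.mul_assoc]
    _ = formJ := by rw [hA', hB']

theorem exists_inv (h : IsU21 A) : ∃ B, IsU21 B ∧ B * A = 1 ∧ A * B = 1 := by
  have h' : Aᴴ * formJ * A = formJ := h
  have h1 : formJ * Aᴴ * formJ * A = 1 := by
    calc formJ * Aᴴ * formJ * A = formJ * (Aᴴ * formJ * A) := by simp only [Matrix.mul_assoc]
      _ = 1 := by rw [h', formJ_mul_self]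
  have h2 := mul_eq_one_comm.mp h1
  refine ⟨_, ?_, h1, h2⟩
  set B := formJ * Aᴴ * formJ
  calc Bᴴ * formJ * B = Bᴴ * (Aᴴ * formJ * A) * B := by rw [h']
    _ = (A * B)ᴴ * formJ * (A * B) := by simp only [conjTranspose_mul, Matrix.mul_assoc]
    _ = formJ := by rw [h2]; simp

theorem mulVec_ne_zero (h : IsU21 A) {v : Fin 3 → ℂ} (hv : v ≠ 0) : A *ᵥ v ≠ 0 := by
  obtain ⟨B, -, hB, -⟩ := h.exists_inv
  intro h0
  apply hv
  rw [← one_mulVec v, ← hB, ← mulVec_mulVec, h0, mulVec_zero]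

theorem exists_smul_lift_act (h : IsU21 A) (P : CR) :
    ∃ c : ℂ, c ≠ 0 ∧ A *ᵥ lift P = c • lift (act A P) :=
  exists_smul_lift (by rw [h.herm_mulVec, herm_lift]) (h.mulVec_ne_zero (lift_ne_zero P))

/-- Only `B` has to preserve the form: the intermediate vector must be null to be recovered from its
projection, whereas the outer matrix is merely applied to it. -/
theorem act_mul (hB : IsU21 B) (A : Matrix (Fin 3) (Fin 3) ℂ) (P : CR) :
    act (A * B) P = act A (act B P) := by
  obtain ⟨c, hc, h⟩ := hB.exists_smul_lift_act P
  rw [act, ← mulVec_mulVec, h, mulVec_smul, proj_smul hc]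
  rfl

end IsU21

theorem act_one (P : CR) : act 1 P = P := by
  rw [act, one_mulVec, proj_lift]

theorem isU21_one : IsU21 1 := by simp [IsU21]

theorem IsU21.act_injective {A : Matrix (Fin 3) (Fin 3) ℂ} (h : IsU21 A) :
    Function.Injective (act A) := by
  obtain ⟨B, -, hB, -⟩ := h.exists_inv
  intro P Q hPQ
  rw [← act_one P, ← act_one Q, ← hB, h.act_mul, h.act_mul, hPQ]

/-! ### The cube root of unity -/

theorem om_re : om.re = -(1 / 2) := by simp [om]

theorem om_im : om.im = -(√3 / 2) := by simp [om]; ring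

theorem sqrt_three_sq : √3 * √3 = 3 := Real.mul_self_sqrt (by norm_num)

theorem sqrt_three_sq' : √3 ^ 2 = 3 := Real.sq_sqrt (by norm_num)

theorem sqrt_three_gt : 1.7 < √3 := Real.lt_sqrt_of_sq_lt (by norm_num)

theorem sqrt_three_lt : √3 < 1.8 := (Real.sqrt_lt' (by norm_num)).mpr (by norm_num)

theorem star_om : star om = -1 - om := by
  apply Complex.ext <;> simp [om_re, om_im]; norm_num

theorem om_sq : om ^ 2 = -1 - om := by
  have := sqrt_three_sq
  apply Complex.ext <;> simp [pow_two, om_re, om_im]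
  · nlinarith
  · ring

theorem om_mul : om * om = -1 - om := by rw [← om_sq, pow_two]

theorem normSq_eq (z : ℂ) : ‖z‖ ^ 2 = z.re ^ 2 + z.im ^ 2 := by
  rw [Complex.sq_norm, Complex.normSq_apply]; ring

/-! ### Polar coordinates around vertical lines -/

/-- The point with polar coordinates `r`, `θ` and height `t` in the Heisenberg coordinates centred
at the vertical line over `a`. -/
def place (a : ℂ) (θ r t : ℝ) : ℂ × ℝ :=
  (a + r * exp (θ * I), t - 2 * (star a * (a + r * exp (θ * I))).im)

/-- The height in the Heisenberg coordinates centred at the vertical line over `a`. -/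
def height (a : ℂ) (p : ℂ × ℝ) : ℝ := p.2 + 2 * (star a * p.1).im

theorem height_place (a : ℂ) (θ r t : ℝ) : height a (place a θ r t) = t := by
  simp [height, place]

theorem norm_place_sub (a : ℂ) (θ t : ℝ) {r : ℝ} (hr : 0 ≤ r) :
    ‖(place a θ r t).1 - a‖ = r := by
  simp [place, Complex.norm_exp_ofReal_mul_I, abs_of_nonneg hr]

/-- The free centre `c` of the branch of the argument allows it to be adapted to the sector in
question. -/
theorem exists_polar (z : ℂ) (c : ℝ) :
    ∃ θ : ℝ, c - Real.pi < θ ∧ θ ≤ c + Real.pi ∧ z = ‖z‖ * exp (θ * I) := by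
  set y := z * exp (-(c * I))
  refine ⟨c + arg y, by linarith [neg_pi_lt_arg y], by linarith [arg_le_pi y], ?_⟩
  have h1 := norm_mul_exp_arg_mul_I y
  have h2 : ‖y‖ = ‖z‖ := by
    rw [norm_mul, ← neg_mul, ← ofReal_neg, norm_exp_ofReal_mul_I, mul_one]
  have h3 : z = y * exp (c * I) := by
    rw [mul_assoc, ← Complex.exp_add]; simp
  conv_lhs => rw [h3, ← h1, h2]
  rw [mul_assoc, ← Complex.exp_add]
  push_cast
  ring_nf

theorem place_zero (a : ℂ) (θ θ' t : ℝ) : place a θ 0 t = place a θ' 0 t := by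
  simp [place]

theorem place_zero_eq {a : ℂ} (ha : ‖a‖ = 1) (θ t : ℝ) : place a θ 0 t = (a, t) := by
  have : (star a * a).im = 0 := by
    rw [star_def, Complex.conj_mul', ha]; simp
  simp only [place, ofReal_zero, zero_mul, add_zero, this]; simp

theorem exp_add_two_pi (θ : ℝ) (n : ℤ) :
    exp ((θ + 2 * Real.pi * n : ℝ) * I) = exp (θ * I) := by
  rw [Complex.exp_eq_exp_iff_exists_int]
  exact ⟨n, by push_cast; ring⟩

theorem place_add_two_pi (a : ℂ) (θ r t : ℝ) (n : ℤ) :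
    place a (θ + 2 * Real.pi * n) r t = place a θ r t := by
  simp only [place, exp_add_two_pi]

theorem continuous_place (a : ℂ) :
    Continuous fun x : ℝ × ℝ × ℝ => place a x.2.1 x.1 x.2.2 := by
  unfold place
  fun_prop

/-- The matrix of the CR transformation `place a`, which maps the vertical axis to the vertical
line over `a`, after a rotation by `ρ`. -/
def placeMatrix (a ρ : ℂ) : Matrix (Fin 3) (Fin 3) ℂ :=
  !![1, -(star a * ρ), -(1 / 2); 0, ρ, a; 0, 0, 1]

/-- The corner entry -1/2 is -|a|²/2 for a unit `a`: the matrix is a rotation followed by the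
Heisenberg translation by (a, 0). -/
theorem isU21_placeMatrix {a ρ : ℂ} (ha : ‖a‖ = 1) (hρ : ‖ρ‖ = 1) : IsU21 (placeMatrix a ρ) := by
  have h1 := Complex.conj_mul' a
  have h2 := Complex.conj_mul' ρ
  rw [ha] at h1
  rw [hρ] at h2
  norm_num at h1 h2
  unfold IsU21 placeMatrix formJ
  ext i j
  fin_cases i <;> fin_cases j <;>
    simp [Matrix.mul_apply, Fin.sum_univ_three, conjTranspose_apply]
  · linear_combination h2
  · ring
  · have h3 : (starRingEnd ℂ) (2 : ℂ) = 2 := map_ofNat _ 2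
    rw [h3]
    linear_combination h1

theorem act_some (A : Matrix (Fin 3) (Fin 3) ℂ) (p : ℂ × ℝ) :
    act A p = proj (A *ᵥ ![(I * p.2 - (‖p.1‖ : ℂ) ^ 2) / 2, p.1, 1]) := rfl

theorem im_norm_sq (z : ℂ) : ((‖z‖ : ℂ) ^ 2).im = 0 := by norm_cast

theorem act_placeMatrix (a : ℂ) {ρ : ℂ} (p : ℂ × ℝ) :
    act (placeMatrix a ρ) p =
      OnePoint.some (a + ρ * p.1, p.2 - 2 * (star a * (ρ * p.1)).im) := by
  rw [act_some, proj_of_ne (by simp [placeMatrix, mulVec, dotProduct, Fin.sum_univ_three])]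
  congr 1
  refine Prod.ext ?_ ?_
  · simp [placeMatrix, mulVec, dotProduct, Fin.sum_univ_three]; ring
  · simp [placeMatrix, mulVec, dotProduct, Fin.sum_univ_three, im_norm_sq]
    ring

theorem act_placeMatrix_polar {a : ℂ} (ha : ‖a‖ = 1) (α θ r t : ℝ) :
    act (placeMatrix a (exp (α * I))) ((r * exp (θ * I), t) : ℂ × ℝ) =
      OnePoint.some (place a (θ + α) r t) := by
  have h0 : (star a * a).im = 0 := by
    rw [star_def, Complex.conj_mul', ha]; simp
  have e : exp (α * I) * (r * exp (θ * I)) = r * exp ((θ + α : ℝ) * I) := by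
    push_cast
    rw [add_mul, Complex.exp_add]; ring
  rw [act_placeMatrix, place]
  simp only [e, mul_add, Complex.add_im, h0, zero_add]

/-! ### The face pairings -/

theorem norm_om : ‖om‖ = 1 := by
  have h := normSq_eq om
  rw [om_re, om_im] at h
  have := sqrt_three_sq
  have h0 := norm_nonneg om
  nlinarith

theorem conj_om : (starRingEnd ℂ) om = -1 - om := star_om

theorem neg_om_eq : -om = exp ((Real.pi / 3 : ℝ) * I) := by
  rw [Complex.exp_mul_I, ← ofReal_cos, ← ofReal_sin, Real.cos_pi_div_three,
    Real.sin_pi_div_three]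
  simp [om]; ring

theorem neg_star_om_eq : -star om = exp ((-(Real.pi / 3) : ℝ) * I) := by
  rw [Complex.exp_mul_I, ← ofReal_cos, ← ofReal_sin, Real.cos_neg, Real.sin_neg,
    Real.cos_pi_div_three, Real.sin_pi_div_three, star_om]
  simp [om]; ring

theorem isU21_G₂ : IsU21 G₂ := by
  have := om_mul
  unfold IsU21 G₂ formJ
  ext i j
  fin_cases i <;> fin_cases j <;>
    simp [Matrix.mul_apply, Fin.sum_univ_three, conjTranspose_apply, conj_om]
  all_goals first | linear_combination this | linear_combination -this

theorem isU21_G₃ : IsU21 G₃ := by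
  have := om_mul
  unfold IsU21 G₃ formJ
  ext i j
  fin_cases i <;> fin_cases j <;>
    simp [Matrix.mul_apply, Fin.sum_univ_three, conjTranspose_apply, conj_om]
  linear_combination -this

theorem act_G₃ (p : ℂ × ℝ) : act G₃ p = OnePoint.some (-om * p.1, p.2) := by
  rw [act_some, proj_of_ne (by simp [G₃, mulVec, dotProduct, Fin.sum_univ_three])]
  congr 1
  refine Prod.ext ?_ ?_
  · simp [G₃, mulVec, dotProduct, Fin.sum_univ_three]
  · simp [G₃, mulVec, dotProduct, Fin.sum_univ_three, im_norm_sq]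
    ring

theorem act_G₂ (p : ℂ × ℝ) :
    act G₂ p = OnePoint.some (-star om * p.1 + star om, p.2 + 2 * p.1.im - √3) := by
  rw [act_some, proj_of_ne (by simp [G₂, mulVec, dotProduct, Fin.sum_univ_three])]
  congr 1
  refine Prod.ext ?_ ?_
  · simp [G₂, mulVec, dotProduct, Fin.sum_univ_three]
  · simp [G₂, mulVec, dotProduct, Fin.sum_univ_three, im_norm_sq, om_im]
    ring

/-- `G₃` rotates about the t-axis by -ω = e^{iπ/3}. It turns the whole picture over 1 into the one
over -ω, so the centred radius and height are kept. -/
theorem act_G₃_place (θ r t : ℝ) :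
    act G₃ (place 1 θ r t) = OnePoint.some (place (-om) (θ + Real.pi / 3) r t) := by
  have e : -om * exp (θ * I) = exp ((θ + Real.pi / 3 : ℝ) * I) := by
    rw [neg_om_eq, ← Complex.exp_add]; push_cast; ring_nf
  have hs : star (-om) * -om = 1 := by rw [star_neg, star_om]; linear_combination om_mul * (-1)
  rw [act_G₃]
  have e1 : -om + r * exp ((θ + Real.pi / 3 : ℝ) * I) = -om * (1 + r * exp (θ * I)) := by
    rw [← e]; ring
  simp only [place, e1, ← mul_assoc, hs, star_one]

/-- The point -ω is the fixed point of z ↦ -ω̄ z + ω̄, whose multiplier is e^{-iπ/3}; the shear in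
the height of `G₂` is exactly absorbed by centring the height at -ω. -/
theorem act_G₂_place (θ r t : ℝ) :
    act G₂ (place (-om) θ r t) = OnePoint.some (place (-om) (θ - Real.pi / 3) r t) := by
  have e : -star om * exp (θ * I) = exp ((θ - Real.pi / 3 : ℝ) * I) := by
    rw [neg_star_om_eq, ← Complex.exp_add]; push_cast; ring_nf
  rw [act_G₂]
  congr 1
  refine Prod.ext ?_ ?_
  · simp only [place]
    rw [← e, star_om]
    linear_combination (norm := ring_nf) -om_sq
  · simp only [place]
    rw [← e]
    set w := r * exp (θ * I) with hw
    have e2 : star (-om) * (-om + r * (-star om * exp (θ * I))) = 1 + om * w := by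
      have : r * (-star om * exp (θ * I)) = -star om * w := by rw [hw]; ring
      rw [this, star_neg, star_om]
      linear_combination (w - 1) * om_sq
    have e3 : star (-om) * (-om + w) = 1 + (1 + om) * w := by
      rw [star_neg, star_om]; linear_combination (norm := ring_nf) - om_sq
    rw [e2, e3]
    simp [om_im, add_mul]
    ring

theorem isU21_pow {A : Matrix (Fin 3) (Fin 3) ℂ} (h : IsU21 A) (n : ℕ) : IsU21 (A ^ n) := by
  induction n with
  | zero => simpa using isU21_one
  | succ n ih => rw [pow_succ]; exact ih.mul h

theorem act_G₂_pow_mul_G₃_place (l : ℕ) (θ r t : ℝ) :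
    act (G₂ ^ l * G₃) (place 1 θ r t) =
      OnePoint.some (place (-om) (θ + Real.pi / 3 - l * (Real.pi / 3)) r t) := by
  induction l with
  | zero => simp [act_G₃_place]
  | succ l ih =>
    rw [pow_succ', Matrix.mul_assoc, ((isU21_pow isU21_G₂ l).mul isU21_G₃).act_mul, ih,
      act_G₂_place]
    push_cast
    ring_nf

/-! ### The projections of the standard tetrahedra to the `z`-plane -/

/-- The projection of the edge `[P₁, P₂]`: the arc of the unit circle from `1` to `-ω`. -/
def shortArc : Set ℂ := {u | u.re ^ 2 + u.im ^ 2 = 1 ∧ 0 ≤ u.im ∧ 1 / 2 ≤ u.re}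

/-- The projection of the standard tetrahedra to the `z`-plane. -/
def region : Set ℂ := {z | ‖z‖ ≤ 1 ∧ ‖z + om‖ ≤ 1 ∧ 1 ≤ ‖z - star om‖}

theorem mem_region_iff (z : ℂ) : z ∈ region ↔ z.re ^ 2 + z.im ^ 2 ≤ 1 ∧
    z.re ^ 2 + z.im ^ 2 ≤ z.re + √3 * z.im ∧ √3 * z.im - z.re ≤ z.re ^ 2 + z.im ^ 2 := by
  have h3 := sqrt_three_sq
  have h1 := normSq_eq z
  have h2 := normSq_eq (z + om)
  have h4 := normSq_eq (z - star om)
  simp only [star_om, add_re, add_im, sub_re, sub_im, om_re, om_im, neg_re, neg_im, one_re,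
    one_im] at h2 h4
  have e2 : ‖z + om‖ ^ 2 = z.re ^ 2 + z.im ^ 2 - (z.re + √3 * z.im) + 1 := by
    rw [h2]; linear_combination h3 / 4
  have e4 : ‖z - star om‖ ^ 2 = z.re ^ 2 + z.im ^ 2 - (√3 * z.im - z.re) + 1 := by
    rw [star_om, h4]; linear_combination h3 / 4
  unfold region
  rw [Set.mem_ofPred_eq, ← sq_le_one_iff₀ (norm_nonneg z), ← sq_le_one_iff₀ (norm_nonneg (z + om)),
    ← one_le_sq_iff₀ (norm_nonneg (z - star om)), h1, e2, e4]
  constructor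
  · rintro ⟨a, b, c⟩; exact ⟨a, by linarith, by linarith⟩
  · rintro ⟨a, b, c⟩; exact ⟨a, by linarith, by linarith⟩

theorem shortArc_im_le {u : ℂ} (hu : u ∈ shortArc) : u.im ≤ √3 * u.re ∧ u.im ≤ √3 / 2 := by
  obtain ⟨h1, h2, h3⟩ := hu
  have h4 := sqrt_three_sq
  have h5 := sqrt_three_gt
  constructor
  · refine (sq_le_sq₀ h2 (by positivity)).mp ?_
    rw [mul_pow, sqrt_three_sq']; nlinarith
  · refine (sq_le_sq₀ h2 (by positivity)).mp ?_
    rw [div_pow, sqrt_three_sq']; nlinarith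

/-- The expression is |b - i a ω̄|², the common denominator of the rational parametrisations below.
-/
theorem denom_pos {a b : ℝ} (ha : 0 ≤ a) (hb : 0 ≤ b) (hab : 0 < a + b) :
    0 < b ^ 2 + √3 * a * b + a ^ 2 := by
  have h5 := sqrt_three_gt
  have : 0 ≤ (√3 - 1) * (a * b) := mul_nonneg (by linarith) (mul_nonneg ha hb)
  nlinarith [mul_nonneg ha hb]

theorem denom_re (a b : ℝ) : (b - I * a * star om : ℂ).re = b + √3 * a / 2 := by
  simp [star_om, om_re, om_im]; ring

theorem denom_im (a b : ℝ) : (b - I * a * star om : ℂ).im = a / 2 := by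
  simp [star_om, om_re, om_im]; ring

/-- The numbers b / (b - i a ω̄) trace the projection of the edge from 0 to 1. Turning this curve
about 0 by the points of `shortArc` stays in the region: after multiplication by the positive
denominator, the three circle conditions are polynomial inequalities in a, b and the coordinates of
u. -/
theorem mem_region_of {u z : ℂ} (hu : u ∈ shortArc) {a b : ℝ} (ha : 0 ≤ a) (hb : 0 ≤ b)
    (hab : 0 < a + b) (hz : z * (b - I * a * star om) = u * b) :
    z ∈ region ∧ ‖z‖ ^ 2 * (b ^ 2 + √3 * a * b + a ^ 2) = b ^ 2 := by
  have hD := denom_pos ha hb hab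
  obtain ⟨hi1, hi2⟩ := shortArc_im_le hu
  obtain ⟨hu1, hu2, hu3⟩ := hu
  have h3 := sqrt_three_sq
  have hre := congrArg re hz
  have him := congrArg im hz
  rw [mul_re, denom_re, denom_im, mul_re, ofReal_re, ofReal_im] at hre
  rw [mul_im, denom_re, denom_im, mul_im, ofReal_re, ofReal_im] at him
  set D := b ^ 2 + √3 * a * b + a ^ 2 with hDdef
  have hx : z.re * D = b * (u.re * (b + √3 * a / 2) + u.im * (a / 2)) := by
    rw [hDdef]
    linear_combination (b + √3 * a / 2) * hre + (a / 2) * him - z.re * a ^ 2 / 4 * h3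
  have hy : z.im * D = b * (u.im * (b + √3 * a / 2) - u.re * (a / 2)) := by
    rw [hDdef]
    linear_combination (b + √3 * a / 2) * him - (a / 2) * hre - z.im * a ^ 2 / 4 * h3
  have hn : (z.re ^ 2 + z.im ^ 2) * D = b ^ 2 := by
    have : (z.re ^ 2 + z.im ^ 2) * D = (z.re * (b + √3 * a / 2) - z.im * (a / 2)) ^ 2
        + (z.re * (a / 2) + z.im * (b + √3 * a / 2)) ^ 2 := by
      rw [hDdef]; linear_combination -(z.re ^ 2 + z.im ^ 2) * a ^ 2 / 4 * h3
    rw [this, hre, him]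
    linear_combination b ^ 2 * hu1
  refine ⟨(mem_region_iff z).mpr ⟨?_, ?_, ?_⟩, by rw [normSq_eq]; exact hn⟩
  · refine le_of_mul_le_mul_right ?_ hD
    rw [hn, hDdef]
    have : 0 ≤ √3 * a * b := by positivity
    nlinarith
  · refine le_of_mul_le_mul_right ?_ hD
    have e : b ^ 2 - (z.re * D + √3 * (z.im * D))
        = -(b * (b * (√3 * u.im - (1 - u.re)) + 2 * a * u.im)) := by
      rw [hx, hy]; linear_combination - a * b * u.im / 2 * h3
    have k : 1 - u.re ≤ √3 * u.im := by nlinarith [sqrt_three_gt]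
    have : 0 ≤ b * (b * (√3 * u.im - (1 - u.re)) + 2 * a * u.im) := by
      have := mul_nonneg hb (sub_nonneg.mpr k)
      positivity
    linarith
  · refine le_of_mul_le_mul_right ?_ hD
    have e : b ^ 2 - (√3 * (z.im * D) - z.re * D)
        = b * (b * (1 + u.re - √3 * u.im) + a * (√3 * u.re - u.im)) := by
      rw [hx, hy]; linear_combination - a * b * u.im / 2 * h3
    have k : √3 * u.im ≤ 1 + u.re := by nlinarith [sqrt_three_gt]
    have : 0 ≤ b * (b * (1 + u.re - √3 * u.im) + a * (√3 * u.re - u.im)) := by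
      have := mul_nonneg hb (sub_nonneg.mpr k)
      have := mul_nonneg ha (sub_nonneg.mpr hi1)
      positivity
    linarith

/-- The two inequalities are what the disc about -ω and the exterior of the disc about ω̄ say about
the rotation parameter u; on the unit circle they leave only the short arc. -/
theorem mem_shortArc_of {u : ℂ} {a : ℝ} (ha : 0 ≤ a) (hu : u.re ^ 2 + u.im ^ 2 = 1)
    (h1 : 1 - u.re ≤ (√3 + 2 * a) * u.im)
    (h2 : 0 ≤ (1 + u.re - √3 * u.im) + a * (√3 * u.re - u.im)) : u ∈ shortArc := by
  have h5 := sqrt_three_gt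
  have hure : u.re ≤ 1 := by nlinarith [sq_nonneg u.im]
  have hσ : 0 ≤ u.im := by
    by_contra hneg
    push Not at hneg
    have : (√3 + 2 * a) * u.im < 0 := mul_neg_of_pos_of_neg (by positivity) hneg
    linarith
  refine ⟨hu, hσ, ?_⟩
  -- If Re u < 1/2, then u is beyond -ω on the circle, so the `a`-term of `h2` is nonpositive and
  -- may be dropped. Squaring what remains gives (1 + Re u)(2 - 4 Re u) ≤ 0, which fails for -1 < Re
  -- u < 1/2.
  by_contra hc
  push Not at hc
  have hσ2 : √3 * u.re < u.im := by
    by_contra hle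
    push Not at hle
    have h7 : 0 ≤ u.re := nonneg_of_mul_nonneg_right (hσ.trans hle) (by linarith)
    have h8 := pow_le_pow_left₀ hσ hle 2
    rw [mul_pow, sqrt_three_sq'] at h8
    have h9 : u.re ^ 2 < (1 / 2) ^ 2 := pow_lt_pow_left₀ hc h7 (by norm_num)
    linarith
  have k3 : √3 * u.im ≤ 1 + u.re := by
    have := mul_nonneg ha (sub_nonneg.mpr hσ2.le)
    linarith
  have hm : u.re ≠ -1 := by
    intro h
    have : u.im = 0 := by
      have : u.im ^ 2 = 0 := by rw [h] at hu; linarith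
      simpa using this
    rw [h, this] at h1
    linarith
  have hm' : -1 < u.re := by
    have : 0 ≤ √3 * u.im := by positivity
    exact lt_of_le_of_ne (by linarith) (Ne.symm hm)
  have h8 := pow_le_pow_left₀ (by positivity) k3 2
  rw [mul_pow, sqrt_three_sq'] at h8
  have h9 := mul_pos (by linarith : 0 < 1 + u.re) (by linarith : 0 < 2 - 4 * u.re)
  linarith [show 3 * (1 - u.re ^ 2) - (1 + u.re) ^ 2 = (1 + u.re) * (2 - 4 * u.re) by ring]

theorem exists_of_mem_region {z : ℂ} (hz : z ∈ region) : ∃ u ∈ shortArc, ∃ a b : ℝ, 0 ≤ a ∧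
    0 ≤ b ∧ 0 < a + b ∧ z * (b - I * a * star om) = u * b := by
  have h3 := sqrt_three_sq
  have h5 := sqrt_three_gt
  by_cases h0 : z = 0
  · exact ⟨1, by simp [shortArc]; norm_num, 1, 0, by simp, by simp, by simp, by simp [h0]⟩
  obtain ⟨g1, g2, g3⟩ := (mem_region_iff z).mp hz
  set n := z.re ^ 2 + z.im ^ 2 with hn
  have hnpos : 0 < n := by
    rw [hn, ← normSq_eq]; have := norm_pos_iff.mpr h0; positivity
  -- With b = 1 the parameter a must satisfy |z|² (1 + √3 a + a²) = 1. The root is (q - √3)/2, and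
  -- |z| ≤ 1 makes it nonnegative.
  set q := √(4 / n - 1) with hq
  have hq3 : 3 ≤ 4 / n - 1 := by
    have : 4 ≤ 4 / n := by rw [le_div_iff₀ hnpos]; linarith
    linarith
  have hqq : q * q = 4 / n - 1 := Real.mul_self_sqrt (by linarith)
  have hq' : √3 ≤ q := Real.sqrt_le_sqrt hq3
  set a := (q - √3) / 2 with ha
  have ha0 : 0 ≤ a := by rw [ha]; linarith
  have hD : n * (1 + √3 * a + a ^ 2) = 1 := by
    have : 1 + √3 * a + a ^ 2 = 1 / n := by
      rw [ha]; linear_combination hqq / 4 - h3 / 4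
    rw [this]; field_simp
  refine ⟨z * ((1 : ℝ) - I * a * star om), ?_, a, 1, ha0, zero_le_one, by linarith, by simp⟩
  have hre : (z * ((1 : ℝ) - I * a * star om)).re = z.re * (1 + √3 * a / 2) - z.im * (a / 2) := by
    rw [mul_re, denom_re, denom_im]
  have him : (z * ((1 : ℝ) - I * a * star om)).im = z.im * (1 + √3 * a / 2) + z.re * (a / 2) := by
    rw [mul_im, denom_re, denom_im]; ring
  set u := z * ((1 : ℝ) - I * a * star om)
  set D := 1 + √3 * a + a ^ 2 with hDdef
  have hDpos : 0 < D := by positivity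
  have hu1 : u.re ^ 2 + u.im ^ 2 = 1 := by
    have hD' : (z.re ^ 2 + z.im ^ 2) * (1 + √3 * a + a ^ 2) = 1 := hD
    rw [hre, him]
    linear_combination hD' + (z.re ^ 2 + z.im ^ 2) * a ^ 2 / 4 * h3
  have hx : z.re * D = u.re * (1 + √3 * a / 2) + u.im * (a / 2) := by
    rw [hre, him, hDdef]; linear_combination - z.re * a ^ 2 / 4 * h3
  have hy : z.im * D = u.im * (1 + √3 * a / 2) - u.re * (a / 2) := by
    rw [hre, him, hDdef]; linear_combination - z.im * a ^ 2 / 4 * h3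
  have k1 : 1 - u.re ≤ (√3 + 2 * a) * u.im := by
    have := mul_le_mul_of_nonneg_right g2 hDpos.le
    have e : n * D - (z.re + √3 * z.im) * D = 1 - u.re - (√3 + 2 * a) * u.im := by
      rw [hD, add_mul, mul_assoc, hx, hy]; linear_combination - a * u.im / 2 * h3
    linarith
  have k2 : 0 ≤ (1 + u.re - √3 * u.im) + a * (√3 * u.re - u.im) := by
    have := mul_le_mul_of_nonneg_right g3 hDpos.le
    have e : n * D - (√3 * z.im - z.re) * D
        = (1 + u.re - √3 * u.im) + a * (√3 * u.re - u.im) := by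
      rw [hD, sub_mul, mul_assoc, hx, hy]; linear_combination - a * u.im / 2 * h3
    linarith
  exact mem_shortArc_of ha0 hu1 k1 k2

/-- The reflection of the projection of the standard tetrahedra that exchanges `0` and `-ω`. -/
theorem reflect_mem_region {z : ℂ} (hz : z ∈ region) : -om - star om * star z ∈ region := by
  obtain ⟨h1, h2, h3⟩ := hz
  have hs := star_om
  have hn : ‖star om‖ = 1 := by rw [norm_star, norm_om]
  have key : ∀ x y : ℂ, (∃ c : ℂ, ‖c‖ = 1 ∧ x = c * star y) → ‖x‖ = ‖y‖ := by
    rintro x y ⟨c, hc, rfl⟩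
    rw [norm_mul, hc, norm_star, one_mul]
  refine ⟨?_, ?_, ?_⟩
  · rw [key (-om - star om * star z) (z + om) ⟨-star om, by rw [norm_neg, hn], ?_⟩]
    · exact h2
    · rw [star_add, hs]; linear_combination om_sq
  · rw [key (-om - star om * star z + om) z ⟨-star om, by rw [norm_neg, hn], by ring⟩]
    exact h1
  · rw [key (-om - star om * star z - star om) (z - star om) ⟨-star om, by rw [norm_neg, hn], ?_⟩]
    · exact h3
    · rw [star_sub, star_star, hs]; linear_combination om_sq

theorem reflect_reflect (z : ℂ) : -om - star om * star (-om - star om * star z) = z := by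
  simp only [star_sub, star_mul', star_neg, star_star, star_om, star_one]
  linear_combination (1 - z) * om_sq

/-! ### Edges and faces of the standard cells -/

theorem lift_some (z : ℂ) (t : ℝ) :
    lift (OnePoint.some (z, t)) = ![(I * t - (‖z‖ : ℂ) ^ 2) / 2, z, 1] := rfl

theorem lift_of_re_im {z x : ℂ} {t : ℝ} (h1 : -(2 * x.re) = z.re ^ 2 + z.im ^ 2)
    (h2 : t = 2 * x.im) : lift (OnePoint.some (z, t)) = ![x, z, 1] := by
  rw [lift_some, ← ofReal_pow, normSq_eq, ← h1, h2]
  congr 1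
  apply Complex.ext <;> simp

theorem lift_P₃ : lift P₃ = ![0, 0, 1] := by
  simp [P₃, lift_some]

/-- At height √3 over the unit circle the first coordinate is the constant (i√3 - 1)/2 = ω̄, so
along [P₁, P₂] only the middle coordinate of the lift varies. -/
theorem lift_arc {u : ℂ} (hu : u ∈ shortArc) :
    lift (OnePoint.some (u, √3)) = ![star om, u, 1] := by
  refine lift_of_re_im ?_ ?_
  · rw [hu.1, star_om]; simp [om_re]; norm_num
  · rw [star_om]; simp [om_im]; ring

theorem one_mem_shortArc : (1 : ℂ) ∈ shortArc := by simp [shortArc]; norm_num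

theorem neg_om_mem_shortArc : -om ∈ shortArc := by
  refine ⟨?_, ?_, ?_⟩
  · simp [om_re, om_im, div_pow]; norm_num
  · simp [om_im]; positivity
  · simp [om_re]

theorem norm_of_mem_shortArc {u : ℂ} (hu : u ∈ shortArc) : ‖u‖ = 1 := by
  have h := normSq_eq u
  rw [hu.1] at h
  have h0 := norm_nonneg u
  nlinarith

/-- Homogeneous parametrisation of the arc by the positive quadrant. -/
theorem mem_shortArc_iff (u : ℂ) : u ∈ shortArc ↔ ∃ a b : ℝ, 0 ≤ a ∧ 0 ≤ b ∧ 0 < a + b ∧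
    u * (a + I * b * om) = a - I * b * star om := by
  have h3 := sqrt_three_sq
  have h5 := sqrt_three_gt
  have hw1 : ∀ a b : ℝ, (a + I * b * om : ℂ).re = a + √3 * b / 2 := by
    intro a b; simp [om_re, om_im]; ring
  have hw2 : ∀ a b : ℝ, (a + I * b * om : ℂ).im = -(b / 2) := by
    intro a b; simp [om_re, om_im]; ring
  constructor
  · intro hu
    have k := (shortArc_im_le hu).1
    obtain ⟨h1, h2, h4⟩ := hu
    have k2 : √3 * u.im ≤ 1 + u.re := by nlinarith
    -- The equation says u = (p + i b/2)/(p - i b/2) with p = a + √3 b/2. By the half-angle formula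
    -- p : b/2 = (1 + Re u) : Im u, which gives these values.
    refine ⟨1 + u.re - √3 * u.im, 2 * u.im, by linarith, by linarith, ?_, ?_⟩
    · nlinarith [sqrt_three_lt]
    · apply Complex.ext
      · rw [mul_re, hw1, hw2, denom_re]
        linear_combination h1
      · rw [mul_im, hw1, hw2, denom_im]
        ring
  · rintro ⟨a, b, ha, hb, hab, h⟩
    have hre := congrArg re h
    have him := congrArg im h
    rw [mul_re, hw1, hw2, denom_re] at hre
    rw [mul_im, hw1, hw2, denom_im] at him
    have hD := denom_pos hb ha (by linarith)
    set p := a + √3 * b / 2 with hp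
    have hp0 : 0 ≤ p := by positivity
    have hDp : a ^ 2 + √3 * b * a + b ^ 2 = p ^ 2 + (b / 2) ^ 2 := by
      rw [hp]; linear_combination - b ^ 2 / 4 * h3
    rw [hDp] at hD
    have e1 : u.re * (p ^ 2 + (b / 2) ^ 2) = p ^ 2 - (b / 2) ^ 2 := by
      linear_combination p * hre - b / 2 * him
    have e2 : u.im * (p ^ 2 + (b / 2) ^ 2) = 2 * p * (b / 2) := by
      linear_combination p * him + b / 2 * hre
    refine ⟨?_, ?_, ?_⟩
    · refine mul_right_cancel₀ hD.ne' ?_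
      linear_combination (u.re * p + u.im * (b / 2) + p) * hre +
        (u.im * p - u.re * (b / 2) + b / 2) * him
    · refine nonneg_of_mul_nonneg_left ?_ hD
      rw [e2]; positivity
    · refine le_of_mul_le_mul_right ?_ hD
      rw [e1]
      have : 3 * (b / 2) ^ 2 ≤ p ^ 2 := by
        have h6 : √3 * b / 2 ≤ p := by rw [hp]; linarith
        have h7 := pow_le_pow_left₀ (by positivity) h6 2
        rw [div_pow, mul_pow, sqrt_three_sq'] at h7
        linarith
      linarith

/-- Homogeneous coordinates on the segment treat the endpoint `Q` (a = 0) like every other point. -/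
theorem mem_edge_iff {P Q : CR} (h : herm (lift P) (lift Q) ≠ 0) (X : CR) :
    X ∈ edge P Q ↔ ∃ a b : ℝ, 0 ≤ a ∧ 0 ≤ b ∧ 0 < a + b ∧
      X = proj ((a : ℂ) • lift P + (I * b * herm (lift P) (lift Q)) • lift Q) := by
  constructor
  · rintro (⟨s, hs, rfl⟩ | rfl)
    · exact ⟨1, s, zero_le_one, hs, by linarith, by simp⟩
    · refine ⟨0, 1, le_rfl, zero_le_one, by norm_num, ?_⟩
      rw [ofReal_zero, zero_smul, zero_add, proj_smul (by simp [h]), proj_lift]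
  · rintro ⟨a, b, ha, hb, hab, rfl⟩
    rcases ha.eq_or_lt with rfl | ha
    · right
      have : b ≠ 0 := by linarith
      rw [ofReal_zero, zero_smul, zero_add, proj_smul (by simp [h, this]), proj_lift]
      rfl
    · left
      refine ⟨b / a, by positivity, ?_⟩
      have ha' : (a : ℂ) ≠ 0 := by simpa using ha.ne'
      rw [← proj_smul ha' (lift P + _), smul_add]
      have e : (a : ℂ) * (I * (b / a : ℝ) * herm (lift P) (lift Q))
          = I * b * herm (lift P) (lift Q) := by push_cast; field_simp
      rw [smul_smul, e]

/-- The Hermitian product of all the lifts joined below is ω. Then the weight of the second lift,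
after normalising the last coordinate, is i b ω/(a + i b ω) = ω(u - 1) with u in `shortArc`: each
such edge is an affine image of one and the same arc. -/
theorem mem_edge_iff_arc {P Q : CR} {p₀ p₁ q₀ q₁ : ℂ} (hP : lift P = ![p₀, p₁, 1])
    (hQ : lift Q = ![q₀, q₁, 1]) (h : herm (lift P) (lift Q) = om) (X : CR) :
    X ∈ edge P Q ↔ ∃ u ∈ shortArc,
      X = OnePoint.some ((1 - om * (u - 1)) * p₁ + om * (u - 1) * q₁,
        2 * ((1 - om * (u - 1)) * p₀ + om * (u - 1) * q₀).im) := by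
  have h0 : om ≠ 0 := by intro h; have := norm_om; rw [h] at this; simp at this
  have key : ∀ (a b : ℝ) (u : ℂ), 0 ≤ a → 0 ≤ b → 0 < a + b →
      u * (a + I * b * om) = a - I * b * star om →
      proj ((a : ℂ) • lift P + (I * b * herm (lift P) (lift Q)) • lift Q) =
      OnePoint.some ((1 - om * (u - 1)) * p₁ + om * (u - 1) * q₁,
        2 * ((1 - om * (u - 1)) * p₀ + om * (u - 1) * q₀).im) := by
    intro a b u ha hb hab hu
    have hw : (a + I * b * om : ℂ) ≠ 0 := by
      intro hw
      have h1 := congrArg re hw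
      have h2 := congrArg im hw
      simp [om_re, om_im] at h1 h2
      have : a = 0 := by simpa [h2] using h1
      linarith
    have e1 : om * (u - 1) * (a + I * b * om) = I * b * om := by
      rw [star_om] at hu
      linear_combination om * hu
    rw [h, hP, hQ, proj_of_ne (by simpa using hw)]
    have e2 : ∀ x y : ℂ, (a * x + I * b * om * y) / (a + I * b * om)
        = (1 - om * (u - 1)) * x + om * (u - 1) * y := by
      intro x y
      rw [div_eq_iff hw]
      linear_combination (x - y) * e1
    rw [← e2, ← e2]
    simp
  rw [mem_edge_iff (by rw [h]; exact h0)]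
  constructor
  · rintro ⟨a, b, ha, hb, hab, rfl⟩
    have hD := denom_pos hb ha (by linarith)
    have hw : (a + I * b * om : ℂ) ≠ 0 := by
      intro hw
      have h1 := congrArg re hw
      have h2 := congrArg im hw
      simp [om_re, om_im] at h1 h2
      have : a = 0 := by simpa [h2] using h1
      linarith
    have hu := div_mul_cancel₀ (a - I * b * star om) hw
    exact ⟨_, (mem_shortArc_iff _).mpr ⟨a, b, ha, hb, hab, hu⟩, key a b _ ha hb hab hu⟩
  · rintro ⟨u, hu, rfl⟩
    obtain ⟨a, b, ha, hb, hab, hu⟩ := (mem_shortArc_iff _).mp hu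
    exact ⟨a, b, ha, hb, hab, (key a b u ha hb hab hu).symm⟩

theorem mem_edge_P₁_P₂ (X : CR) :
    X ∈ edge P₁ P₂ ↔ ∃ u ∈ shortArc, X = OnePoint.some (u, √3) := by
  have h1 : lift P₁ = _ := lift_arc one_mem_shortArc
  have h2 : lift P₂ = _ := lift_arc neg_om_mem_shortArc
  rw [mem_edge_iff_arc h1 h2 (by rw [h1, h2, herm_eq]; simp [conj_om]; ring)]
  refine exists_congr fun u => and_congr_right fun _ => ?_
  have e1 : (1 - om * (u - 1)) * 1 + om * (u - 1) * -om = u := by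
    linear_combination (1 - u) * om_sq
  have e2 : (1 - om * (u - 1)) * star om + om * (u - 1) * star om = star om := by ring
  have e3 : 2 * (star om).im = √3 := by rw [star_om]; simp [om_im]; ring
  rw [e1, e2, e3]

theorem herm_P₃_arc {u : ℂ} (hu : u ∈ shortArc) :
    herm (lift P₃) (lift (OnePoint.some (u, √3))) = om := by
  rw [lift_P₃, lift_arc hu, herm_eq]; simp [conj_om]

/-- These edges are rotations about the t-axis of the single edge [P₃, P₁]; hence the height does
not involve `u`. -/
theorem mem_edge_P₃_arc {u : ℂ} (hu : u ∈ shortArc) (X : CR) :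
    X ∈ edge P₃ (OnePoint.some (u, √3)) ↔
      ∃ v ∈ shortArc, X = OnePoint.some (u * (om * (v - 1)), 2 * v.im) := by
  rw [mem_edge_iff_arc lift_P₃ (lift_arc hu) (herm_P₃_arc hu)]
  refine exists_congr fun v => and_congr_right fun _ => ?_
  have e1 : (1 - om * (v - 1)) * 0 + om * (v - 1) * star om = v - 1 := by
    rw [star_om]; linear_combination (1 - v) * om_sq
  have e2 : (1 - om * (v - 1)) * 0 + om * (v - 1) * u = u * (om * (v - 1)) := by ring
  rw [e1, e2]
  simp

theorem mem_edge_P₃_P₁ (X : CR) :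
    X ∈ edge P₃ P₁ ↔ ∃ v ∈ shortArc, X = OnePoint.some (om * (v - 1), 2 * v.im) := by
  have h := mem_edge_P₃_arc one_mem_shortArc X
  simp only [one_mul] at h
  exact h

theorem mem_edge_P₃_P₂ (X : CR) :
    X ∈ edge P₃ P₂ ↔ ∃ v ∈ shortArc, X = OnePoint.some (-om * (om * (v - 1)), 2 * v.im) :=
  mem_edge_P₃_arc neg_om_mem_shortArc X

theorem mem_triPlus_P₃_P₁_P₂ (X : CR) :
    X ∈ triPlus P₃ P₁ P₂ ↔ ∃ u ∈ shortArc, ∃ v ∈ shortArc,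
      X = OnePoint.some (u * (om * (v - 1)), 2 * v.im) := by
  constructor
  · rintro ⟨Y, hY, hX⟩
    obtain ⟨u, hu, rfl⟩ := (mem_edge_P₁_P₂ Y).mp hY
    exact ⟨u, hu, (mem_edge_P₃_arc hu X).mp hX⟩
  · rintro ⟨u, hu, hX⟩
    exact ⟨_, (mem_edge_P₁_P₂ _).mpr ⟨u, hu, rfl⟩, (mem_edge_P₃_arc hu X).mpr hX⟩

theorem lift_edge_P₃_P₁ {u : ℂ} (hu : u ∈ shortArc) :
    lift (OnePoint.some (om * (u - 1), 2 * u.im)) = ![u - 1, om * (u - 1), 1] := by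
  refine lift_of_re_im ?_ (by simp)
  have h1 := hu.1
  have h3 := sqrt_three_sq
  simp [om_re, om_im]
  linear_combination (-((u.re - 1) ^ 2 + u.im ^ 2) / 4) * h3 - h1

theorem mem_triMinus_P₂_P₃_P₁ (X : CR) :
    X ∈ triMinus P₂ P₃ P₁ ↔ ∃ u ∈ shortArc, ∃ v ∈ shortArc,
      X = OnePoint.some (-om + om * u * (1 - om * (v - 1)),
        2 * ((u - 1) * (1 - om * (v - 1)) + v).im) := by
  have h2 : lift P₂ = _ := lift_arc neg_om_mem_shortArc
  have key : ∀ u ∈ shortArc, ∀ X, X ∈ edge (OnePoint.some (om * (u - 1), 2 * u.im)) P₂ ↔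
      ∃ v ∈ shortArc, X = OnePoint.some (-om + om * u * (1 - om * (v - 1)),
        2 * ((u - 1) * (1 - om * (v - 1)) + v).im) := by
    intro u hu X
    have h1 := lift_edge_P₃_P₁ hu
    rw [mem_edge_iff_arc h1 h2]
    · refine exists_congr fun v => and_congr_right fun _ => ?_
      have e1 : (1 - om * (v - 1)) * (om * (u - 1)) + om * (v - 1) * -om
          = -om + om * u * (1 - om * (v - 1)) := by ring
      have e2 : (1 - om * (v - 1)) * (u - 1) + om * (v - 1) * star om
          = ((u - 1) * (1 - om * (v - 1)) + v) - 1 := by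
        rw [star_om]; linear_combination (1 - v) * om_sq
      rw [e1, e2, sub_im, one_im, sub_zero]
    · rw [h1, h2, herm_eq]
      simp [conj_om]
      linear_combination (1 - u) * (-om_sq)
  constructor
  · rintro ⟨Y, hY, hX⟩
    obtain ⟨u, hu, rfl⟩ := (mem_edge_P₃_P₁ Y).mp hY
    exact ⟨u, hu, (key u hu X).mp hX⟩
  · rintro ⟨u, hu, hX⟩
    exact ⟨_, (mem_edge_P₃_P₁ _).mpr ⟨u, hu, rfl⟩, (key u hu X).mpr hX⟩

/-- Translates between the two parametrisations in use: the weights ω(v - 1) and, conjugated, 1 -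
ω(v - 1) are the quotients appearing in `mem_region_of`, with the roles of `a` and `b` exchanged. -/
theorem arc_param_aux {v : ℂ} {a b : ℝ} (h : v * (a + I * b * om) = a - I * b * star om) :
    om * (v - 1) * (b - I * a * star om) = b ∧
    star (1 - om * (v - 1)) * (a - I * b * star om) = a := by
  have h' : om * (v - 1) * (a + I * b * om) = I * b * om := by
    rw [star_om] at h
    linear_combination om * h
  constructor
  · have : (b - I * a * star om) * (I * om) = a + I * b * om := by
      rw [star_om]; linear_combination (a + a * om) * om * I_sq - a * om_sq
    have h0 : I * om ≠ 0 := by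
      refine mul_ne_zero I_ne_zero ?_
      intro h; have := norm_om; rw [h] at this; simp at this
    refine mul_right_cancel₀ h0 ?_
    rw [mul_assoc, this]
    linear_combination h'
  · have : star ((1 - om * (v - 1)) * (a + I * b * om)) = star (a : ℂ) := by
      congr 1; linear_combination -h'
    rw [star_mul'] at this
    convert this using 1
    · congr 1
      simp [sub_eq_add_neg]
    · simp

/-- The arc `[P₃, P₁]` in the parametrisation used for the projection of the tetrahedra. -/
theorem arc_param {v : ℂ} (hv : v ∈ shortArc) : ∃ a b : ℝ, 0 ≤ a ∧ 0 ≤ b ∧ 0 < a + b ∧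
    om * (v - 1) * (b - I * a * star om) = b ∧
    star (1 - om * (v - 1)) * (a - I * b * star om) = a := by
  obtain ⟨a, b, ha, hb, hab, h⟩ := (mem_shortArc_iff _).mp hv
  exact ⟨a, b, ha, hb, hab, arc_param_aux h⟩

theorem denom_ne_zero {a b : ℝ} (hab : 0 < a + b) :
    (b - I * a * star om : ℂ) ≠ 0 := by
  intro hw
  have h1 := congrArg re hw
  have h2 := congrArg im hw
  rw [denom_re, zero_re] at h1
  rw [denom_im, zero_im] at h2
  have h3 : a = 0 := by linarith
  rw [h3] at h1 hab
  linarith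

theorem arc_of_param {a b : ℝ} (ha : 0 ≤ a) (hb : 0 ≤ b) (hab : 0 < a + b) :
    ∃ v ∈ shortArc, om * (v - 1) * (b - I * a * star om) = b ∧
      star (1 - om * (v - 1)) * (a - I * b * star om) = a := by
  have hw : (a + I * b * om : ℂ) ≠ 0 := by
    intro hw
    apply denom_ne_zero (a := b) (b := a) (by linarith)
    have := congrArg star hw
    rw [star_zero] at this
    rw [← this]
    simp [sub_eq_add_neg]
  have hv := div_mul_cancel₀ (a - I * b * star om) hw
  exact ⟨_, (mem_shortArc_iff _).mpr ⟨a, b, ha, hb, hab, hv⟩, arc_param_aux hv⟩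

/-! ### The bottom faces -/

theorem bottom_B_subset {u v : ℂ} (hu : u ∈ shortArc) (hv : v ∈ shortArc) :
    u * (om * (v - 1)) ∈ region ∧ 2 * v.im ≤ √3 := by
  obtain ⟨a, b, ha, hb, hab, h, -⟩ := arc_param hv
  exact ⟨(mem_region_of hu ha hb hab (by rw [mul_assoc, h])).1,
    by linarith [(shortArc_im_le hv).2]⟩

theorem exists_bottom_B {z : ℂ} (hz : z ∈ region) :
    ∃ u ∈ shortArc, ∃ v ∈ shortArc, z = u * (om * (v - 1)) := by
  obtain ⟨u, hu, a, b, ha, hb, hab, h⟩ := exists_of_mem_region hz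
  obtain ⟨v, hv, h', -⟩ := arc_of_param ha hb hab
  refine ⟨u, hu, v, hv, mul_right_cancel₀ (denom_ne_zero hab) ?_⟩
  rw [h, mul_assoc, h']

/-- This is the reflection of the arc that exchanges its endpoints 1 and -ω. -/
theorem neg_om_mul_star_mem {u : ℂ} (hu : u ∈ shortArc) : -om * star u ∈ shortArc := by
  have h := shortArc_im_le hu
  obtain ⟨h1, h2, h3⟩ := hu
  have h4 := sqrt_three_sq
  have h5 := sqrt_three_gt
  have e1 : (-om * star u).re = u.re / 2 + √3 / 2 * u.im := by simp [om_re, om_im]; ring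
  have e2 : (-om * star u).im = √3 / 2 * u.re - u.im / 2 := by simp [om_re, om_im]; ring
  refine ⟨?_, ?_, ?_⟩
  · rw [e1, e2]; linear_combination h1 + (u.re ^ 2 + u.im ^ 2) / 4 * h4
  · rw [e2]; linarith [h.1]
  · rw [e1]
    nlinarith

/-- The type A face is a cone from P₂ instead of P₃. The reflection exchanging 0 and -ω turns its
projection into that of the type B face, so both types project to the same region. -/
theorem bottom_A_subset {u v : ℂ} (hu : u ∈ shortArc) (hv : v ∈ shortArc) :
    -om + om * u * (1 - om * (v - 1)) ∈ region := by
  obtain ⟨a, b, ha, hb, hab, -, h⟩ := arc_param hv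
  have h1 := (mem_region_of (z := -om * star u * star (1 - om * (v - 1)))
    (neg_om_mul_star_mem hu) hb ha (by linarith) (by rw [mul_assoc, h])).1
  have h2 := reflect_mem_region h1
  convert h2 using 1
  simp only [star_mul', star_neg, star_star, star_om]
  linear_combination (-u * (1 - om * (v - 1))) * om_sq

theorem exists_bottom_A {z : ℂ} (hz : z ∈ region) :
    ∃ u ∈ shortArc, ∃ v ∈ shortArc, z = -om + om * u * (1 - om * (v - 1)) := by
  obtain ⟨u, hu, a, b, ha, hb, hab, h⟩ := exists_of_mem_region (reflect_mem_region hz)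
  obtain ⟨v, hv, -, h'⟩ := arc_of_param hb ha (by linarith)
  refine ⟨-om * star u, neg_om_mul_star_mem hu, v, hv, ?_⟩
  have e : -om - star om * star z = u * star (1 - om * (v - 1)) := by
    refine mul_right_cancel₀ (denom_ne_zero hab) ?_
    rw [h, mul_assoc, h']
  rw [← reflect_reflect z, e, star_mul', star_star, star_om]
  linear_combination (star u * (1 - om * (v - 1))) * om_sq

/-- The face consists of rotated copies, about the vertical line through P₂, of one edge ending at
P₂. So both the centred height and the distance from -ω depend on v alone, and the claim reduces to
√3 (1 - Re v) ≤ Im v on the arc. -/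
theorem height_bottom_A {u v : ℂ} (hu : u ∈ shortArc) (hv : v ∈ shortArc) {z : ℂ} {t : ℝ}
    (hz : z = -om + om * u * (1 - om * (v - 1)))
    (ht : t = 2 * ((u - 1) * (1 - om * (v - 1)) + v).im) :
    height (-om) (z, t) ≤ √3 * (1 - ‖z + om‖ ^ 2) := by
  have h3 := sqrt_three_sq
  have h5 := sqrt_three_gt
  have e1 : height (-om) (z, t) = √3 * (1 - v.re) + v.im := by
    have : (u - 1) * (1 - om * (v - 1)) + v + star (-om) * z = star om * (1 - v) + 1 := by
      rw [hz, star_neg, star_om]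
      linear_combination (u * (1 - om * (v - 1)) - 1) * om_sq
    have := congrArg im this
    rw [add_im] at this
    rw [height, ht]
    simp only
    rw [← mul_add, this, star_om]
    simp [om_re, om_im]
    ring
  have e2 : ‖z + om‖ ^ 2 = 2 - v.re - √3 * v.im := by
    have h6 : z + om = om * u * (1 - om * (v - 1)) := by rw [hz]; ring
    rw [h6, norm_mul, norm_mul, norm_om, norm_of_mem_shortArc hu, one_mul, one_mul,
      normSq_eq]
    simp [om_re, om_im]
    linear_combination hv.1 + ((v.re - 1) ^ 2 + v.im ^ 2) / 4 * h3
  rw [e1, e2]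
  obtain ⟨k1, k2, k3⟩ := hv
  have : √3 * (1 - v.re) ≤ v.im := by
    refine (sq_le_sq₀ (mul_nonneg (by positivity) ?_) k2).mp ?_
    · nlinarith
    · rw [mul_pow, sqrt_three_sq']; nlinarith
  nlinarith

/-! ### Vertical rays and the tubes around vertical edges -/

theorem mem_edge_infty (p : ℂ × ℝ) (X : CR) :
    X ∈ edge (OnePoint.some p) P₄ ↔
      X = OnePoint.infty ∨ ∃ t, p.2 ≤ t ∧ X = OnePoint.some (p.1, t) := by
  have key : ∀ s : ℝ, proj (lift (OnePoint.some p) +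
      (I * s * herm (lift (OnePoint.some p)) (lift P₄)) • lift P₄) =
      OnePoint.some (p.1, p.2 + 2 * s) := by
    intro s
    obtain ⟨z, t⟩ := p
    have h : lift P₄ = ![1, 0, 0] := rfl
    rw [herm_eq, h, lift_some, proj_of_ne (by simp)]
    simp [im_norm_sq]
    ring
  constructor
  · rintro (⟨s, hs, rfl⟩ | rfl)
    · exact Or.inr ⟨p.2 + 2 * s, by linarith, key s⟩
    · exact Or.inl rfl
  · rintro (rfl | ⟨t, ht, rfl⟩)
    · exact Or.inr rfl
    · refine Or.inl ⟨(t - p.2) / 2, by linarith, ?_⟩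
      rw [key]
      congr 2
      ring

theorem of_mem_edge_infty_left {p : ℂ × ℝ} {X : CR} (h : X ∈ edge P₄ (OnePoint.some p)) :
    X = OnePoint.infty ∨ ∃ t, t ≤ p.2 ∧ X = OnePoint.some (p.1, t) := by
  rcases h with (⟨s, hs, rfl⟩ | rfl)
  · obtain ⟨z, t⟩ := p
    have h : lift P₄ = ![1, 0, 0] := rfl
    rcases hs.eq_or_lt with rfl | hs
    · left
      rw [h]
      exact proj_of_eq (by simp)
    · right
      refine ⟨t - 2 / s, by simp; positivity, ?_⟩
      have hs' : (s : ℂ) ≠ 0 := by simpa using hs.ne'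
      rw [herm_eq, h, lift_some, proj_of_ne (by simp [hs'])]
      congr 1
      refine Prod.ext ?_ ?_
      · simp [hs']
      · have : (1 + I * s * ((I * t - (‖z‖ : ℂ) ^ 2) / 2)) / (I * s)
            = ((I * t - (‖z‖ : ℂ) ^ 2) / 2) - I * ((1 / s : ℝ) : ℂ) := by
          push_cast
          field_simp
          linear_combination 2 * I_sq
        simp only [star_one, cons_val, mul_one, add_zero, mul_zero, zero_add, Pi.add_apply, Pi.smul_apply, smul_eq_mul, cons_val_zero, cons_val_one]
        rw [this]
        simp [im_norm_sq]
        ring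
  · exact Or.inr ⟨p.2, le_rfl, rfl⟩

/-- The tube around the open vertical ray over a base point, above the height `√3`, in terms of
the distance from the ray and of the height in centred coordinates. -/
def Tube (r t : ℝ) : Prop := r < 1 / 10 ∧ √3 + 8 * r < t

/-- The vertices `P₁` and `P₂` lie over these points. -/
def IsBase (a : ℂ) : Prop := a = 1 ∨ a = -om

theorem IsBase.norm_eq {a : ℂ} (h : IsBase a) : ‖a‖ = 1 := by
  rcases h with rfl | rfl
  · simp
  · rw [norm_neg, norm_om]

theorem im_star_mul_self (a : ℂ) : (star a * a).im = 0 := by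
  rw [star_def, Complex.conj_mul']; exact im_norm_sq a

theorem IsBase.height_le {a : ℂ} (h : IsBase a) (z : ℂ) (t : ℝ) :
    height a (z, t) ≤ t + 2 * ‖z - a‖ := by
  have e : (star a * z).im = (star a * (z - a)).im := by
    rw [mul_sub, sub_im, im_star_mul_self, sub_zero]
  have := (le_abs_self _).trans (abs_im_le_norm (star a * (z - a)))
  rw [norm_mul, norm_star, h.norm_eq, one_mul] at this
  simp only [height, e]
  linarith

theorem height_sub_height (a z : ℂ) (t t' : ℝ) : height a (z, t) - height a (z, t') = t - t' := by
  simp [height]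

/-- This is what the slope 8 of the tube is for. The delicate case is type A over 1, where
`height_bottom_A` contributes at most 2√3 ‖z - 1‖ and the change of centre at most 2 ‖z - 1‖ beyond
√3; their sum is below 8 ‖z - 1‖. -/
theorem mem_region_of_mem_bottomFace {T : TetType} {X : CR} (h : X ∈ bottomFace T) :
    ∃ z t, X = OnePoint.some (z, t) ∧ z ∈ region ∧
      ∀ a, IsBase a → height a (z, t) ≤ √3 + 8 * ‖z - a‖ := by
  cases T with
  | B =>
    obtain ⟨u, hu, v, hv, rfl⟩ := (mem_triPlus_P₃_P₁_P₂ X).mp h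
    obtain ⟨h1, h2⟩ := bottom_B_subset hu hv
    refine ⟨_, _, rfl, h1, fun a ha => ?_⟩
    linarith [ha.height_le (u * (om * (v - 1))) (2 * v.im), norm_nonneg (u * (om * (v - 1)) - a)]
  | A =>
    obtain ⟨u, hu, v, hv, rfl⟩ := (mem_triMinus_P₂_P₃_P₁ X).mp h
    have h1 := bottom_A_subset hu hv
    have h2 := height_bottom_A hu hv rfl rfl
    refine ⟨_, _, rfl, h1, ?_⟩
    generalize -om + om * u * (1 - om * (v - 1)) = z at *
    generalize 2 * ((u - 1) * (1 - om * (v - 1)) + v).im = t at *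
    have h5 := sqrt_three_lt
    have h6 := sqrt_three_gt
    rintro a (rfl | rfl)
    · have e : height 1 (z, t) = height (-om) (z, t) + 2 * (-om * (z - 1)).im + √3 := by
        simp [height, om_re, om_im]; ring
      have k1 := (le_abs_self _).trans (abs_im_le_norm (-om * (z - 1)))
      rw [norm_mul, norm_neg, norm_om, one_mul] at k1
      have k2 : 1 - ‖z - 1‖ ≤ ‖z + om‖ := by
        have := norm_sub_norm_le (1 + om) (1 - z)
        rw [show (1 + om) - (1 - z) = z + om by ring, norm_sub_rev 1 z,
          show 1 + om = -star om by rw [star_om]; ring, norm_neg, norm_star, norm_om] at this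
        exact this
      have k3 : ‖z + om‖ ≤ 1 := h1.2.1
      have k4 : 1 - ‖z + om‖ ^ 2 ≤ 2 * ‖z - 1‖ := by
        nlinarith [norm_nonneg (z + om), norm_nonneg (z - 1)]
      have k5 := mul_le_mul_of_nonneg_left k4 (by positivity : 0 ≤ √3)
      have k6 := mul_le_mul_of_nonneg_right h5.le (norm_nonneg (z - 1))
      rw [e]
      nlinarith [norm_nonneg (z - 1)]
    · have : √3 * (1 - ‖z + om‖ ^ 2) ≤ √3 := by nlinarith [sq_nonneg ‖z + om‖]
      linarith [norm_nonneg (z - -om)]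

theorem exists_mem_bottomFace (T : TetType) {z : ℂ} (hz : z ∈ region) :
    ∃ t, OnePoint.some (z, t) ∈ bottomFace T := by
  cases T with
  | B =>
    obtain ⟨u, hu, v, hv, rfl⟩ := exists_bottom_B hz
    exact ⟨_, (mem_triPlus_P₃_P₁_P₂ _).mpr ⟨u, hu, v, hv, rfl⟩⟩
  | A =>
    obtain ⟨u, hu, v, hv, rfl⟩ := exists_bottom_A hz
    exact ⟨_, (mem_triMinus_P₂_P₃_P₁ _).mpr ⟨u, hu, v, hv, rfl⟩⟩

theorem coe_injective {p p' : ℂ × ℝ} (h : (OnePoint.some p : CR) = OnePoint.some p') : p = p' :=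
  OnePoint.coe_injective h

theorem mem_tetrahedron_iff (T : TetType) (z : ℂ) (t : ℝ) :
    OnePoint.some (z, t) ∈ tetrahedron T ↔ ∃ t' ≤ t, OnePoint.some (z, t') ∈ bottomFace T := by
  constructor
  · rintro ⟨Y, hY, hX⟩
    obtain ⟨z', t', rfl, -, -⟩ := mem_region_of_mem_bottomFace hY
    rcases (mem_edge_infty _ _).mp hX with h | ⟨s, hs, h⟩
    · exact absurd h (OnePoint.coe_ne_infty _)
    · obtain ⟨rfl, rfl⟩ := Prod.ext_iff.mp (coe_injective h)
      exact ⟨t', hs, hY⟩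
  · rintro ⟨t', ht, h⟩
    exact ⟨_, h, (mem_edge_infty _ _).mpr (Or.inr ⟨t, ht, rfl⟩)⟩

theorem not_tube_of_mem_bottomFace {T : TetType} {z a : ℂ} {t : ℝ} (ha : IsBase a)
    (h : OnePoint.some (z, t) ∈ bottomFace T) : ¬ Tube ‖z - a‖ (height a (z, t)) := by
  obtain ⟨z', t', h1, -, h2⟩ := mem_region_of_mem_bottomFace h
  obtain ⟨rfl, rfl⟩ := Prod.ext_iff.mp (coe_injective h1)
  exact fun hT => absurd hT.2 (not_lt.mpr (h2 a ha))

/-- In the tube one is always above the bottom face, so the two types of tetrahedra cannot be told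
apart there and only the planar projection matters. -/
theorem mem_tetrahedron_iff_of_tube (T : TetType) {z a : ℂ} {t : ℝ} (ha : IsBase a)
    (hT : Tube ‖z - a‖ (height a (z, t))) :
    OnePoint.some (z, t) ∈ tetrahedron T ↔ z ∈ region := by
  rw [mem_tetrahedron_iff]
  constructor
  · rintro ⟨t', -, h⟩
    obtain ⟨z', t'', h1, h2, -⟩ := mem_region_of_mem_bottomFace h
    obtain ⟨rfl, rfl⟩ := Prod.ext_iff.mp (coe_injective h1)
    exact h2
  · intro hz
    obtain ⟨t', h⟩ := exists_mem_bottomFace T hz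
    obtain ⟨z', t'', h1, -, h2⟩ := mem_region_of_mem_bottomFace h
    obtain ⟨rfl, rfl⟩ := Prod.ext_iff.mp (coe_injective h1)
    refine ⟨t', ?_, h⟩
    linarith [h2 a ha, hT.2, height_sub_height a z t t']

theorem mem_slab_iff (k : ℕ) (z : ℂ) (t : ℝ) : OnePoint.some (z, t) ∈ slab k ↔ z ∈ slabBase k := by
  constructor
  · rintro (⟨z', hz, t', h⟩ | h)
    · obtain ⟨rfl, rfl⟩ := Prod.ext_iff.mp (coe_injective h)
      exact hz
    · exact absurd h (OnePoint.coe_ne_infty _)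
  · exact fun h => Or.inl ⟨z, h, t, rfl⟩

/-! ### Trigonometry -/

/-- Conditions on distances from centres of circles become comparisons of cosines. This and the next
lemmas solve such comparisons on a window for the angle that contains just one component of
solutions. -/
theorem le_and_le_of_cos_le {α x : ℝ} (hα' : α ≤ Real.pi) (h1 : -α < x)
    (h2 : x < 2 * Real.pi + α) (h : Real.cos x ≤ Real.cos α) : α ≤ x ∧ x ≤ 2 * Real.pi - α := by
  constructor
  · by_contra! hx
    have := Real.cos_lt_cos_of_nonneg_of_le_pi (abs_nonneg x) hα' (abs_lt.mpr ⟨h1, hx⟩)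
    rw [Real.cos_abs] at this
    linarith
  · by_contra! hx
    have := Real.cos_lt_cos_of_nonneg_of_le_pi (abs_nonneg (x - 2 * Real.pi)) hα'
      (abs_lt.mpr ⟨by linarith, by linarith⟩)
    rw [Real.cos_abs, Real.cos_sub_two_pi] at this
    linarith

theorem cos_le_of_le_of_le {α x : ℝ} (hα : 0 ≤ α) (h1 : α ≤ x)
    (h2 : x ≤ 2 * Real.pi - α) : Real.cos x ≤ Real.cos α := by
  rcases le_total x Real.pi with hx | hx
  · exact Real.cos_le_cos_of_nonneg_of_le_pi hα hx h1
  · rw [← Real.cos_two_pi_sub]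
    exact Real.cos_le_cos_of_nonneg_of_le_pi hα (by linarith) (by linarith)

theorem abs_le_of_le_cos {α x : ℝ} (hα : 0 ≤ α) (h1 : α - 2 * Real.pi < x)
    (h2 : x < 2 * Real.pi - α) (h : Real.cos α ≤ Real.cos x) : |x| ≤ α := by
  by_contra! hx
  have hx' : |x| < 2 * Real.pi - α := abs_lt.mpr ⟨by linarith, h2⟩
  rw [← Real.cos_abs x] at h
  rcases le_total |x| Real.pi with hp | hp
  · exact absurd (Real.cos_lt_cos_of_nonneg_of_le_pi hα hp hx) (not_lt.mpr h)
  · rw [← Real.cos_two_pi_sub |x|] at h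
    exact absurd (Real.cos_lt_cos_of_nonneg_of_le_pi hα (by linarith) (by linarith)) (not_lt.mpr h)

theorem le_cos_of_abs_le {α x : ℝ} (hα' : α ≤ Real.pi) (h : |x| ≤ α) :
    Real.cos α ≤ Real.cos x := by
  rw [← Real.cos_abs x]
  exact Real.cos_le_cos_of_nonneg_of_le_pi (abs_nonneg x) hα' h

/-- The angle between the tangent of a unit circle and a chord of length `r`. -/
def chordAngle (r : ℝ) : ℝ := Real.arcsin (r / 2)

theorem continuous_chordAngle : Continuous chordAngle :=
  Real.continuous_arcsin.comp (continuous_id.div_const 2)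

theorem chordAngle_nonneg {r : ℝ} (hr : 0 ≤ r) : 0 ≤ chordAngle r :=
  Real.arcsin_nonneg.mpr (by linarith)

theorem chordAngle_lt {r : ℝ} (hr : r < 1 / 10) : chordAngle r < Real.pi / 6 := by
  have hpi := Real.pi_pos
  rw [chordAngle, Real.arcsin_lt_iff_lt_sin' ⟨by linarith, by linarith⟩, Real.sin_pi_div_six]
  linarith

theorem sin_chordAngle {r : ℝ} (hr : 0 ≤ r) (hr' : r < 1 / 10) :
    Real.sin (chordAngle r) = r / 2 :=
  Real.sin_arcsin (by linarith) (by linarith)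

theorem cos_pi_div_two_add_chordAngle {r : ℝ} (hr : 0 ≤ r) (hr' : r < 1 / 10) :
    Real.cos (Real.pi / 2 + chordAngle r) = -(r / 2) := by
  rw [add_comm, Real.cos_add_pi_div_two, sin_chordAngle hr hr']

theorem exp_re_im (x : ℝ) : (exp (x * I)).re = Real.cos x ∧ (exp (x * I)).im = Real.sin x :=
  ⟨exp_ofReal_mul_I_re x, exp_ofReal_mul_I_im x⟩

/-- The law of cosines, with r² written as -2 r cos(π/2 + ψ) for ψ = `chordAngle r`. Lying inside or
outside the unit circle thereby becomes a comparison of two cosines, exact for every r. -/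
theorem norm_exp_add_sq {r : ℝ} (hr : 0 ≤ r) (hr' : r < 1 / 10) (γ θ : ℝ) :
    ‖exp (γ * I) + r * exp (θ * I)‖ ^ 2 =
      1 + 2 * r * (Real.cos (θ - γ) - Real.cos (Real.pi / 2 + chordAngle r)) := by
  rw [cos_pi_div_two_add_chordAngle hr hr', normSq_eq, Real.cos_sub]
  simp only [add_re, add_im, mul_re, mul_im, ofReal_re, ofReal_im, (exp_re_im _).1,
    (exp_re_im _).2]
  linear_combination Real.sin_sq_add_cos_sq γ + r ^ 2 * Real.sin_sq_add_cos_sq θ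

theorem norm_exp_add_le {r γ θ : ℝ} (hr : 0 ≤ r) (hr' : r < 1 / 10)
    (h : Real.cos (θ - γ) ≤ Real.cos (Real.pi / 2 + chordAngle r)) :
    ‖exp (γ * I) + r * exp (θ * I)‖ ≤ 1 := by
  rw [← sq_le_one_iff₀ (norm_nonneg _), norm_exp_add_sq hr hr']
  nlinarith

theorem le_norm_exp_add {r γ θ : ℝ} (hr : 0 ≤ r) (hr' : r < 1 / 10)
    (h : Real.cos (Real.pi / 2 + chordAngle r) ≤ Real.cos (θ - γ)) :
    1 ≤ ‖exp (γ * I) + r * exp (θ * I)‖ := by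
  rw [← one_le_sq_iff₀ (norm_nonneg _), norm_exp_add_sq hr hr']
  nlinarith

theorem cos_le_of_norm_exp_add_le {r γ θ : ℝ} (hr : 0 < r) (hr' : r < 1 / 10)
    (h : ‖exp (γ * I) + r * exp (θ * I)‖ ≤ 1) :
    Real.cos (θ - γ) ≤ Real.cos (Real.pi / 2 + chordAngle r) := by
  rw [← sq_le_one_iff₀ (norm_nonneg _), norm_exp_add_sq hr.le hr'] at h
  by_contra! hx
  nlinarith [mul_pos hr (sub_pos.mpr hx)]

theorem le_cos_of_le_norm_exp_add {r γ θ : ℝ} (hr : 0 < r) (hr' : r < 1 / 10)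
    (h : 1 ≤ ‖exp (γ * I) + r * exp (θ * I)‖) :
    Real.cos (Real.pi / 2 + chordAngle r) ≤ Real.cos (θ - γ) := by
  rw [← one_le_sq_iff₀ (norm_nonneg _), norm_exp_add_sq hr.le hr'] at h
  by_contra! hx
  nlinarith [mul_pos hr (sub_pos.mpr hx)]

theorem exp_zero_mul_I : exp ((0 : ℝ) * I) = 1 := by simp

theorem one_add_om : 1 + om = exp ((-(Real.pi / 3) : ℝ) * I) := by
  rw [← neg_star_om_eq, star_om]; ring

/-! ### The cells near the vertical edges, in polar coordinates -/

variable {r θ : ℝ}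

theorem one_add_polar_add_om (r θ : ℝ) :
    1 + r * exp (θ * I) + om = exp ((-(Real.pi / 3) : ℝ) * I) + r * exp (θ * I) := by
  rw [← one_add_om]; ring

theorem neg_om_add_polar_sub (r θ : ℝ) :
    -om + r * exp (θ * I) - star om = exp ((0 : ℝ) * I) + r * exp (θ * I) := by
  rw [exp_zero_mul_I, star_om]; ring

theorem neg_om_add_polar (r θ : ℝ) :
    -om + r * exp (θ * I) = exp ((Real.pi / 3 : ℝ) * I) + r * exp (θ * I) := by
  rw [neg_om_eq]

theorem one_add_polar (r θ : ℝ) :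
    1 + r * exp (θ * I) = exp ((0 : ℝ) * I) + r * exp (θ * I) := by
  rw [exp_zero_mul_I]

theorem norm_polar (hr : 0 ≤ r) : ‖(r * exp (θ * I) : ℂ)‖ = r := by
  rw [norm_mul, norm_exp_ofReal_mul_I, mul_one, norm_real, Real.norm_of_nonneg hr]

/-- Near 1 the third circle plays no role, since its centre ω̄ is at distance at least 3/2 from 1.
-/
theorem one_le_norm_sub_star_om {z : ℂ} (h : ‖z - 1‖ < 1 / 10) : 1 < ‖z - star om‖ := by
  have h1 := norm_sub_norm_le (1 - star om) (1 - z)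
  rw [norm_sub_rev 1 z, show (1 - star om) - (1 - z) = z - star om by ring] at h1
  have h2 : 3 / 2 ≤ ‖1 - star om‖ := by
    have := (le_abs_self _).trans (abs_re_le_norm (1 - star om))
    rw [star_om] at this ⊢
    simp only [sub_re, neg_re, one_re, om_re] at this
    linarith
  linarith

theorem mem_region_one (hr : 0 ≤ r) (hr' : r < 1 / 10)
    (h1 : Real.pi / 2 + chordAngle r ≤ θ) (h2 : θ ≤ 7 * Real.pi / 6 - chordAngle r) :
    1 + r * exp (θ * I) ∈ region := by
  have hψ := chordAngle_nonneg hr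
  have hψ' := chordAngle_lt hr'
  have hpi := Real.pi_pos
  refine ⟨?_, ?_, (one_le_norm_sub_star_om ?_).le⟩
  · rw [one_add_polar]
    exact norm_exp_add_le hr hr' (cos_le_of_le_of_le (by linarith) (by linarith) (by linarith))
  · rw [one_add_polar_add_om]
    exact norm_exp_add_le hr hr' (cos_le_of_le_of_le (by linarith) (by linarith) (by linarith))
  · rw [add_sub_cancel_left, norm_polar hr]; exact hr'

theorem exists_angle_region_one {z : ℂ} (hz : z ∈ region) (h : ‖z - 1‖ < 1 / 10) :
    ∃ θ, Real.pi / 2 + chordAngle ‖z - 1‖ ≤ θ ∧ θ ≤ 7 * Real.pi / 6 - chordAngle ‖z - 1‖ ∧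
      z = 1 + ‖z - 1‖ * exp (θ * I) := by
  -- The branch is centred on the bisector of the sector from π/2 to 7π/6, so that both circle
  -- conditions can be solved on it without ambiguity.
  obtain ⟨θ, h1, h2, h3⟩ := exists_polar (z - 1) (5 * Real.pi / 6)
  have h3' : z = 1 + ‖z - 1‖ * exp (θ * I) := by rw [← h3]; ring
  obtain ⟨g1, g2, -⟩ := hz
  set r := ‖z - 1‖ with hr
  clear_value r
  subst z
  have hr0 : 0 ≤ r := by rw [hr]; exact norm_nonneg _
  have hψ := chordAngle_nonneg hr0
  have hψ' := chordAngle_lt h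
  have hpi := Real.pi_pos
  rcases hr0.eq_or_lt with rfl | hr0
  · exact ⟨_, le_rfl, by linarith, by simp⟩
  rw [one_add_polar] at g1
  rw [one_add_polar_add_om] at g2
  have k1 := le_and_le_of_cos_le (by linarith) (by linarith) (by linarith)
    (cos_le_of_norm_exp_add_le hr0 h g1)
  have k2 := le_and_le_of_cos_le (by linarith) (by linarith) (by linarith)
    (cos_le_of_norm_exp_add_le hr0 h g2)
  exact ⟨θ, by linarith, by linarith, rfl⟩

/-- At -ω the region lies inside the unit circle about 0 but outside the one about ω̄. Both sides
therefore bend the same way and the sector has width exactly π/3 for every r, unlike at 1, where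
both sides bend inwards. -/
theorem mem_region_neg_om (hr : 0 ≤ r) (hr' : r < 1 / 10)
    (h1 : 3 * Real.pi / 2 - chordAngle r ≤ θ) (h2 : θ ≤ 11 * Real.pi / 6 - chordAngle r) :
    -om + r * exp (θ * I) ∈ region := by
  have hψ := chordAngle_nonneg hr
  have hψ' := chordAngle_lt hr'
  have hpi := Real.pi_pos
  refine ⟨?_, ?_, ?_⟩
  · rw [neg_om_add_polar]
    exact norm_exp_add_le hr hr' (cos_le_of_le_of_le (by linarith) (by linarith) (by linarith))
  · rw [show -om + r * exp (θ * I) + om = r * exp (θ * I) by ring, norm_polar hr]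
    linarith
  · rw [neg_om_add_polar_sub]
    refine le_norm_exp_add hr hr' ?_
    rw [sub_zero, ← Real.cos_sub_two_pi θ]
    exact le_cos_of_abs_le (by linarith) (abs_le.mpr ⟨by linarith, by linarith⟩)

theorem exists_angle_region_neg_om {z : ℂ} (hz : z ∈ region) (h : ‖z - -om‖ < 1 / 10) :
    ∃ θ, 3 * Real.pi / 2 - chordAngle ‖z - -om‖ ≤ θ ∧
      θ ≤ 11 * Real.pi / 6 - chordAngle ‖z - -om‖ ∧ z = -om + ‖z - -om‖ * exp (θ * I) := by
  obtain ⟨θ, h1, h2, h3⟩ := exists_polar (z - -om) (5 * Real.pi / 3)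
  have h3' : z = -om + ‖z - -om‖ * exp (θ * I) := by rw [← h3]; ring
  obtain ⟨g1, -, g2⟩ := hz
  set r := ‖z - -om‖ with hr
  clear_value r
  subst z
  have hr0 : 0 ≤ r := by rw [hr]; exact norm_nonneg _
  have hψ := chordAngle_nonneg hr0
  have hψ' := chordAngle_lt h
  have hpi := Real.pi_pos
  rcases hr0.eq_or_lt with rfl | hr0
  · exact ⟨_, le_rfl, by linarith, by simp⟩
  rw [neg_om_add_polar] at g1
  rw [neg_om_add_polar_sub] at g2
  have k1 := le_and_le_of_cos_le (by linarith) (by linarith) (by linarith)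
    (cos_le_of_norm_exp_add_le hr0 h g1)
  have k2 := le_cos_of_le_norm_exp_add hr0 h g2
  rw [sub_zero, ← Real.cos_sub_two_pi θ] at k2
  have k3 := abs_le.mp (abs_le_of_le_cos (by linarith) (by linarith) (by linarith) k2)
  exact ⟨θ, by linarith, by linarith, rfl⟩

/-! #### Slabs -/

/-- Rotation by π/6 makes the parallel sides of the half-strip horizontal: 1 comes to height 1/2,
and -ω to height 1. -/
theorem exp_pi_div_six_mul_one (r θ : ℝ) :
    (exp (Real.pi / 6 * I) * (1 + r * exp (θ * I))).re = √3 / 2 + r * Real.cos (θ + Real.pi / 6) ∧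
    (exp (Real.pi / 6 * I) * (1 + r * exp (θ * I))).im = 1 / 2 + r * Real.sin (θ + Real.pi / 6) := by
  have : exp (Real.pi / 6 * I) * (1 + r * exp (θ * I)) =
      exp ((Real.pi / 6 : ℝ) * I) + r * exp ((θ + Real.pi / 6 : ℝ) * I) := by
    push_cast
    rw [mul_add, mul_one, mul_left_comm, ← Complex.exp_add]
    ring_nf
  rw [this, add_re, add_im, re_ofReal_mul, im_ofReal_mul, (exp_re_im _).1, (exp_re_im _).2,
    (exp_re_im _).1, (exp_re_im _).2, Real.cos_pi_div_six, Real.sin_pi_div_six]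
  exact ⟨rfl, rfl⟩

theorem exp_pi_div_six_mul_neg_om (r θ : ℝ) :
    (exp (Real.pi / 6 * I) * (-om + r * exp (θ * I))).re = r * Real.cos (θ + Real.pi / 6) ∧
    (exp (Real.pi / 6 * I) * (-om + r * exp (θ * I))).im = 1 + r * Real.sin (θ + Real.pi / 6) := by
  have : exp (Real.pi / 6 * I) * (-om + r * exp (θ * I)) =
      exp ((Real.pi / 2 : ℝ) * I) + r * exp ((θ + Real.pi / 6 : ℝ) * I) := by
    rw [neg_om_eq]
    push_cast
    rw [mul_add, mul_left_comm, ← Complex.exp_add, ← Complex.exp_add]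
    ring_nf
  rw [this, add_re, add_im, re_ofReal_mul, im_ofReal_mul, (exp_re_im _).1, (exp_re_im _).2,
    (exp_re_im _).1, (exp_re_im _).2, Real.cos_pi_div_two, Real.sin_pi_div_two, zero_add]
  exact ⟨rfl, rfl⟩

theorem mem_slabBase_one (k : ℕ) (hr : 0 ≤ r) (hr' : r < 1 / 10)
    (h1 : -(Real.pi / 6) ≤ θ) (h2 : θ ≤ Real.pi / 2 + chordAngle r) :
    1 + r * exp (θ * I) ∈ slabBase k := by
  have hψ := chordAngle_nonneg hr
  have hψ' := chordAngle_lt hr'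
  have hpi := Real.pi_pos
  have h3 := sqrt_three_gt
  left
  rw [Set.mem_ofPred_eq, (exp_pi_div_six_mul_one r θ).1, (exp_pi_div_six_mul_one r θ).2]
  refine ⟨?_, ?_, ?_, ?_⟩
  · rw [one_add_polar]
    refine le_norm_exp_add hr hr' ?_
    rw [sub_zero]
    exact le_cos_of_abs_le (by linarith) (abs_le.mpr ⟨by linarith, by linarith⟩)
  · nlinarith [Real.neg_one_le_cos (θ + Real.pi / 6)]
  · have := Real.sin_nonneg_of_nonneg_of_le_pi (x := θ + Real.pi / 6) (by linarith) (by linarith)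
    nlinarith
  · nlinarith [Real.sin_le_one (θ + Real.pi / 6)]

theorem nonneg_of_sin_nonneg {x : ℝ} (h1 : -Real.pi < x) (h2 : x < 2 * Real.pi)
    (h : 0 ≤ Real.sin x) : 0 ≤ x ∧ x ≤ Real.pi := by
  constructor
  · by_contra! hx
    exact absurd (Real.sin_neg_of_neg_of_neg_pi_lt hx h1) (not_lt.mpr h)
  · by_contra! hx
    have := Real.sin_neg_of_neg_of_neg_pi_lt (x := x - 2 * Real.pi) (by linarith) (by linarith)
    rw [Real.sin_sub_two_pi] at this
    linarith

/-- Used with -ω as origin and the direction towards 1 as real axis. The rays of the slab's sector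
make an angle of at least π/6 with that axis, so the sector stays away from the point 1 and the slab
near 1 is the half-strip alone. -/
theorem sector_ne {ρ : ℝ} (h1 : Real.pi / 6 ≤ θ) (h2 : θ ≤ 11 * Real.pi / 6) :
    1 / 10 < ‖(ρ * exp (θ * I) - 1 : ℂ)‖ ∨ ρ < 0 := by
  by_contra! h
  obtain ⟨hn, hρ⟩ := h
  have e1 := (abs_re_le_norm _).trans hn
  have e2 := (abs_im_le_norm _).trans hn
  rw [sub_re, re_ofReal_mul, (exp_re_im _).1, one_re] at e1
  rw [sub_im, im_ofReal_mul, (exp_re_im _).2, one_im, sub_zero] at e2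
  obtain ⟨a1, a2⟩ := abs_le.mp e1
  have hpi := Real.pi_pos
  have c1 := cos_le_of_le_of_le (by positivity) h1 (by linarith)
  rw [Real.cos_pi_div_six] at c1
  have hs := sqrt_three_lt
  have hs' := sqrt_three_gt
  have e3 := abs_le.mp e2
  have e4 : (ρ * Real.sin θ) ^ 2 ≤ (1 / 10) ^ 2 := sq_le_sq' e3.1 e3.2
  have e5 : 1 ≤ ρ := by
    by_contra! hlt
    nlinarith
  have h5 : 0 < Real.cos θ := by
    by_contra! hc
    nlinarith
  have e6 : Real.cos θ ^ 2 ≤ 3 / 4 := by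
    have := pow_le_pow_left₀ h5.le c1 2
    rw [div_pow, sqrt_three_sq'] at this
    linarith
  have e7 := Real.sin_sq_add_cos_sq θ
  have e8 := mul_le_mul_of_nonneg_right (one_le_pow₀ e5 : 1 ≤ ρ ^ 2) (sq_nonneg (Real.sin θ))
  rw [mul_pow] at e4
  linarith

theorem angle_bound (k : ℕ) : (0 : ℝ) ≤ (((1 - (k : ℤ)) % 6 : ℤ) : ℝ) * (Real.pi / 3) ∧
    (((1 - (k : ℤ)) % 6 : ℤ) : ℝ) * (Real.pi / 3) ≤ 5 * (Real.pi / 3) := by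
  have hpi := Real.pi_pos
  have h1 : 0 ≤ (1 - (k : ℤ)) % 6 := Int.emod_nonneg _ (by norm_num)
  have h2 : (1 - (k : ℤ)) % 6 ≤ 5 := by
    have := Int.emod_lt_of_pos (1 - (k : ℤ)) (by norm_num : (0 : ℤ) < 6); omega
  have h1' : (0 : ℝ) ≤ (((1 - (k : ℤ)) % 6 : ℤ) : ℝ) := by exact_mod_cast h1
  have h2' : (((1 - (k : ℤ)) % 6 : ℤ) : ℝ) ≤ 5 := by exact_mod_cast h2
  exact ⟨by positivity, by gcongr⟩

theorem exists_angle_slab_one {k : ℕ} {z : ℂ} (hz : z ∈ slabBase k) (h : ‖z - 1‖ < 1 / 10) :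
    ∃ θ, -(Real.pi / 6) ≤ θ ∧ θ ≤ Real.pi / 2 + chordAngle ‖z - 1‖ ∧
      z = 1 + ‖z - 1‖ * exp (θ * I) := by
  have hpi := Real.pi_pos
  rcases hz with ⟨g1, -, g2, -⟩ | ⟨ρ, θ, hρ, hθ, hθ', rfl⟩
  · obtain ⟨θ, h1, h2, h3⟩ := exists_polar (z - 1) (Real.pi / 3)
    have h3' : z = 1 + ‖z - 1‖ * exp (θ * I) := by rw [← h3]; ring
    set r := ‖z - 1‖ with hr
    clear_value r
    subst z
    have hr0 : 0 ≤ r := by rw [hr]; exact norm_nonneg _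
    have hψ := chordAngle_nonneg hr0
    have hψ' := chordAngle_lt h
    rcases hr0.eq_or_lt with rfl | hr0
    · exact ⟨_, le_rfl, by linarith, by simp⟩
    rw [(exp_pi_div_six_mul_one r θ).2] at g2
    have k0 : 0 ≤ Real.sin (θ + Real.pi / 6) := nonneg_of_mul_nonneg_right (by linarith) hr0
    have k1 := nonneg_of_sin_nonneg (by linarith) (by linarith) k0
    rw [one_add_polar] at g1
    have k2 := le_cos_of_le_norm_exp_add hr0 h g1
    rw [sub_zero] at k2
    have k3 := abs_le.mp (abs_le_of_le_cos (by linarith) (by linarith) (by linarith) k2)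
    exact ⟨θ, by linarith, by linarith, rfl⟩
  · exfalso
    have e : (-om + ρ * exp ((θ - Real.pi / 6) * I) - 1 : ℂ) =
        exp ((-(Real.pi / 3) : ℝ) * I) * (ρ * exp ((θ + Real.pi / 6 : ℝ) * I) - 1) := by
      rw [mul_sub, mul_left_comm, ← Complex.exp_add, mul_one, ← one_add_om]
      push_cast
      ring_nf
    rw [e, norm_mul, norm_exp_ofReal_mul_I, one_mul] at h
    have := angle_bound k
    rcases sector_ne (ρ := ρ) (θ := θ + Real.pi / 6) (by linarith) (by linarith) with h' | h'
    · linarith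
    · linarith

/-- The ray in direction -π/6 separates the two pieces of the slab at -ω: the added sector lies on
one side of it, the thin part of the half-strip above the unit circle, of angle ψ, on the other. -/
theorem mem_slabBase_neg_om (k : ℕ) (hr : 0 ≤ r) (hr' : r < 1 / 10)
    (h1 : -(Real.pi / 6) - chordAngle r ≤ θ)
    (h2 : θ ≤ -(Real.pi / 6) + (((1 - (k : ℤ)) % 6 : ℤ) : ℝ) * (Real.pi / 3)) :
    -om + r * exp (θ * I) ∈ slabBase k := by
  have hψ := chordAngle_nonneg hr
  have hψ' := chordAngle_lt hr'
  have hpi := Real.pi_pos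
  rcases le_total (-(Real.pi / 6)) θ with hθ | hθ
  · right
    refine ⟨r, θ + Real.pi / 6, hr, by linarith, by linarith, ?_⟩
    push_cast
    ring_nf
  · left
    rw [Set.mem_ofPred_eq, (exp_pi_div_six_mul_neg_om r θ).1, (exp_pi_div_six_mul_neg_om r θ).2]
    refine ⟨?_, ?_, ?_, ?_⟩
    · rw [neg_om_add_polar]
      refine le_norm_exp_add hr hr' ?_
      exact le_cos_of_abs_le (by linarith) (abs_le.mpr ⟨by linarith, by linarith⟩)
    · exact mul_nonneg hr (Real.cos_nonneg_of_neg_pi_div_two_le_of_le (by linarith) (by linarith))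
    · nlinarith [Real.neg_one_le_sin (θ + Real.pi / 6)]
    · have := Real.sin_nonpos_of_nonpos_of_neg_pi_le (x := θ + Real.pi / 6) (by linarith)
        (by linarith)
      nlinarith

theorem exists_angle_slab_neg_om {k : ℕ} {z : ℂ} (hz : z ∈ slabBase k) (h : ‖z - -om‖ < 1 / 10) :
    ∃ θ, -(Real.pi / 6) - chordAngle ‖z - -om‖ ≤ θ ∧
      θ ≤ -(Real.pi / 6) + (((1 - (k : ℤ)) % 6 : ℤ) : ℝ) * (Real.pi / 3) ∧
      z = -om + ‖z - -om‖ * exp (θ * I) := by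
  have hpi := Real.pi_pos
  have hk := angle_bound k
  rcases hz with ⟨g1, g3, -, g2⟩ | ⟨ρ, θ, hρ, hθ, hθ', rfl⟩
  · obtain ⟨θ, h1, h2, h3⟩ := exists_polar (z - -om) (-(Real.pi / 6))
    have h3' : z = -om + ‖z - -om‖ * exp (θ * I) := by rw [← h3]; ring
    set r := ‖z - -om‖ with hr
    clear_value r
    subst z
    have hr0 : 0 ≤ r := by rw [hr]; exact norm_nonneg _
    have hψ := chordAngle_nonneg hr0
    have hψ' := chordAngle_lt h
    rcases hr0.eq_or_lt with rfl | hr0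
    · exact ⟨_, le_rfl, by linarith, by simp⟩
    rw [(exp_pi_div_six_mul_neg_om r θ).1] at g3
    rw [(exp_pi_div_six_mul_neg_om r θ).2] at g2
    have k0 : 0 ≤ Real.cos (θ + Real.pi / 6) := nonneg_of_mul_nonneg_right g3 hr0
    have k0' : Real.sin (θ + Real.pi / 6) ≤ 0 := by
      by_contra! hs
      nlinarith [mul_pos hr0 hs]
    have k1 : θ + Real.pi / 6 ≤ 0 := by
      by_contra! hs
      rcases h2.eq_or_lt with h2 | h2
      · rw [show θ + Real.pi / 6 = Real.pi by linarith, Real.cos_pi] at k0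
        linarith
      · exact absurd (Real.sin_pos_of_pos_of_lt_pi hs (by linarith)) (not_lt.mpr k0')
    have k2 : -(Real.pi / 2) ≤ θ + Real.pi / 6 := by
      by_contra! hs
      have := Real.cos_neg_of_pi_div_two_lt_of_lt (x := -(θ + Real.pi / 6)) (by linarith)
        (by linarith)
      rw [Real.cos_neg] at this
      linarith
    rw [neg_om_add_polar] at g1
    have k3 := le_cos_of_le_norm_exp_add hr0 h g1
    have k4 := abs_le.mp (abs_le_of_le_cos (by linarith) (by linarith) (by linarith) k3)
    exact ⟨θ, by linarith, by linarith, rfl⟩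
  · have e : (-om + ρ * exp ((θ - Real.pi / 6) * I) - -om : ℂ) =
        ρ * exp ((θ - Real.pi / 6 : ℝ) * I) := by push_cast; ring
    rw [e, norm_polar hρ] at *
    have hψ := chordAngle_nonneg hρ
    exact ⟨θ - Real.pi / 6, by linarith, by linarith, by push_cast; ring⟩

/-! ### The faces near the vertical edges -/

section

variable {r θ : ℝ}

theorem exists_of_mem_triMinus {Q R : CR} (hQR : ∀ Y ∈ edge Q R, ∃ p : ℂ × ℝ, Y = OnePoint.some p)
    {z : ℂ} {t : ℝ} : OnePoint.some (z, t) ∈ triMinus P₄ Q R ↔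
      ∃ t' ≤ t, OnePoint.some (z, t') ∈ edge Q R := by
  constructor
  · rintro ⟨Y, hY, hX⟩
    obtain ⟨⟨z', t'⟩, rfl⟩ := hQR Y hY
    rcases (mem_edge_infty _ _).mp hX with h | ⟨s, hs, h⟩
    · exact absurd h (OnePoint.coe_ne_infty _)
    · obtain ⟨rfl, rfl⟩ := Prod.ext_iff.mp (coe_injective h)
      exact ⟨t', hs, hY⟩
  · rintro ⟨t', ht, h⟩
    exact ⟨_, h, (mem_edge_infty _ _).mpr (Or.inr ⟨t, ht, rfl⟩)⟩

theorem mem_triMinus₄₁₂ {z : ℂ} {t : ℝ} :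
    OnePoint.some (z, t) ∈ triMinus P₄ P₁ P₂ ↔ z ∈ shortArc ∧ √3 ≤ t := by
  rw [exists_of_mem_triMinus]
  · constructor
    · rintro ⟨t', ht, h⟩
      obtain ⟨u, hu, h⟩ := (mem_edge_P₁_P₂ _).mp h
      obtain ⟨h1, h2⟩ := Prod.mk.inj (coe_injective h)
      exact ⟨h1 ▸ hu, h2 ▸ ht⟩
    · rintro ⟨hz, ht⟩
      exact ⟨_, ht, (mem_edge_P₁_P₂ _).mpr ⟨z, hz, rfl⟩⟩
  · intro Y hY
    obtain ⟨u, hu, h⟩ := (mem_edge_P₁_P₂ _).mp hY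
    exact ⟨_, h⟩

theorem mem_triMinus₄₃₁ {z : ℂ} {t : ℝ} :
    OnePoint.some (z, t) ∈ triMinus P₄ P₃ P₁ ↔
      ∃ v ∈ shortArc, z = om * (v - 1) ∧ 2 * v.im ≤ t := by
  rw [exists_of_mem_triMinus]
  · constructor
    · rintro ⟨t', ht, h⟩
      obtain ⟨u, hu, h⟩ := (mem_edge_P₃_P₁ _).mp h
      obtain ⟨rfl, rfl⟩ := Prod.ext_iff.mp (coe_injective h)
      exact ⟨u, hu, rfl, ht⟩
    · rintro ⟨v, hv, rfl, ht⟩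
      exact ⟨_, ht, (mem_edge_P₃_P₁ _).mpr ⟨v, hv, rfl⟩⟩
  · intro Y hY
    obtain ⟨u, hu, h⟩ := (mem_edge_P₃_P₁ _).mp hY
    exact ⟨_, h⟩

theorem mem_triMinus₄₃₂ {z : ℂ} {t : ℝ} :
    OnePoint.some (z, t) ∈ triMinus P₄ P₃ P₂ ↔
      ∃ v ∈ shortArc, z = -om * (om * (v - 1)) ∧ 2 * v.im ≤ t := by
  rw [exists_of_mem_triMinus]
  · constructor
    · rintro ⟨t', ht, h⟩
      obtain ⟨u, hu, h⟩ := (mem_edge_P₃_P₂ _).mp h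
      obtain ⟨rfl, rfl⟩ := Prod.ext_iff.mp (coe_injective h)
      exact ⟨u, hu, rfl, ht⟩
    · rintro ⟨v, hv, rfl, ht⟩
      exact ⟨_, ht, (mem_edge_P₃_P₂ _).mpr ⟨v, hv, rfl⟩⟩
  · intro Y hY
    obtain ⟨u, hu, h⟩ := (mem_edge_P₃_P₂ _).mp hY
    exact ⟨_, h⟩

/-- Edges leaving P₄ descend to their endpoint, so this face stays below height √3. This is why the
edges (41), (42) of a slab do not interfere with (14), (24) on the same vertical lines. -/
theorem not_tube_of_mem_triPlus₄₁₂ {z a : ℂ} {t : ℝ} (ha : IsBase a)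
    (h : OnePoint.some (z, t) ∈ triPlus P₄ P₁ P₂) : ¬ Tube ‖z - a‖ (height a (z, t)) := by
  obtain ⟨Y, hY, hX⟩ := h
  obtain ⟨u, hu, rfl⟩ := (mem_edge_P₁_P₂ _).mp hY
  rcases of_mem_edge_infty_left hX with h | ⟨s, hs, h⟩
  · exact absurd h (OnePoint.coe_ne_infty _)
  · obtain ⟨rfl, rfl⟩ := Prod.ext_iff.mp (coe_injective h)
    intro hT
    have := hT.2
    simp only at *
    linarith [ha.height_le z t, norm_nonneg (z - a)]

theorem norm_add_om_of_mem {v : ℂ} (hv : v ∈ shortArc) : ‖om * (v - 1) + om‖ = 1 := by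
  rw [show om * (v - 1) + om = om * v by ring, norm_mul, norm_om, norm_of_mem_shortArc hv, one_mul]

theorem norm_sub_star_om_of_mem {v : ℂ} (hv : v ∈ shortArc) :
    ‖-om * (om * (v - 1)) - star om‖ = 1 := by
  rw [show -om * (om * (v - 1)) - star om = -star om * v by
    rw [star_om]; linear_combination (1 - v) * om_sq, norm_mul, norm_neg, norm_star, norm_om,
    norm_of_mem_shortArc hv, one_mul]

/-! #### Angles of the faces -/

/-- Within the sector one cosine inequality holds already; lying on the circle gives the reverse
one, which pins the angle. For r = 0 the angle carries no information, whence the alternative in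
this and the following lemmas. -/
theorem angle_tet_one_lo (hr : 0 ≤ r) (hr' : r < 1 / 10) (h1 : Real.pi / 2 + chordAngle r ≤ θ)
    (h2 : θ ≤ 7 * Real.pi / 6 - chordAngle r) (h : ‖1 + r * exp (θ * I)‖ = 1) :
    r = 0 ∨ θ = Real.pi / 2 + chordAngle r := by
  have hψ := chordAngle_nonneg hr
  have hψ' := chordAngle_lt hr'
  have hpi := Real.pi_pos
  refine hr.eq_or_lt.imp Eq.symm fun hr0 => ?_
  rw [one_add_polar] at h
  have k := le_cos_of_le_norm_exp_add hr0 hr' h.ge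
  rw [sub_zero] at k
  have := abs_le.mp (abs_le_of_le_cos (by linarith) (by linarith) (by linarith) k)
  linarith

theorem angle_tet_one_hi (hr : 0 ≤ r) (hr' : r < 1 / 10) (h1 : Real.pi / 2 + chordAngle r ≤ θ)
    (h2 : θ ≤ 7 * Real.pi / 6 - chordAngle r) (h : ‖1 + r * exp (θ * I) + om‖ = 1) :
    r = 0 ∨ θ = 7 * Real.pi / 6 - chordAngle r := by
  have hψ := chordAngle_nonneg hr
  have hψ' := chordAngle_lt hr'
  have hpi := Real.pi_pos
  refine hr.eq_or_lt.imp Eq.symm fun hr0 => ?_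
  rw [one_add_polar_add_om] at h
  have k := le_cos_of_le_norm_exp_add hr0 hr' h.ge
  rw [← Real.cos_sub_two_pi (_ - _)] at k
  have := abs_le.mp (abs_le_of_le_cos (by linarith) (by linarith) (by linarith) k)
  linarith

theorem angle_tet_neg_om_hi (hr : 0 ≤ r) (hr' : r < 1 / 10)
    (h1 : 3 * Real.pi / 2 - chordAngle r ≤ θ) (h2 : θ ≤ 11 * Real.pi / 6 - chordAngle r)
    (h : ‖-om + r * exp (θ * I)‖ = 1) : r = 0 ∨ θ = 11 * Real.pi / 6 - chordAngle r := by
  have hψ := chordAngle_nonneg hr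
  have hψ' := chordAngle_lt hr'
  have hpi := Real.pi_pos
  refine hr.eq_or_lt.imp Eq.symm fun hr0 => ?_
  rw [neg_om_add_polar] at h
  have k := le_cos_of_le_norm_exp_add hr0 hr' h.ge
  rw [← Real.cos_sub_two_pi (_ - _)] at k
  have := abs_le.mp (abs_le_of_le_cos (by linarith) (by linarith) (by linarith) k)
  linarith

theorem angle_tet_neg_om_lo (hr : 0 ≤ r) (hr' : r < 1 / 10)
    (h1 : 3 * Real.pi / 2 - chordAngle r ≤ θ) (h2 : θ ≤ 11 * Real.pi / 6 - chordAngle r)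
    (h : ‖-om + r * exp (θ * I) - star om‖ = 1) : r = 0 ∨ θ = 3 * Real.pi / 2 - chordAngle r := by
  have hψ := chordAngle_nonneg hr
  have hψ' := chordAngle_lt hr'
  have hpi := Real.pi_pos
  refine hr.eq_or_lt.imp Eq.symm fun hr0 => ?_
  rw [neg_om_add_polar_sub] at h
  have k := cos_le_of_norm_exp_add_le hr0 hr' h.le
  rw [sub_zero] at k
  have := le_and_le_of_cos_le (by linarith) (by linarith) (by linarith) k
  linarith

theorem angle_slab_one_hi (hr : 0 ≤ r) (hr' : r < 1 / 10) (h1 : -(Real.pi / 6) ≤ θ)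
    (h2 : θ ≤ Real.pi / 2 + chordAngle r) (h : ‖1 + r * exp (θ * I)‖ = 1) :
    r = 0 ∨ θ = Real.pi / 2 + chordAngle r := by
  have hψ := chordAngle_nonneg hr
  have hψ' := chordAngle_lt hr'
  have hpi := Real.pi_pos
  refine hr.eq_or_lt.imp Eq.symm fun hr0 => ?_
  rw [one_add_polar] at h
  have k := cos_le_of_norm_exp_add_le hr0 hr' h.le
  rw [sub_zero] at k
  have := le_and_le_of_cos_le (by linarith) (by linarith) (by linarith) k
  linarith

/-- The sector may be so wide that it meets the unit circle on both sides of -ω. Being on the short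
arc, and not merely on the circle, says sin (θ - π/3) ≤ 0 and excludes the far side. -/
theorem angle_slab_neg_om_lo (hr : 0 ≤ r) (hr' : r < 1 / 10)
    (h1 : -(Real.pi / 6) - chordAngle r ≤ θ) (h2 : θ ≤ 3 * Real.pi / 2)
    (h : -om + r * exp (θ * I) ∈ shortArc) : r = 0 ∨ θ = -(Real.pi / 6) - chordAngle r := by
  have hψ := chordAngle_nonneg hr
  have hψ' := chordAngle_lt hr'
  have hpi := Real.pi_pos
  refine hr.eq_or_lt.imp Eq.symm fun hr0 => ?_
  have hn := norm_of_mem_shortArc h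
  have hs := (shortArc_im_le h).1
  have hsin : Real.sin (θ - Real.pi / 3) ≤ 0 := by
    rw [add_re, add_im, re_ofReal_mul, im_ofReal_mul, (exp_re_im _).1, (exp_re_im _).2, neg_re,
      neg_im, om_re, om_im] at hs
    rw [Real.sin_sub, Real.cos_pi_div_three, Real.sin_pi_div_three]
    by_contra! hx
    have := mul_pos hr0 hx
    nlinarith
  rw [neg_om_add_polar] at hn
  have k1 := cos_le_of_norm_exp_add_le hr0 hr' hn.le
  have k2 := le_cos_of_le_norm_exp_add hr0 hr' hn.ge
  have k3 := abs_le.mp (abs_le_of_le_cos (by linarith) (by linarith) (by linarith) k2)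
  by_contra hne
  have hlt : -(Real.pi / 2 + chordAngle r) < θ - Real.pi / 3 :=
    lt_of_le_of_ne (by linarith) fun h => hne (by linarith)
  have k4 := le_and_le_of_cos_le (by linarith) hlt (by linarith) k1
  exact absurd (Real.sin_pos_of_pos_of_lt_pi (by linarith) (by linarith)) (not_lt.mpr hsin)

theorem eq_of_polar_eq {ρ θ θ' : ℝ} (hr : 0 ≤ r) (hρ : 0 ≤ ρ)
    (h : (r * exp (θ * I) : ℂ) = ρ * exp (θ' * I)) :
    r = ρ ∧ (r = 0 ∨ ∃ n : ℤ, θ = θ' + 2 * Real.pi * n) := by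
  have h1 : r = ρ := by rw [← norm_polar (θ := θ) hr, h, norm_polar hρ]
  refine ⟨h1, or_iff_not_imp_left.mpr fun h0 => ?_⟩
  subst h1
  have h0' : (r : ℂ) ≠ 0 := by exact_mod_cast h0
  obtain ⟨n, hn⟩ := Complex.exp_eq_exp_iff_exists_int.mp (mul_left_cancel₀ h0' h)
  refine ⟨n, ?_⟩
  have : ((θ : ℂ) - (θ' + 2 * Real.pi * n : ℝ)) * I = 0 := by
    push_cast; linear_combination hn
  have := (mul_eq_zero.mp this).resolve_right I_ne_zero
  exact_mod_cast sub_eq_zero.mp this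

theorem int_eq_zero_of_abs_lt {n : ℤ} {x : ℝ} (h : 2 * Real.pi * n = x)
    (hx : |x| < 2 * Real.pi) : n = 0 := by
  have hpi := Real.pi_pos
  rw [← h, abs_mul, abs_of_pos (by positivity : 0 < 2 * Real.pi)] at hx
  have : |(n : ℝ)| < 1 := by
    by_contra! h1
    nlinarith
  rw [← Int.cast_abs] at this
  exact Int.abs_lt_one_iff.mp (by exact_mod_cast this)

theorem mem_bigon'_iff {z : ℂ} {t : ℝ} : OnePoint.some (z, t) ∈ bigon' ↔
    ∃ ρ : ℝ, 0 ≤ ρ ∧ z = 1 + ρ * exp ((-(Real.pi / 6) : ℝ) * I) := by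
  constructor
  · rintro (⟨ρ, s, hρ, h⟩ | h)
    · obtain ⟨h1, -⟩ := Prod.mk.inj (coe_injective h)
      exact ⟨ρ, hρ, by rw [h1]; push_cast; rfl⟩
    · exact absurd h (OnePoint.coe_ne_infty _)
  · rintro ⟨ρ, hρ, rfl⟩
    exact Or.inl ⟨ρ, t, hρ, by push_cast; rfl⟩

theorem mem_bigon_iff {k : ℕ} {z : ℂ} {t : ℝ} : OnePoint.some (z, t) ∈ bigon k ↔
    ∃ ρ : ℝ, 0 ≤ ρ ∧ z = -om + ρ * exp ((Real.pi / 6 * (1 - 2 * k) : ℝ) * I) := by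
  constructor
  · rintro (⟨ρ, s, hρ, h⟩ | h)
    · obtain ⟨h1, -⟩ := Prod.mk.inj (coe_injective h)
      exact ⟨ρ, hρ, by rw [h1]; push_cast; rfl⟩
    · exact absurd h (OnePoint.coe_ne_infty _)
  · rintro ⟨ρ, hρ, rfl⟩
    exact Or.inl ⟨ρ, t, hρ, by push_cast; rfl⟩

theorem angle_slab_one_lo {t : ℝ} (hr : 0 ≤ r) (hr' : r < 1 / 10) (h1 : -(Real.pi / 6) ≤ θ)
    (h2 : θ ≤ Real.pi / 2 + chordAngle r)
    (h : OnePoint.some (1 + r * exp (θ * I), t) ∈ bigon') : r = 0 ∨ θ = -(Real.pi / 6) := by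
  obtain ⟨ρ, hρ, h⟩ := mem_bigon'_iff.mp h
  have hψ' := chordAngle_lt hr'
  have hpi := Real.pi_pos
  refine (eq_of_polar_eq hr hρ (add_left_cancel h)).2.imp_right ?_
  rintro ⟨n, hn⟩
  have : n = 0 := int_eq_zero_of_abs_lt (x := θ + Real.pi / 6) (by linarith)
    (abs_lt.mpr ⟨by linarith, by linarith⟩)
  rw [hn, this]; simp

/-- The angle of the bigon `B_k` at `-ω` in the range used for the slab. -/
theorem exists_bigon_angle (k : ℕ) : ∃ n : ℤ,
    -(Real.pi / 6) + (((1 - (k : ℤ)) % 6 : ℤ) : ℝ) * (Real.pi / 3) =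
      Real.pi / 6 * (1 - 2 * k) + 2 * Real.pi * n := by
  refine ⟨-((1 - (k : ℤ)) / 6), ?_⟩
  have h : ((1 - (k : ℤ)) % 6 : ℤ) = 1 - (k : ℤ) - 6 * ((1 - (k : ℤ)) / 6) := Int.emod_def _ _
  rw [h]
  push_cast
  ring

theorem angle_slab_neg_om_hi {k : ℕ} {t : ℝ} (hr : 0 ≤ r) (hr' : r < 1 / 10)
    (h1 : -(Real.pi / 6) - chordAngle r ≤ θ)
    (h2 : θ ≤ -(Real.pi / 6) + (((1 - (k : ℤ)) % 6 : ℤ) : ℝ) * (Real.pi / 3))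
    (h : OnePoint.some (-om + r * exp (θ * I), t) ∈ bigon k) :
    r = 0 ∨ θ = -(Real.pi / 6) + (((1 - (k : ℤ)) % 6 : ℤ) : ℝ) * (Real.pi / 3) := by
  obtain ⟨ρ, hρ, h⟩ := mem_bigon_iff.mp h
  have hψ' := chordAngle_lt hr'
  have hψ := chordAngle_nonneg hr
  have hpi := Real.pi_pos
  have hk := angle_bound k
  refine (eq_of_polar_eq hr hρ (add_left_cancel h)).2.imp_right ?_
  rintro ⟨n, hn⟩
  obtain ⟨n', hn'⟩ := exists_bigon_angle k
  have : n' - n = 0 := int_eq_zero_of_abs_lt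
    (x := -(Real.pi / 6) + (((1 - (k : ℤ)) % 6 : ℤ) : ℝ) * (Real.pi / 3) - θ)
    (by push_cast; linarith) (abs_lt.mpr ⟨by linarith, by linarith⟩)
  rw [hn', hn, sub_eq_zero.mp this]

/-- After rotation by π/6 the bigon projects into the line at height 1/2, while -ω is at height 1.
-/
theorem not_mem_bigon'_neg_om {t : ℝ} (hr : 0 ≤ r) (hr' : r < 1 / 10) :
    OnePoint.some (-om + r * exp (θ * I), t) ∉ bigon' := by
  intro h
  obtain ⟨ρ, hρ, h⟩ := mem_bigon'_iff.mp h
  have h1 := (exp_pi_div_six_mul_neg_om r θ).2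
  rw [h, (exp_pi_div_six_mul_one ρ _).2] at h1
  simp at h1
  nlinarith [Real.neg_one_le_sin (θ + Real.pi / 6)]

/-- These cosines are roots of 4c³ - 3c = ±1, that is, c is ±1 or ±1/2. -/
theorem half_le_abs_cos (k : ℕ) : 1 / 2 ≤ |Real.cos (k * (Real.pi / 3))| := by
  have h1 := Real.cos_three_mul (k * (Real.pi / 3))
  rw [show 3 * (k * (Real.pi / 3)) = k * Real.pi by ring, Real.cos_nat_mul_pi] at h1
  set c := Real.cos (k * (Real.pi / 3))
  rcases neg_one_pow_eq_or ℝ k with h | h <;> rw [h] at h1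
  · have : (c - 1) * (2 * c + 1) ^ 2 = 0 := by linear_combination -h1
    rcases mul_eq_zero.mp this with h | h
    · rw [sub_eq_zero.mp h]; norm_num
    · have : c = -(1 / 2) := by have := pow_eq_zero_iff (two_ne_zero) |>.mp h; linarith
      rw [this]; norm_num [abs_of_neg]
  · have : (c + 1) * (2 * c - 1) ^ 2 = 0 := by linear_combination -h1
    rcases mul_eq_zero.mp this with h | h
    · rw [show c = -1 by linarith]; norm_num
    · have : c = 1 / 2 := by have := pow_eq_zero_iff (two_ne_zero) |>.mp h; linarith
      rw [this]; norm_num [abs_of_pos]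

/-- The line through -ω that carries the projection of the bigon has distance |cos (kπ/3)| ≥ 1/2
from 1. -/
theorem not_mem_bigon_one {k : ℕ} {t : ℝ} (hr : 0 ≤ r) (hr' : r < 1 / 10) :
    OnePoint.some (1 + r * exp (θ * I), t) ∉ bigon k := by
  intro h
  obtain ⟨ρ, hρ, h⟩ := mem_bigon_iff.mp h
  have e : exp ((-(Real.pi / 3) - Real.pi / 6 * (1 - 2 * k) : ℝ) * I) - ρ =
      -(r * exp ((θ - Real.pi / 6 * (1 - 2 * k) : ℝ) * I)) := by
    have h' : exp ((-(Real.pi / 3) : ℝ) * I) + r * exp (θ * I) =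
        ρ * exp ((Real.pi / 6 * (1 - 2 * k) : ℝ) * I) := by
      rw [← one_add_om]; linear_combination h
    have h1 : ∀ x y : ℝ, exp ((x - y : ℝ) * I) = exp (x * I) * exp (-(y * I)) := by
      intro x y; rw [← Complex.exp_add]; push_cast; ring_nf
    have h2 : exp ((Real.pi / 6 * (1 - 2 * k) : ℝ) * I) *
        exp (-((Real.pi / 6 * (1 - 2 * k) : ℝ) * I)) = 1 := by
      rw [← Complex.exp_add]; simp
    rw [h1, h1]
    linear_combination exp (-((Real.pi / 6 * (1 - 2 * k) : ℝ) * I)) * h' + ρ * h2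
  have h1 := congrArg im e
  have h2 := (abs_im_le_norm _).trans_eq (norm_polar (θ := θ - Real.pi / 6 * (1 - 2 * k)) hr)
  rw [sub_im, (exp_re_im _).2, ofReal_im, neg_im, sub_zero] at h1
  rw [← abs_neg, ← h1, show -(Real.pi / 3) - Real.pi / 6 * (1 - 2 * k) =
    k * (Real.pi / 3) - Real.pi / 2 by ring, Real.sin_sub_pi_div_two, abs_neg] at h2
  linarith [half_le_abs_cos k]

/-! #### Points on the faces -/

theorem arc_one_mem (hr : 0 ≤ r) (hr' : r < 1 / 10) :
    1 + r * exp ((Real.pi / 2 + chordAngle r : ℝ) * I) ∈ shortArc := by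
  have hψ := chordAngle_nonneg hr
  have hψ' := chordAngle_lt hr'
  have hpi := Real.pi_pos
  refine ⟨?_, ?_, ?_⟩
  · rw [← normSq_eq, one_add_polar, norm_exp_add_sq hr hr', sub_zero]; simp
  · rw [add_im, im_ofReal_mul, (exp_re_im _).2, one_im, zero_add]
    exact mul_nonneg hr (Real.sin_nonneg_of_nonneg_of_le_pi (by linarith) (by linarith))
  · rw [add_re, re_ofReal_mul, (exp_re_im _).1, one_re, cos_pi_div_two_add_chordAngle hr hr']
    nlinarith

theorem arc_neg_om_mem (hr : 0 ≤ r) (hr' : r < 1 / 10) :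
    -om + r * exp ((11 * Real.pi / 6 - chordAngle r : ℝ) * I) ∈ shortArc := by
  have hψ := chordAngle_nonneg hr
  have hψ' := chordAngle_lt hr'
  have hpi := Real.pi_pos
  refine ⟨?_, ?_, ?_⟩
  · rw [← normSq_eq, neg_om_add_polar, norm_exp_add_sq hr hr',
      show 11 * Real.pi / 6 - chordAngle r - Real.pi / 3 =
        2 * Real.pi - (Real.pi / 2 + chordAngle r) by ring, Real.cos_two_pi_sub]
    simp
  · rw [add_im, im_ofReal_mul, (exp_re_im _).2, neg_im, om_im]
    nlinarith [Real.neg_one_le_sin (11 * Real.pi / 6 - chordAngle r), sqrt_three_gt]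
  · rw [add_re, re_ofReal_mul, (exp_re_im _).1, neg_re, om_re, ← Real.cos_two_pi_sub]
    have := mul_nonneg hr (Real.cos_nonneg_of_neg_pi_div_two_le_of_le
      (x := 2 * Real.pi - (11 * Real.pi / 6 - chordAngle r)) (by linarith) (by linarith))
    linarith

theorem tube_snd_place {a : ℂ} (ha : IsBase a) (hr : 0 ≤ r) {t : ℝ} (hT : Tube r t) (θ : ℝ) :
    √3 ≤ (place a θ r t).2 := by
  have h1 := ha.height_le (place a θ r t).1 (place a θ r t).2
  have h2 : height a ((place a θ r t).1, (place a θ r t).2) = t := height_place a θ r t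
  rw [h2, norm_place_sub a θ t hr] at h1
  linarith [hT.2]

theorem place_one_mem₄₁₂ {t : ℝ} (hr : 0 ≤ r) (hT : Tube r t) :
    OnePoint.some (place 1 (Real.pi / 2 + chordAngle r) r t) ∈ triMinus P₄ P₁ P₂ :=
  mem_triMinus₄₁₂.mpr ⟨arc_one_mem hr hT.1, tube_snd_place (Or.inl rfl) hr hT _⟩

theorem place_neg_om_mem₄₁₂ {t : ℝ} (hr : 0 ≤ r) (hT : Tube r t) :
    OnePoint.some (place (-om) (11 * Real.pi / 6 - chordAngle r) r t) ∈ triMinus P₄ P₁ P₂ :=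
  mem_triMinus₄₁₂.mpr ⟨arc_neg_om_mem hr hT.1, tube_snd_place (Or.inr rfl) hr hT _⟩

/-- The map v ↦ ω(v - 1), which projects [P₃, P₁], sends -ω to 1 and rotates by ω = e^{-2πi/3}; this
carries the known angle of the short arc at -ω to the angle of this face at 1. -/
theorem place_one_mem₄₃₁ {t : ℝ} (hr : 0 ≤ r) (hT : Tube r t) :
    OnePoint.some (place 1 (7 * Real.pi / 6 - chordAngle r) r t) ∈ triMinus P₄ P₃ P₁ := by
  have hv := arc_neg_om_mem hr hT.1
  refine mem_triMinus₄₃₁.mpr ⟨_, hv, ?_, ?_⟩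
  · have e : exp ((7 * Real.pi / 6 - chordAngle r : ℝ) * I) =
        om * exp ((11 * Real.pi / 6 - chordAngle r : ℝ) * I) := by
      have : om = exp ((-(2 * Real.pi / 3) : ℝ) * I) := by
        have h2 := neg_star_om_eq
        have : om = -star om * -star om := by rw [star_om]; linear_combination -om_sq
        rw [this, h2, ← Complex.exp_add]; push_cast; ring_nf
      rw [this, ← Complex.exp_add]; push_cast; ring_nf
    rw [e]
    linear_combination om_sq
  · exact (by linarith [(shortArc_im_le hv).2] : _ ≤ √3).trans (tube_snd_place (Or.inl rfl) hr hT _)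

theorem place_neg_om_mem₄₃₂ {t : ℝ} (hr : 0 ≤ r) (hT : Tube r t) :
    OnePoint.some (place (-om) (3 * Real.pi / 2 - chordAngle r) r t) ∈ triMinus P₄ P₃ P₂ := by
  have hv := arc_neg_om_mem hr hT.1
  refine mem_triMinus₄₃₂.mpr ⟨_, hv, ?_, ?_⟩
  · have e : exp ((3 * Real.pi / 2 - chordAngle r : ℝ) * I) =
        -star om * exp ((11 * Real.pi / 6 - chordAngle r : ℝ) * I) := by
      rw [neg_star_om_eq, ← Complex.exp_add]; push_cast; ring_nf
    change -om + r * exp ((3 * Real.pi / 2 - chordAngle r : ℝ) * I) = _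
    rw [e, star_om]
    linear_combination
      (r * exp ((11 * Real.pi / 6 - chordAngle r : ℝ) * I) - om) * om_sq
  · exact (by linarith [(shortArc_im_le hv).2] : _ ≤ √3).trans (tube_snd_place (Or.inr rfl) hr hT _)

end

/-! ### Gaps between the letters `R` -/

section

variable {m : ℕ} {w : ZMod m → Flip} {j : ZMod m}

/-- Going once around the cyclic word returns to w_j, so a next letter R exists and the infimum
defining `gap` is attained. -/
theorem exists_gap [NeZero m] (hj : w j = Flip.R) : w (j + (m - 1 : ℕ) + 1) = Flip.R := by
  have h : ((m - 1 : ℕ) : ZMod m) + 1 = 0 := by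
    have := NeZero.one_le (n := m)
    rw [← Nat.cast_add_one, Nat.sub_add_cancel this, ZMod.natCast_self]
  rw [add_assoc, h, add_zero, hj]

theorem gap_spec [NeZero m] (hj : w j = Flip.R) : w (j + gap w j + 1) = Flip.R :=
  Nat.sInf_mem (s := {n : ℕ | w (j + n + 1) = Flip.R}) ⟨_, exists_gap hj⟩

theorem gap_lt [NeZero m] (hj : w j = Flip.R) : gap w j < m := by
  have h : gap w j ≤ m - 1 := Nat.sInf_le (s := {n : ℕ | w (j + n + 1) = Flip.R}) (exists_gap hj)
  have := NeZero.one_le (n := m)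
  omega

theorem ne_R_of_lt_gap {s : ℕ} (h : s < gap w j) : w (j + s + 1) ≠ Flip.R :=
  fun h' => Nat.notMem_of_lt_sInf (s := {n : ℕ | w (j + n + 1) = Flip.R}) h h'

theorem eq_gap_of_R {s : ℕ} (hs : s ≤ gap w j) (h : w (j + s + 1) = Flip.R) : s = gap w j :=
  hs.eq_or_lt.resolve_right fun h' => ne_R_of_lt_gap h' h

/-- The bigon pairing lands on the bigon with index `gap w j`, whereas the target slab is realised
with its own `backGap`; the pairing is geometrically meaningful because the two numbers agree. -/
theorem backGap_eq (hj : w j = Flip.R) {k : ZMod m} (hk : k = j + gap w j + 1) :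
    backGap w k = gap w j := by
  have key : ∀ n ≤ gap w j, k - n - 1 = j + (gap w j - n : ℕ) := by
    intro n hn
    rw [hk, Nat.cast_sub hn]; ring
  have hmem : gap w j ∈ {n : ℕ | w (k - n - 1) = Flip.R} := by
    rw [Set.mem_ofPred_eq, key _ le_rfl]
    simpa using hj
  refine le_antisymm (Nat.sInf_le hmem) ?_
  by_contra! hlt
  have h1 : w (k - backGap w k - 1) = Flip.R :=
    Nat.sInf_mem (s := {n : ℕ | w (k - n - 1) = Flip.R}) ⟨_, hmem⟩
  rw [key _ hlt.le] at h1
  refine ne_R_of_lt_gap (w := w) (j := j) (s := gap w j - backGap w k - 1) ?_ ?_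
  · have : 0 < gap w j := by omega
    by_contra! h
    have : gap w j - backGap w k = 0 := by omega
    omega
  · convert h1 using 2
    have : gap w j - backGap w k = (gap w j - backGap w k - 1) + 1 := by omega
    conv_rhs => rw [this]
    push_cast
    ring

end

/-! ### The wedges around an edge -/

section

variable {m : ℕ} {w : ZMod m → Flip} {j : ZMod m}

/-- The `3`-cells around the edge `e_j`, in their cyclic order. -/
def wedgeCell (hj : w j = Flip.R) (hk : w (j + gap w j + 1) = Flip.R) : ℕ → Cell w
  | 0 => Cell.slab (j + gap w j + 1) hk
  | 1 => Cell.slab j hj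
  | 2 => Cell.tet j
  | s + 3 => Cell.tet (j + s + 1)

/-- The points over which the edges of the wedges lie. -/
def wedgeBase : ℕ → ℂ
  | 0 => -om
  | 1 => 1
  | 2 => 1
  | _ + 3 => -om

/-- The angle of the bigon `B_l` at `-ω`, measured from `-π / 6`. -/
def bigonAngle (l : ℕ) : ℝ := (((1 - (l : ℤ)) % 6 : ℤ) : ℝ) * (Real.pi / 3)

/-- The angles by which the wedges are rotated in the developed picture. -/
def wedgeShift (l : ℕ) : ℕ → ℝ
  | 0 => -bigonAngle l
  | 1 => 0
  | 2 => 0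
  | s + 3 => (s - 1) * (Real.pi / 3)

/-- The wedge `i` is bounded by the angles `wedgeLo l i r` and `wedgeLo l (i + 1) r` at distance
`r` from the edge. -/
def wedgeLo (l : ℕ) : ℕ → ℝ → ℝ
  | 0, r => -(Real.pi / 6) - bigonAngle l - chordAngle r
  | 1, _ => -(Real.pi / 6)
  | 2, r => Real.pi / 2 + chordAngle r
  | s + 3, r => 7 * Real.pi / 6 + s * (Real.pi / 3) - chordAngle r

theorem isBase_wedgeBase (i : ℕ) : IsBase (wedgeBase i) := by
  rcases i with _ | _ | _ | s
  · exact Or.inr rfl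
  · exact Or.inl rfl
  · exact Or.inl rfl
  · exact Or.inr rfl

theorem bigonAngle_bound (l : ℕ) : 0 ≤ bigonAngle l ∧ bigonAngle l ≤ 5 * (Real.pi / 3) :=
  angle_bound l

/-- The point `x` lies in the tube around the edge in the wedge `i`, with developed cylindrical
coordinates `r`, `Θ`, `t`. -/
structure InWedge (hj : w j = Flip.R) (hk : w (j + gap w j + 1) = Flip.R) (i : ℕ) (x : Pieces w)
    (r Θ t : ℝ) : Prop where
  lt : i < gap w j + 4
  cell : x.1 = wedgeCell hj hk i
  nonneg : 0 ≤ r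
  tube : Tube r t
  lo : wedgeLo (gap w j) i r ≤ Θ
  hi : Θ ≤ wedgeLo (gap w j) (i + 1) r
  eq : (x.2 : CR) = OnePoint.some (place (wedgeBase i) (Θ - wedgeShift (gap w j) i) r t)

variable {hj : w j = Flip.R} {hk : w (j + gap w j + 1) = Flip.R}

/-- Each wedge is narrower than a full turn, so its angle is determined by the point. Strict
positivity of the width can fail on the axis: for l ≡ 1 mod 6 the first wedge has width ψ only. -/
theorem wedgeLo_lt (l i : ℕ) {r : ℝ} (hr : 0 ≤ r) (hr' : r < 1 / 10) :
    wedgeLo l i r ≤ wedgeLo l (i + 1) r ∧ wedgeLo l (i + 1) r < wedgeLo l i r + 2 * Real.pi ∧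
      (r ≠ 0 → wedgeLo l i r < wedgeLo l (i + 1) r) := by
  have hψ := chordAngle_nonneg hr
  have hψ' := chordAngle_lt hr'
  have hpi := Real.pi_pos
  have hk := bigonAngle_bound l
  have hψ0 : r ≠ 0 → 0 < chordAngle r := fun h => by
    have := lt_of_le_of_ne hr (Ne.symm h)
    exact Real.arcsin_pos.mpr (by linarith)
  rcases i with _ | _ | _ | s <;> simp only [wedgeLo] <;> (try push_cast) <;>
    refine ⟨by linarith, by linarith, fun h => ?_⟩ <;> have := hψ0 h <;> linarith

theorem not_vertex_of_tube {a : ℂ} (ha : IsBase a) {p : ℂ × ℝ} (hT : Tube ‖p.1 - a‖ (height a p)) :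
    (OnePoint.some p : CR) ∉ ({P₁, P₂, P₃, P₄} : Set CR) := by
  have key : ∀ b t, IsBase b → ¬ Tube ‖b - a‖ (height a (b, t)) ∨ (b = a) := by
    intro b t hb
    rcases ha with rfl | rfl <;> rcases hb with rfl | rfl
    · exact Or.inr rfl
    · left
      rintro ⟨h, -⟩
      rw [show -om - 1 = star om by rw [star_om]; ring, norm_star, norm_om] at h
      norm_num at h
    · left
      rintro ⟨h, -⟩
      rw [show 1 - -om = -star om by rw [star_om]; ring, norm_neg, norm_star, norm_om] at h
      norm_num at h
    · exact Or.inr rfl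
  have key2 : ∀ b, IsBase b → (OnePoint.some p : CR) ≠ OnePoint.some (b, √3) := by
    intro b hb h
    rw [coe_injective h] at hT
    rcases key b (√3) hb with h' | rfl
    · exact h' hT
    · have := hT.2
      simp [height] at this
      have h0 := im_star_mul_self b
      rw [star_def, mul_im, conj_re, conj_im] at h0
      linarith
  rintro (h | h | h | h)
  · exact key2 1 (Or.inl rfl) h
  · exact key2 (-om) (Or.inr rfl) h
  · rw [coe_injective h] at hT
    have := hT.1
    simp only [zero_sub, norm_neg, ha.norm_eq] at this
    norm_num at this
  · exact OnePoint.coe_ne_infty _ h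

/-- Inside the tube a cell is no more than its wedge; hence wedge coordinates exist on an entire
neighbourhood, in the cell, of a point of the edge. -/
theorem InWedge.exists_of_mem [NeZero m] {i : ℕ} (hi : i < gap w j + 4) {x : Pieces w}
    (hx : x.1 = wedgeCell hj hk i) {p : ℂ × ℝ} (hp : (x.2 : CR) = OnePoint.some p)
    (hT : Tube ‖p.1 - wedgeBase i‖ (height (wedgeBase i) p)) :
    ∃ Θ, InWedge hj hk i x ‖p.1 - wedgeBase i‖ Θ (height (wedgeBase i) p) := by
  have key : ∀ θ, wedgeLo (gap w j) i ‖p.1 - wedgeBase i‖ ≤ θ + wedgeShift (gap w j) i →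
      θ + wedgeShift (gap w j) i ≤ wedgeLo (gap w j) (i + 1) ‖p.1 - wedgeBase i‖ →
      p.1 = wedgeBase i + ‖p.1 - wedgeBase i‖ * exp (θ * I) →
      ∃ Θ, InWedge hj hk i x ‖p.1 - wedgeBase i‖ Θ (height (wedgeBase i) p) := by
    intro θ h1 h2 h3
    refine ⟨θ + wedgeShift (gap w j) i, hi, hx, norm_nonneg _, hT, h1, h2, ?_⟩
    rw [hp, add_sub_cancel_right]
    congr 1
    refine Prod.ext h3 ?_
    simp only [place, ← h3, height]
    ring
  obtain ⟨c, x⟩ := x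
  obtain ⟨z, t⟩ := p
  simp only at hx hp
  subst hx
  rcases i with _ | _ | _ | s
  · have hm : (OnePoint.some (z, t) : CR) ∈ slab (backGap w (j + gap w j + 1)) := hp ▸ x.2.1
    rw [backGap_eq hj rfl, mem_slab_iff] at hm
    obtain ⟨θ, h1, h2, h3⟩ := exists_angle_slab_neg_om hm hT.1
    refine key θ ?_ ?_ h3 <;> simp only [wedgeLo, wedgeShift, wedgeBase, bigonAngle] <;> linarith
  · have hm : (OnePoint.some (z, t) : CR) ∈ slab (backGap w j) := hp ▸ x.2.1
    rw [mem_slab_iff] at hm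
    obtain ⟨θ, h1, h2, h3⟩ := exists_angle_slab_one hm hT.1
    refine key θ ?_ ?_ h3 <;> simp only [wedgeLo, wedgeShift, wedgeBase] <;> linarith
  · have hm : (OnePoint.some (z, t) : CR) ∈ tetrahedron (tetType w j) := hp ▸ x.2.1
    rw [mem_tetrahedron_iff_of_tube _ (Or.inl rfl) hT] at hm
    obtain ⟨θ, h1, h2, h3⟩ := exists_angle_region_one hm hT.1
    refine key θ ?_ ?_ h3 <;> simp only [wedgeLo, wedgeShift, wedgeBase] <;> (try push_cast) <;>
      linarith
  · have hm : (OnePoint.some (z, t) : CR) ∈ tetrahedron (tetType w (j + s + 1)) := hp ▸ x.2.1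
    rw [mem_tetrahedron_iff_of_tube _ (Or.inr rfl) hT] at hm
    obtain ⟨θ, h1, h2, h3⟩ := exists_angle_region_neg_om hm hT.1
    refine key θ ?_ ?_ h3 <;> simp only [wedgeLo, wedgeShift, wedgeBase] <;> (try push_cast) <;>
      linarith

theorem tube_place {a : ℂ} {r t : ℝ} (hr : 0 ≤ r) (hT : Tube r t) (θ : ℝ) :
    Tube ‖(place a θ r t).1 - a‖ (height a (place a θ r t)) := by
  rw [norm_place_sub a θ t hr, height_place]; exact hT

variable (hj hk) in
-- Converse of `InWedge.exists_of_mem`: every admissible triple of coordinates is realised in the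
-- cell, and the tube avoids the removed vertices.
theorem place_mem_ideal [NeZero m] {i : ℕ} {r Θ t : ℝ}
    (hr : 0 ≤ r) (hT : Tube r t) (h1 : wedgeLo (gap w j) i r ≤ Θ)
    (h2 : Θ ≤ wedgeLo (gap w j) (i + 1) r) :
    OnePoint.some (place (wedgeBase i) (Θ - wedgeShift (gap w j) i) r t) ∈
      (wedgeCell hj hk i).ideal := by
  have hpt := tube_place (a := wedgeBase i) hr hT (Θ - wedgeShift (gap w j) i)
  have hv := not_vertex_of_tube (isBase_wedgeBase i) hpt
  have hv' : OnePoint.some (place (wedgeBase i) (Θ - wedgeShift (gap w j) i) r t) ∉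
      ({P₁, P₂, P₄} : Set CR) := by
    intro h
    apply hv
    rcases h with h | h | h
    · exact Or.inl h
    · exact Or.inr (Or.inl h)
    · exact Or.inr (Or.inr (Or.inr h))
  have hpi := Real.pi_pos
  rcases i with _ | _ | _ | s <;> simp only [wedgeLo] at h1 h2
  · refine ⟨?_, hv'⟩
    change _ ∈ slab (backGap w (j + gap w j + 1))
    rw [backGap_eq hj rfl]
    refine (mem_slab_iff _ _ _).mpr (mem_slabBase_neg_om _ hr hT.1 ?_ ?_) <;>
      simp only [wedgeShift, bigonAngle] at * <;> linarith
  · refine ⟨(mem_slab_iff _ _ _).mpr (mem_slabBase_one _ hr hT.1 ?_ ?_), hv'⟩ <;>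
      simp only [wedgeShift] at * <;> linarith
  · refine ⟨(mem_tetrahedron_iff_of_tube _ (Or.inl rfl) hpt).mpr (mem_region_one hr hT.1 ?_ ?_),
      hv⟩ <;> simp only [wedgeShift] at * <;> (try push_cast at *) <;> linarith
  · refine ⟨(mem_tetrahedron_iff_of_tube _ (Or.inr rfl) hpt).mpr (mem_region_neg_om hr hT.1 ?_ ?_),
      hv⟩ <;> simp only [wedgeShift] at * <;> (try push_cast at *) <;> linarith

variable (hj hk) in
/-- The point of a wedge with given developed cylindrical coordinates. -/
theorem exists_inWedge [NeZero m] {i : ℕ} (hi : i < gap w j + 4) {r Θ t : ℝ} (hr : 0 ≤ r)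
    (hT : Tube r t) (h1 : wedgeLo (gap w j) i r ≤ Θ) (h2 : Θ ≤ wedgeLo (gap w j) (i + 1) r) :
    ∃ x, InWedge hj hk i x r Θ t :=
  ⟨⟨wedgeCell hj hk i, ⟨_, place_mem_ideal hj hk hr hT h1 h2⟩⟩, hi, rfl, hr, hT, h1, h2, rfl⟩

/-- The same cell may occur as two wedges (slab j and tetrahedron j do so if w contains a single R).
The base point, 1 or -ω, then tells the wedges apart, the two tubes being disjoint. -/
theorem InWedge.unique [NeZero m] {i i' : ℕ} {x : Pieces w} {r Θ t r' Θ' t' : ℝ}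
    (h : InWedge hj hk i x r Θ t) (h' : InWedge hj hk i' x r' Θ' t') :
    i = i' ∧ r = r' ∧ t = t' ∧ (r = 0 ∨ Θ = Θ') := by
  have hpt := tube_place (a := wedgeBase i) h.nonneg h.tube (Θ - wedgeShift (gap w j) i)
  have hpt' := tube_place (a := wedgeBase i') h'.nonneg h'.tube (Θ' - wedgeShift (gap w j) i')
  have e := coe_injective (h.eq.symm.trans h'.eq)
  have hb : wedgeBase i = wedgeBase i' := by
    rw [← e] at hpt'
    have h1 : ‖wedgeBase i - wedgeBase i'‖ < 1 := by
      have := norm_sub_le_norm_sub_add_norm_sub (wedgeBase i)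
        (place (wedgeBase i) (Θ - wedgeShift (gap w j) i) r t).1 (wedgeBase i')
      rw [norm_sub_rev (wedgeBase i) (place _ _ _ _).1] at this
      linarith [hpt.1, hpt'.1]
    have e1 : ‖-om - 1‖ = 1 := by
      rw [show -om - 1 = star om by rw [star_om]; ring, norm_star, norm_om]
    rcases isBase_wedgeBase i with h2 | h2 <;> rcases isBase_wedgeBase i' with h3 | h3 <;>
      rw [h2, h3] at h1 ⊢
    · rw [norm_sub_rev] at h1; linarith
    · linarith
  have hi : i = i' := by
    have hc := h.cell.symm.trans h'.cell
    have hl := h.lt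
    have hl' := h'.lt
    have hg := gap_lt hj
    have h1 : (1 : ℂ) ≠ -om := by
      intro h; have := congrArg re h; simp [om_re] at this
    rcases i with _ | _ | _ | s <;> rcases i' with _ | _ | _ | s' <;>
      simp only [wedgeBase, wedgeCell, reduceCtorEq, Cell.tet.injEq] at hb hc ⊢
    all_goals first
      | rfl
      | exact absurd hb h1
      | exact absurd hb.symm h1
      | skip
    -- Two tetrahedra over -ω remain; s and s' are at most `gap w j`, hence less than m, so their
    -- residues determine them.
    have : (s : ZMod m) = s' := by simpa using hc
    rw [ZMod.natCast_eq_natCast_iff', Nat.mod_eq_of_lt (show s < m by omega),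
      Nat.mod_eq_of_lt (show s' < m by omega)] at this
    rw [this]
  subst hi
  have e1 := congrArg (height (wedgeBase i)) e
  rw [height_place, height_place] at e1
  have e2 := congrArg Prod.fst e
  simp only [place] at e2
  obtain ⟨rfl, e3⟩ := eq_of_polar_eq h.nonneg h'.nonneg (add_left_cancel e2)
  refine ⟨rfl, rfl, e1, e3.imp_right ?_⟩
  rintro ⟨n, hn⟩
  have hw := wedgeLo_lt (gap w j) i h.nonneg h.tube.1
  have := h.lo
  have := h.hi
  have := h'.lo
  have := h'.hi
  have hn0 : n = 0 := int_eq_zero_of_abs_lt (x := Θ - Θ') (by linarith)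
    (abs_lt.mpr ⟨by linarith, by linarith⟩)
  rw [hn0] at hn
  simp at hn
  exact hn

end

/-! ### Gluing the wedges -/

section

variable {m : ℕ} {w : ZMod m → Flip} {j : ZMod m}
  {hj : w j = Flip.R} {hk : w (j + gap w j + 1) = Flip.R} {i : ℕ} {x y : Pieces w} {r Θ t : ℝ}

namespace InWedge

theorem eq_of (h : InWedge hj hk i x r Θ t) {Θ₀ : ℝ} (h0 : r = 0 ∨ Θ = Θ₀) :
    (x.2 : CR) = OnePoint.some (place (wedgeBase i) (Θ₀ - wedgeShift (gap w j) i) r t) := by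
  rcases h0 with rfl | rfl
  · rw [h.eq, place_zero]
  · exact h.eq

theorem of_lo (hi : i < gap w j + 4) (hc : x.1 = wedgeCell hj hk i) (hr : 0 ≤ r) (hT : Tube r t)
    (he : (x.2 : CR) = OnePoint.some
      (place (wedgeBase i) (wedgeLo (gap w j) i r - wedgeShift (gap w j) i) r t)) :
    InWedge hj hk i x r (wedgeLo (gap w j) i r) t :=
  ⟨hi, hc, hr, hT, le_rfl, (wedgeLo_lt _ i hr hT.1).1, he⟩

theorem of_hi (hi : i < gap w j + 4) (hc : x.1 = wedgeCell hj hk i) (hr : 0 ≤ r) (hT : Tube r t)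
    (he : (x.2 : CR) = OnePoint.some
      (place (wedgeBase i) (wedgeLo (gap w j) (i + 1) r - wedgeShift (gap w j) i) r t)) :
    InWedge hj hk i x r (wedgeLo (gap w j) (i + 1) r) t :=
  ⟨hi, hc, hr, hT, (wedgeLo_lt _ i hr hT.1).1, le_rfl, he⟩

theorem cases_tet (h : InWedge hj hk i x r Θ t) {a : ZMod m} (ha : x.1 = Cell.tet a) :
    (i = 2 ∧ a = j) ∨ ∃ s : ℕ, i = s + 3 ∧ a = j + s + 1 ∧ s ≤ gap w j := by
  have hc := ha.symm.trans h.cell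
  have hl := h.lt
  rcases i with _ | _ | _ | s <;> simp only [wedgeCell, reduceCtorEq, Cell.tet.injEq] at hc
  · exact Or.inl ⟨rfl, hc⟩
  · exact Or.inr ⟨s, rfl, hc, by omega⟩

theorem cases_slab (h : InWedge hj hk i x r Θ t) {a : ZMod m} {ha' : w a = Flip.R}
    (ha : x.1 = Cell.slab a ha') : (i = 0 ∧ a = j + gap w j + 1) ∨ (i = 1 ∧ a = j) := by
  have hc := ha.symm.trans h.cell
  rcases i with _ | _ | _ | s <;> simp only [wedgeCell, reduceCtorEq, Cell.slab.injEq] at hc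
  · exact Or.inl ⟨rfl, hc⟩
  · exact Or.inr ⟨rfl, hc⟩

/-! #### The faces of the wedges -/

theorem not_bottom (h : InWedge hj hk i x r Θ t) (T : TetType) : (x.2 : CR) ∉ bottomFace T := by
  intro hF
  rw [h.eq] at hF
  exact not_tube_of_mem_bottomFace (isBase_wedgeBase i) hF (tube_place h.nonneg h.tube _)

theorem not_triPlus (h : InWedge hj hk i x r Θ t) : (x.2 : CR) ∉ triPlus P₄ P₁ P₂ := by
  intro hF
  rw [h.eq] at hF
  exact not_tube_of_mem_triPlus₄₁₂ (isBase_wedgeBase i) hF (tube_place h.nonneg h.tube _)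

theorem face₄₁₂_zero (h : InWedge hj hk 0 x r Θ t) (hF : (x.2 : CR) ∈ triMinus P₄ P₁ P₂) :
    r = 0 ∨ Θ = wedgeLo (gap w j) 0 r := by
  rw [h.eq] at hF
  have h1 := h.lo
  have h2 := h.hi
  have hb := bigonAngle_bound (gap w j)
  simp only [wedgeLo, wedgeShift] at *
  refine (angle_slab_neg_om_lo h.nonneg h.tube.1 ?_ ?_ (mem_triMinus₄₁₂.mp hF).1).imp_right ?_
  · linarith
  · linarith [Real.pi_pos]
  · intro; linarith

theorem face_bigon_zero (h : InWedge hj hk 0 x r Θ t) (hF : (x.2 : CR) ∈ bigon (gap w j)) :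
    r = 0 ∨ Θ = wedgeLo (gap w j) 1 r := by
  rw [h.eq] at hF
  have h1 := h.lo
  have h2 := h.hi
  simp only [wedgeLo, wedgeShift, bigonAngle] at *
  refine (angle_slab_neg_om_hi h.nonneg h.tube.1 ?_ ?_ hF).imp_right ?_
  · linarith
  · linarith
  · intro; linarith

theorem face_bigon'_one (h : InWedge hj hk 1 x r Θ t) (hF : (x.2 : CR) ∈ bigon') :
    r = 0 ∨ Θ = wedgeLo (gap w j) 1 r := by
  rw [h.eq] at hF
  have h1 := h.lo
  have h2 := h.hi
  simp only [wedgeLo, wedgeShift] at *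
  refine (angle_slab_one_lo h.nonneg h.tube.1 ?_ ?_ hF).imp_right ?_
  · linarith
  · linarith
  · intro; linarith

theorem face₄₁₂_one (h : InWedge hj hk 1 x r Θ t) (hF : (x.2 : CR) ∈ triMinus P₄ P₁ P₂) :
    r = 0 ∨ Θ = wedgeLo (gap w j) 2 r := by
  rw [h.eq] at hF
  have h1 := h.lo
  have h2 := h.hi
  simp only [wedgeLo, wedgeShift] at *
  refine (angle_slab_one_hi h.nonneg h.tube.1 ?_ ?_
    (norm_of_mem_shortArc (mem_triMinus₄₁₂.mp hF).1)).imp_right ?_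
  · linarith
  · linarith
  · intro; linarith

theorem face₄₁₂_two (h : InWedge hj hk 2 x r Θ t) (hF : (x.2 : CR) ∈ triMinus P₄ P₁ P₂) :
    r = 0 ∨ Θ = wedgeLo (gap w j) 2 r := by
  rw [h.eq] at hF
  have h1 := h.lo
  have h2 := h.hi
  simp only [wedgeLo, wedgeShift, Nat.cast_zero] at *
  refine (angle_tet_one_lo h.nonneg h.tube.1 ?_ ?_
    (norm_of_mem_shortArc (mem_triMinus₄₁₂.mp hF).1)).imp_right ?_
  · linarith
  · linarith
  · intro; linarith

theorem face₄₃₁_two (h : InWedge hj hk 2 x r Θ t) (hF : (x.2 : CR) ∈ triMinus P₄ P₃ P₁) :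
    r = 0 ∨ Θ = wedgeLo (gap w j) 3 r := by
  rw [h.eq] at hF
  have h1 := h.lo
  have h2 := h.hi
  simp only [wedgeLo, wedgeShift, Nat.cast_zero] at *
  obtain ⟨v, hv, e, -⟩ := mem_triMinus₄₃₁.mp hF
  refine (angle_tet_one_hi h.nonneg h.tube.1 ?_ ?_
    (Eq.trans (congrArg (fun z => ‖z + om‖) e) (norm_add_om_of_mem hv))).imp_right ?_
  · linarith
  · linarith
  · intro; linarith

theorem face₄₁₂_add_three {s : ℕ} (h : InWedge hj hk (s + 3) x r Θ t)
    (hF : (x.2 : CR) ∈ triMinus P₄ P₁ P₂) : r = 0 ∨ Θ = wedgeLo (gap w j) (s + 4) r := by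
  rw [h.eq] at hF
  have h1 := h.lo
  have h2 := h.hi
  simp only [wedgeLo, wedgeShift] at *
  push_cast at *
  refine (angle_tet_neg_om_hi h.nonneg h.tube.1 ?_ ?_
    (norm_of_mem_shortArc (mem_triMinus₄₁₂.mp hF).1)).imp_right ?_
  · linarith
  · linarith
  · intro; linarith

theorem face₄₃₂_add_three {s : ℕ} (h : InWedge hj hk (s + 3) x r Θ t)
    (hF : (x.2 : CR) ∈ triMinus P₄ P₃ P₂) : r = 0 ∨ Θ = wedgeLo (gap w j) (s + 3) r := by
  rw [h.eq] at hF
  have h1 := h.lo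
  have h2 := h.hi
  simp only [wedgeLo, wedgeShift] at *
  push_cast at *
  obtain ⟨v, hv, e, -⟩ := mem_triMinus₄₃₂.mp hF
  refine (angle_tet_neg_om_lo h.nonneg h.tube.1 ?_ ?_
    (Eq.trans (congrArg (fun z => ‖z - star om‖) e) (norm_sub_star_om_of_mem hv))).imp_right ?_
  · linarith
  · linarith
  · intro; linarith

theorem not_face₄₃₁_add_three {s : ℕ} (h : InWedge hj hk (s + 3) x r Θ t) :
    (x.2 : CR) ∉ triMinus P₄ P₃ P₁ := by
  intro hF
  rw [h.eq] at hF
  obtain ⟨v, hv, e, -⟩ := mem_triMinus₄₃₁.mp hF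
  have h1 := norm_place_sub (wedgeBase (s + 3)) (Θ - wedgeShift (gap w j) (s + 3)) t h.nonneg
  have h2 : ‖(place (wedgeBase (s + 3)) (Θ - wedgeShift (gap w j) (s + 3)) r t).1 + om‖ = 1 :=
    Eq.trans (congrArg (fun z => ‖z + om‖) e) (norm_add_om_of_mem hv)
  rw [show wedgeBase (s + 3) = -om from rfl, sub_neg_eq_add] at h1
  have := h.tube.1
  linarith [h2.symm.trans h1]

theorem not_face₄₃₂_two (h : InWedge hj hk 2 x r Θ t) : (x.2 : CR) ∉ triMinus P₄ P₃ P₂ := by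
  intro hF
  rw [h.eq] at hF
  obtain ⟨v, hv, e, -⟩ := mem_triMinus₄₃₂.mp hF
  have h1 := norm_place_sub (wedgeBase 2) (Θ - wedgeShift (gap w j) 2) t h.nonneg
  have h2 : ‖(place (wedgeBase 2) (Θ - wedgeShift (gap w j) 2) r t).1 - star om‖ = 1 :=
    Eq.trans (congrArg (fun z => ‖z - star om‖) e) (norm_sub_star_om_of_mem hv)
  have := h.tube.1
  exact absurd h2 (one_le_norm_sub_star_om (h1.trans_lt this)).ne'

theorem not_bigon'_zero (h : InWedge hj hk 0 x r Θ t) : (x.2 : CR) ∉ bigon' := by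
  rw [h.eq]
  exact not_mem_bigon'_neg_om h.nonneg h.tube.1

theorem not_bigon_one (h : InWedge hj hk 1 x r Θ t) (k : ℕ) : (x.2 : CR) ∉ bigon k := by
  rw [h.eq]
  exact not_mem_bigon_one h.nonneg h.tube.1

end InWedge

/-- The ramification order `N` of the edge, characterised by the total angle. -/
def IsTotalAngle (l N : ℕ) : Prop := bigonAngle l + (l + 5) * (Real.pi / 3) = 2 * Real.pi * N

/-- The last boundary and the first are the same face after N full turns; the corrections ψ agree on
both sides, so the identity holds at every distance r. -/
theorem wedgeLo_last {l N : ℕ} (hN : IsTotalAngle l N) (r : ℝ) :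
    wedgeLo l (l + 4) r = wedgeLo l 0 r + 2 * Real.pi * N := by
  rw [← hN]
  simp only [wedgeLo]
  push_cast
  ring

/-- Reducing 1 - l modulo 6 in `bigonAngle` changes the direction of the bigon only by full turns.
-/
theorem bigon_place (l : ℕ) (r t : ℝ) :
    place (-om) (-(Real.pi / 6) + bigonAngle l) r t =
      place (-om) (-(Real.pi / 6) + Real.pi / 3 - l * (Real.pi / 3)) r t := by
  obtain ⟨n, hn⟩ := exists_bigon_angle l
  rw [show -(Real.pi / 6) + bigonAngle l =
    (-(Real.pi / 6) + Real.pi / 3 - l * (Real.pi / 3)) + 2 * Real.pi * n by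
      rw [bigonAngle, hn]; ring, place_add_two_pi]

theorem slab_face_place (r t : ℝ) :
    place (-om) (-(Real.pi / 6) - chordAngle r) r t =
      place (-om) (11 * Real.pi / 6 - chordAngle r) r t := by
  rw [← place_add_two_pi (-om) (-(Real.pi / 6) - chordAngle r) r t 1]
  congr 1
  push_cast
  ring

/-- Two developed angles which agree up to the rotation by the total angle. -/
def AngleEq (N : ℕ) (r Θ Θ' : ℝ) : Prop := r = 0 ∨ ∃ n : ℤ, Θ' = Θ + 2 * Real.pi * N * n

theorem AngleEq.of_eq {N : ℕ} {Θ₀ Θ' : ℝ} (h : r = 0 ∨ Θ = Θ₀) (h' : Θ' = Θ₀) :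
    AngleEq N r Θ Θ' := h.imp_right fun h => ⟨0, by rw [h, h']; simp⟩

theorem AngleEq.of_add {N : ℕ} {Θ₀ Θ' : ℝ} (h : r = 0 ∨ Θ = Θ₀) (n : ℤ)
    (h' : Θ' = Θ₀ + 2 * Real.pi * N * n) : AngleEq N r Θ Θ' :=
  h.imp_right fun h => ⟨n, by rw [h, h']⟩

/-- A pairing either misses the tube or moves a boundary face of one wedge onto that of a
neighbouring wedge. The shifts in `wedgeShift` are chosen to undo the rotations by `G₂` and `G₃`, so
the developed angle is unchanged except where the cycle closes. -/
theorem InWedge.glue {N : ℕ} (hN : IsTotalAngle (gap w j) N) (hG : Glue w x y)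
    (h : InWedge hj hk i x r Θ t) :
    ∃ i' Θ', InWedge hj hk i' y r Θ' t ∧ AngleEq N r Θ Θ' := by
  obtain ⟨F, G, F', hP, hxF, -, hy⟩ := hG
  obtain ⟨c, x⟩ := x
  obtain ⟨c', y⟩ := y
  simp only at hP hxF hy
  have hl := h.lt
  cases hP with
  | left₁ a ha =>
    rcases h.cases_tet rfl with ⟨rfl, rfl⟩ | ⟨s, rfl, ha', hs⟩
    · rw [hj] at ha; cases ha
    · exact absurd hxF h.not_face₄₃₁_add_three
  | left₂ a ha =>
    rcases h.cases_tet rfl with ⟨rfl, rfl⟩ | ⟨s, rfl, ha', hs⟩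
    · rw [hj] at ha; cases ha
    -- The last tetrahedron of the cycle is of type R, so an L-pairing starts earlier and wedge s +
    -- 4 still belongs to the cycle.
    · have hs' : s ≠ gap w j := by
        rintro rfl
        rw [ha', hk] at ha; cases ha
      have e := h.face₄₁₂_add_three hxF
      refine ⟨s + 4, _, of_lo (by omega) ?_ h.nonneg h.tube ?_, AngleEq.of_eq e rfl⟩
      · simp only [wedgeCell]
        rw [ha']; push_cast; ring_nf
      · have hx := h.eq_of e
        simp only at hx ⊢
        rw [hy, hx]
        refine (act_G₂_place _ _ _).trans ?_
        simp only [wedgeLo, wedgeShift, wedgeBase]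
        push_cast; ring_nf
  | right₁ a ha =>
    rcases h.cases_tet rfl with ⟨rfl, rfl⟩ | ⟨s, rfl, ha', hs⟩
    · have e := h.face₄₃₁_two hxF
      refine ⟨3, _, of_lo (by omega) ?_ h.nonneg h.tube ?_, AngleEq.of_eq e rfl⟩
      · simp only [wedgeCell]; simp
      · have hx := h.eq_of e
        simp only at hx ⊢
        rw [hy, hx]
        refine (act_G₃_place _ _ _).trans ?_
        simp only [wedgeLo, wedgeShift, wedgeBase]
        push_cast; ring_nf
    · exact absurd hxF h.not_face₄₃₁_add_three
  | right₂ a ha => exact absurd hxF h.not_triPlus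
  | inner a ha =>
    rw [act_one] at hy
    rcases h.cases_tet rfl with ⟨rfl, rfl⟩ | ⟨s, rfl, ha', hs⟩
    · have e := h.face₄₁₂_two hxF
      refine ⟨1, _, of_hi (by omega) rfl h.nonneg h.tube ?_, AngleEq.of_eq e rfl⟩
      exact hy.trans (h.eq_of e)
    -- Here the cycle closes: the last tetrahedron is glued to the slab of wedge 0, and the
    -- developed angle drops by the total angle 2πN.
    · have hs' : s = gap w j := eq_gap_of_R hs (ha' ▸ ha)
      subst hs'
      have e := h.face₄₁₂_add_three hxF
      refine ⟨0, _, of_lo (by omega) ?_ h.nonneg h.tube ?_,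
        AngleEq.of_add e (-1) (by rw [wedgeLo_last hN]; push_cast; ring)⟩
      · simp only [wedgeCell, ha']
      · refine hy.trans ((h.eq_of e).trans ?_)
        simp only [wedgeLo, wedgeShift, wedgeBase]
        have := slab_face_place r t
        rw [show -(Real.pi / 6) - bigonAngle (gap w j) - chordAngle r - -bigonAngle (gap w j) =
          -(Real.pi / 6) - chordAngle r by ring, this]
        push_cast; ring_nf
  | bigon a b ha hb hab =>
    rcases h.cases_slab rfl with ⟨rfl, ha'⟩ | ⟨rfl, ha'⟩
    · exact absurd hxF h.not_bigon'_zero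
    · subst ha'
      have e := h.face_bigon'_one hxF
      refine ⟨0, _, of_hi (by omega) ?_ h.nonneg h.tube ?_, AngleEq.of_eq e rfl⟩
      · simp only [wedgeCell, hab]
      · have hx := h.eq_of e
        simp only at hx ⊢
        rw [hy, hx]
        refine (act_G₂_pow_mul_G₃_place _ _ _ _).trans ?_
        simp only [wedgeLo, wedgeShift, wedgeBase]
        rw [sub_neg_eq_add, bigon_place, sub_zero]

/-- Passing to the cyclically next R is injective, so the slab glued to wedge 0 through its bigon
can only be slab j. -/
theorem next_injective {a : ZMod m} (ha : w a = Flip.R) (hj : w j = Flip.R)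
    (h : a + gap w a + 1 = j + gap w j + 1) : a = j := by
  have h' := add_right_cancel h
  have key : ∀ a b : ZMod m, w a = Flip.R → w b = Flip.R → a + gap w a = b + gap w b →
      gap w a ≤ gap w b := by
    intro a b ha hb hab
    by_contra! hlt
    refine ne_R_of_lt_gap (w := w) (j := a) (s := gap w a - gap w b - 1) (by omega) ?_
    convert hb using 2
    have e : ((gap w a - gap w b - 1 : ℕ) : ZMod m) + 1 + gap w b = gap w a := by
      norm_cast
      congr 1
      omega
    linear_combination e + hab
  have := le_antisymm (key a j ha hj h') (key j a hj ha h'.symm)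
  rw [this] at h'
  exact add_right_cancel h'

/-- The relation `Glue` is directed, so following it backwards needs a separate analysis, now by the
target faces. Together with `InWedge.glue` it shows that the union of the wedges is saturated. -/
theorem InWedge.glue_symm {N : ℕ} (hN : IsTotalAngle (gap w j) N) (hG : Glue w x y)
    (h : InWedge hj hk i y r Θ t) :
    ∃ i' Θ', InWedge hj hk i' x r Θ' t ∧ AngleEq N r Θ Θ' := by
  obtain ⟨F, G, F', hP, -, hyF, hy⟩ := hG
  obtain ⟨c, x⟩ := x
  obtain ⟨c', y⟩ := y
  simp only at hP hyF hy
  have hl := h.lt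
  cases hP with
  | left₁ a ha => exact absurd hyF (h.not_bottom TetType.A)
  | left₂ a ha =>
    rcases h.cases_tet rfl with ⟨rfl, -⟩ | ⟨s, rfl, ha', hs⟩
    · exact absurd hyF h.not_face₄₃₂_two
    · have ha'' := add_right_cancel ha'
      -- The first tetrahedron over -ω comes from tetrahedron j, which is of type R, so an L-pairing
      -- cannot lead into it.
      rcases s with _ | s
      · rw [ha''] at ha
        simp [hj] at ha
      have e := h.face₄₃₂_add_three hyF
      refine ⟨s + 3, _, of_hi (by omega) ?_ h.nonneg h.tube ?_, AngleEq.of_eq e rfl⟩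
      · simp only [wedgeCell]
        rw [ha'']; push_cast; ring_nf
      · have hx := h.eq_of e
        refine isU21_G₂.act_injective (hy.symm.trans (hx.trans ?_))
        refine Eq.trans ?_ (act_G₂_place _ _ _).symm
        simp only [wedgeLo, wedgeShift, wedgeBase]
        push_cast; ring_nf
  | right₁ a ha =>
    rcases h.cases_tet rfl with ⟨rfl, -⟩ | ⟨s, rfl, ha', hs⟩
    · exact absurd hyF h.not_face₄₃₂_two
    · have ha'' := add_right_cancel ha'
      rcases s with _ | s
      · have e := h.face₄₃₂_add_three hyF
        refine ⟨2, _, of_hi (by omega) ?_ h.nonneg h.tube ?_, AngleEq.of_eq e rfl⟩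
        · simp only [wedgeCell]
          rw [ha'']; simp
        · have hx := h.eq_of e
          refine isU21_G₃.act_injective (hy.symm.trans (hx.trans ?_))
          refine Eq.trans ?_ (act_G₃_place _ _ _).symm
          simp only [wedgeLo, wedgeShift, wedgeBase]
          push_cast; ring_nf
      · refine absurd ?_ (ne_R_of_lt_gap (w := w) (j := j) (s := s) (by omega))
        rw [← ha, ha'']; push_cast; ring_nf
  | right₂ a ha => exact absurd hyF (h.not_bottom TetType.B)
  | inner a ha =>
    rw [act_one] at hy
    rcases h.cases_slab rfl with ⟨rfl, ha'⟩ | ⟨rfl, rfl⟩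
    · have e := h.face₄₁₂_zero hyF
      refine ⟨gap w j + 3, _, of_hi (by omega) ?_ h.nonneg h.tube ?_,
        AngleEq.of_add e 1 (by rw [wedgeLo_last hN]; push_cast; ring)⟩
      · simp only [wedgeCell]; rw [ha']
      · refine hy.symm.trans ((h.eq_of e).trans ?_)
        simp only [wedgeLo, wedgeShift, wedgeBase]
        have := slab_face_place r t
        rw [show -(Real.pi / 6) - bigonAngle (gap w j) - chordAngle r - -bigonAngle (gap w j) =
          -(Real.pi / 6) - chordAngle r by ring, this]
        push_cast; ring_nf
    · have e := h.face₄₁₂_one hyF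
      refine ⟨2, _, of_lo (by omega) rfl h.nonneg h.tube ?_, AngleEq.of_eq e rfl⟩
      exact hy.symm.trans (h.eq_of e)
  | bigon a b ha hb hab =>
    rcases h.cases_slab rfl with ⟨rfl, ha'⟩ | ⟨rfl, ha'⟩
    · have haj := next_injective ha hj (hab.symm.trans ha')
      subst haj
      have e := h.face_bigon_zero hyF
      refine ⟨1, _, of_lo (by omega) rfl h.nonneg h.tube ?_, AngleEq.of_eq e rfl⟩
      have hx := h.eq_of e
      refine ((isU21_pow isU21_G₂ _).mul isU21_G₃).act_injective (hy.symm.trans (hx.trans ?_))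
      refine Eq.trans ?_ (act_G₂_pow_mul_G₃_place _ _ _ _).symm
      simp only [wedgeLo, wedgeShift, wedgeBase]
      rw [sub_neg_eq_add, bigon_place, sub_zero]
    · exact absurd hyF (h.not_bigon_one _)

end

/-! ### Equality of developed coordinates implies equality in the bundle -/

section

variable {m : ℕ} {w : ZMod m → Flip} {j : ZMod m}
  {hj : w j = Flip.R} {hk : w (j + gap w j + 1) = Flip.R} {i : ℕ} {x y : Pieces w} {r Θ t : ℝ}

theorem piHat_eq_of_glue (h : Glue w x y) : piHat w x = piHat w y := Quot.sound h

theorem piHat_eq_of_pairing {F F' : Set CR} {G : Matrix (Fin 3) (Fin 3) ℂ} {c c' : Cell w}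
    (hP : Pairing w c F G c' F') (hx : x.1 = c) (hy : y.1 = c') (hF : (x.2 : CR) ∈ F)
    (hF' : (y.2 : CR) ∈ F') (h : (y.2 : CR) = act G x.2) : piHat w x = piHat w y :=
  piHat_eq_of_glue ⟨F, G, F', by rw [hx, hy]; exact hP, hF, hF', h⟩

namespace InWedge

/-- The common boundary angle of consecutive wedges is a genuine face pairing: in turn the bigon,
the inner face of the slab, the R-pairing by `G₃`, and then the L-pairings by `G₂`. -/
theorem piHat_eq_succ {r t : ℝ} (hx : InWedge hj hk i x r (wedgeLo (gap w j) (i + 1) r) t)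
    (hy : InWedge hj hk (i + 1) y r (wedgeLo (gap w j) (i + 1) r) t) :
    piHat w x = piHat w y := by
  have hr := hx.nonneg
  have hT := hx.tube
  have ex := hx.eq
  have ey := hy.eq
  have hl := hy.lt
  rcases i with _ | _ | _ | s
  · simp only [wedgeBase, wedgeShift, wedgeLo, sub_neg_eq_add, sub_zero, bigon_place]
      at ex ey
    have e : (x.2 : CR) = act (G₂ ^ gap w j * G₃) y.2 := by
      rw [ex, ey, act_G₂_pow_mul_G₃_place]
    refine (piHat_eq_of_pairing (Pairing.bigon j _ hj hk rfl) hy.cell hx.cell ?_ ?_ e).symm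
    · rw [ey]
      exact mem_bigon'_iff.mpr ⟨r, hr, rfl⟩
    · rw [ex]
      refine mem_bigon_iff.mpr ⟨r, hr, ?_⟩
      congr 4
      push_cast
      ring
  · simp only [wedgeBase, wedgeShift, wedgeLo, sub_zero] at ex ey
    have hF := place_one_mem₄₁₂ hr hT
    refine (piHat_eq_of_pairing (Pairing.inner j hj) hy.cell hx.cell ?_ ?_ ?_).symm
    · rw [ey]; exact hF
    · rw [ex]; exact hF
    · rw [act_one, ex, ey]
  · simp only [wedgeBase, wedgeShift, wedgeLo, sub_zero] at ex ey
    rw [show 7 * Real.pi / 6 + (0 : ℕ) * (Real.pi / 3) - chordAngle r =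
      7 * Real.pi / 6 - chordAngle r by simp] at ex
    rw [show 7 * Real.pi / 6 + (0 : ℕ) * (Real.pi / 3) - chordAngle r -
      (((0 : ℕ) : ℝ) - 1) * (Real.pi / 3) = 3 * Real.pi / 2 - chordAngle r by
      push_cast; ring] at ey
    refine piHat_eq_of_pairing (Pairing.right₁ j hj) hx.cell
      (hy.cell.trans (by simp [wedgeCell])) ?_ ?_ ?_
    · rw [ex]; exact place_one_mem₄₃₁ hr hT
    · rw [ey]; exact place_neg_om_mem₄₃₂ hr hT
    · rw [ex, ey, act_G₃_place]
      congr 2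
      ring
  · simp only [wedgeBase, wedgeShift, wedgeLo] at ex ey
    rw [show 7 * Real.pi / 6 + (s + 1 : ℕ) * (Real.pi / 3) - chordAngle r -
      ((s : ℝ) - 1) * (Real.pi / 3) = 11 * Real.pi / 6 - chordAngle r by push_cast; ring] at ex
    rw [show 7 * Real.pi / 6 + (s + 1 : ℕ) * (Real.pi / 3) - chordAngle r -
      (((s + 1 : ℕ) : ℝ) - 1) * (Real.pi / 3) = 3 * Real.pi / 2 - chordAngle r by
      push_cast; ring] at ey
    have hL : w (j + s + 1) = Flip.L := by
      have := ne_R_of_lt_gap (w := w) (j := j) (s := s) (by omega)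
      cases h : w (j + s + 1)
      · exact absurd h this
      · rfl
    refine piHat_eq_of_pairing (Pairing.left₂ (j + (s : ZMod m) + 1) hL) hx.cell
      (hy.cell.trans (by simp only [wedgeCell]; push_cast; ring_nf)) ?_ ?_ ?_
    · rw [ex]; exact place_neg_om_mem₄₁₂ hr hT
    · rw [ey]; exact place_neg_om_mem₄₃₂ hr hT
    · rw [ex, ey, act_G₂_place]
      congr 2
      ring

theorem piHat_eq_wrap {r t : ℝ}
    (hx : InWedge hj hk (gap w j + 3) x r (wedgeLo (gap w j) (gap w j + 4) r) t)
    (hy : InWedge hj hk 0 y r (wedgeLo (gap w j) 0 r) t) : piHat w x = piHat w y := by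
  have hr := hx.nonneg
  have hT := hx.tube
  have ex := hx.eq
  have ey := hy.eq
  simp only [wedgeBase, wedgeShift, wedgeLo] at ex ey
  rw [show 7 * Real.pi / 6 + (gap w j + 1 : ℕ) * (Real.pi / 3) - chordAngle r -
    ((gap w j : ℝ) - 1) * (Real.pi / 3) = 11 * Real.pi / 6 - chordAngle r by push_cast; ring] at ex
  rw [show -(Real.pi / 6) - bigonAngle (gap w j) - chordAngle r - -bigonAngle (gap w j) =
    -(Real.pi / 6) - chordAngle r by ring, slab_face_place] at ey
  have hF := place_neg_om_mem₄₁₂ hr hT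
  refine piHat_eq_of_pairing (Pairing.inner _ hk) hx.cell hy.cell ?_ ?_ ?_
  · rw [ex]; exact hF
  · rw [ey]; exact hF
  · rw [act_one, ex, ey]

/-- Two points with the same developed coordinates are identified. -/
theorem piHat_eq_of_le [NeZero m] {i' : ℕ} (hii' : i ≤ i') (hx : InWedge hj hk i x r Θ t)
    (hy : InWedge hj hk i' y r Θ t) : piHat w x = piHat w y := by
  induction i', hii' using Nat.le_induction generalizing y with
  | base =>
    have e := hx.eq.trans hy.eq.symm
    have ec := hx.cell.trans hy.cell.symm
    obtain ⟨c, x⟩ := x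
    obtain ⟨c', y⟩ := y
    simp only at ec e
    subst ec
    rw [Subtype.ext e]
  | succ i' hii' ih =>
    have hmono : ∀ n, wedgeLo (gap w j) (i + 1) r ≤ wedgeLo (gap w j) (i + 1 + n) r := by
      intro n
      induction n with
      | zero => exact le_rfl
      | succ n ihn => exact ihn.trans (wedgeLo_lt _ _ hx.nonneg hx.tube.1).1
    have h1 : wedgeLo (gap w j) (i' + 1) r ≤ Θ := hy.lo
    have h2 : Θ ≤ wedgeLo (gap w j) (i + 1) r := hx.hi
    have h3 := hmono (i' - i)
    rw [show i + 1 + (i' - i) = i' + 1 by omega] at h3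
    -- Boundary angles increase with the index, so an angle shared with a strictly later wedge is
    -- the boundary angle just before that wedge.
    have h4 : Θ = wedgeLo (gap w j) (i' + 1) r := by linarith
    subst h4
    have hl := hy.lt
    obtain ⟨z, hz⟩ := exists_inWedge hj hk (i := i') (by omega) hx.nonneg hx.tube
      (wedgeLo_lt _ i' hx.nonneg hx.tube.1).1 le_rfl
    exact (ih hz).trans (piHat_eq_succ hz hy)

theorem piHat_eq [NeZero m] {i' : ℕ} (hx : InWedge hj hk i x r Θ t)
    (hy : InWedge hj hk i' y r Θ t) : piHat w x = piHat w y := by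
  rcases le_total i i' with h | h
  · exact hx.piHat_eq_of_le h hy
  · exact (hy.piHat_eq_of_le h hx).symm

/-- All points of the wedges on the edge at the same height are identified. -/
theorem piHat_eq_zero [NeZero m] {i' : ℕ} {Θ' : ℝ} (hx : InWedge hj hk i x 0 Θ t)
    (hy : InWedge hj hk i' y 0 Θ' t) : piHat w x = piHat w y := by
  have key : ∀ n (hn : n < gap w j + 4) (a b : Pieces w) (Θ Θ' : ℝ), InWedge hj hk 0 a 0 Θ t →
      InWedge hj hk n b 0 Θ' t → piHat w a = piHat w b := by
    intro n hn
    induction n with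
    | zero =>
      intro a b Θ Θ' ha hb
      have hb' : InWedge hj hk 0 b 0 Θ t :=
        ⟨hb.lt, hb.cell, le_rfl, hb.tube, ha.lo, ha.hi, by rw [hb.eq]; simp only [place]; simp⟩
      exact ha.piHat_eq hb'
    | succ n ih =>
      intro a b Θ Θ' ha hb
      obtain ⟨z, hz⟩ := exists_inWedge hj hk (i := n) (by omega) hb.nonneg hb.tube
        (wedgeLo_lt _ n hb.nonneg hb.tube.1).1 le_rfl
      rw [ih (by omega) a z _ _ ha hz]
      refine piHat_eq_succ hz (of_lo hn hb.cell le_rfl hb.tube (hb.eq_of (Or.inl rfl)))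
  obtain ⟨z, hz⟩ := exists_inWedge hj hk (i := 0) (by omega) hx.nonneg hx.tube
    le_rfl (wedgeLo_lt _ 0 hx.nonneg hx.tube.1).1
  exact (key _ hx.lt z x _ _ hz hx).symm.trans (key _ hy.lt z y _ _ hz hy)

/-- Points whose developed angles differ by a full turn are identified. -/
theorem piHat_eq_of_angleEq [NeZero m] {N : ℕ} (hN : IsTotalAngle (gap w j) N) {i' : ℕ} {Θ' : ℝ}
    (hx : InWedge hj hk i x r Θ t) (hy : InWedge hj hk i' y r Θ' t) (h : AngleEq N r Θ Θ') :
    piHat w x = piHat w y := by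
  rcases h with rfl | ⟨n, hn⟩
  · exact hx.piHat_eq_zero hy
  have hpi := Real.pi_pos
  have hmono : ∀ a n, wedgeLo (gap w j) a r ≤ wedgeLo (gap w j) (a + n) r := by
    intro a n
    induction n with
    | zero => exact le_rfl
    | succ n ihn => exact ihn.trans (wedgeLo_lt _ _ hx.nonneg hx.tube.1).1
  have hrange : ∀ {i : ℕ} {x : Pieces w} {Θ : ℝ}, InWedge hj hk i x r Θ t →
      wedgeLo (gap w j) 0 r ≤ Θ ∧ Θ ≤ wedgeLo (gap w j) 0 r + 2 * Real.pi * N := by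
    intro i x Θ hx
    have h1 := hmono 0 i
    rw [zero_add] at h1
    have hl := hx.lt
    have h2 := hmono (i + 1) (gap w j + 4 - (i + 1))
    rw [show i + 1 + (gap w j + 4 - (i + 1)) = gap w j + 4 by omega, wedgeLo_last hN] at h2
    exact ⟨h1.trans hx.lo, hx.hi.trans h2⟩
  have hN0 : (0 : ℝ) < 2 * Real.pi * N := by
    rw [← hN]; have := (bigonAngle_bound (gap w j)).1; positivity
  obtain ⟨hx1, hx2⟩ := hrange hx
  obtain ⟨hy1, hy2⟩ := hrange hy
  have wrap : ∀ {i i' : ℕ} {x y : Pieces w} {Θ Θ' : ℝ}, InWedge hj hk i x r Θ t →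
      InWedge hj hk i' y r Θ' t → Θ = wedgeLo (gap w j) (gap w j + 4) r →
      Θ' = wedgeLo (gap w j) 0 r → piHat w x = piHat w y := by
    intro i i' x y Θ Θ' hx hy h1 h2
    obtain ⟨a, ha⟩ := exists_inWedge hj hk (i := gap w j + 3) (by omega) hx.nonneg hx.tube
      (wedgeLo_lt _ _ hx.nonneg hx.tube.1).1 le_rfl
    obtain ⟨b, hb⟩ := exists_inWedge hj hk (i := 0) (by omega) hx.nonneg hx.tube
      le_rfl (wedgeLo_lt _ _ hx.nonneg hx.tube.1).1
    subst h1 h2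
    exact (hx.piHat_eq ha).trans ((ha.piHat_eq_wrap hb).trans (hb.piHat_eq hy))
  -- All developed angles lie in one interval of length 2πN. A nontrivial multiple of 2πN can only
  -- join its two ends, and these are glued by `piHat_eq_wrap`.
  have hn1 : |(n : ℝ)| ≤ 1 := by
    rw [abs_le]
    constructor <;> nlinarith
  have hn2 : -1 ≤ n ∧ n ≤ 1 := by
    have := abs_le.mp hn1
    exact ⟨by exact_mod_cast this.1, by exact_mod_cast this.2⟩
  have hl := wedgeLo_last hN r
  rcases (by omega : n = -1 ∨ n = 0 ∨ n = 1) with rfl | rfl | rfl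
  · push_cast at hn
    exact wrap hx hy (by linarith) (by linarith)
  · have : Θ' = Θ := by rw [hn]; simp
    subst this
    exact hx.piHat_eq hy
  · push_cast at hn
    exact (wrap hy hx (by linarith) (by linarith)).symm

end InWedge

end

/-! ### A criterion for open embeddings on a quotient -/

/-- The compact parameter space replaces local analysis of the quotient, including any separation
property of it: compactness makes parametrisations closed maps onto their images, which gives
continuity and openness at once. -/
theorem isOpenEmbedding_of_param {K X B Y : Type*} [TopologicalSpace K] [TopologicalSpace X]
    [TopologicalSpace B] [TopologicalSpace Y] [CompactSpace K] [T2Space X] [T2Space Y]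
    {π : X → B} (hπ : IsQuotientMap π) {κ : K → X} (hκ : Continuous κ) {h : B → Y}
    (hη : Continuous fun k => h (π (κ k))) {U : Set B} (hU : IsOpen U)
    (hUκ : π ⁻¹' U ⊆ Set.range κ)
    (hinj : ∀ k k', h (π (κ k)) = h (π (κ k')) → π (κ k) = π (κ k'))
    (hV : IsOpen (h '' U)) : ContinuousOn h U ∧ IsOpenEmbedding (U.domRestrict h) := by
  have hpar : ∀ b ∈ U, ∃ k, π (κ k) = b := by
    intro b hb
    obtain ⟨x, rfl⟩ := hπ.surjective b
    obtain ⟨k, rfl⟩ := hUκ hb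
    exact ⟨k, rfl⟩
  have hcont : ContinuousOn h U := by
    refine (hπ.continuousOn_isOpen_iff hU).mpr (ContinuousOn.mono ?_ hUκ)
    -- A continuous map from a compact to a Hausdorff space is closed, so continuity on the range of
    -- κ may be tested on the parameters.
    have hc : IsClosedMap (Set.rangeFactorization κ) :=
      (hκ.subtype_mk _).isClosedMap
    have hq : IsQuotientMap (Set.rangeFactorization κ) :=
      hc.isQuotientMap (hκ.subtype_mk _) Set.rangeFactorization_surjective
    rw [continuousOn_iff_continuous_domRestrict, hq.continuous_iff]
    exact hη
  refine ⟨hcont, IsOpenEmbedding.of_continuous_injective_isOpenMap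
    (continuousOn_iff_continuous_domRestrict.mp hcont) ?_ ?_⟩
  · rintro ⟨b, hb⟩ ⟨b', hb'⟩ hbb
    obtain ⟨k, rfl⟩ := hpar b hb
    obtain ⟨k', rfl⟩ := hpar b' hb'
    exact Subtype.ext (hinj k k' hbb)
  · intro O hO
    obtain ⟨O', hO', rfl⟩ := isOpen_induced_iff.mp hO
    have hcl : IsClosed ((fun k => h (π (κ k))) '' ((fun k => π (κ k)) ⁻¹' (U ∩ O'))ᶜ) := by
      refine hη.isClosedMap _ (IsOpen.isClosed_compl ?_)
      exact (hU.inter hO').preimage (hπ.continuous.comp hκ)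
    -- By injectivity on parameters, the image of an open piece is the open set h(U) minus the image
    -- of the complementary parameters, which is closed.
    have e : (U.domRestrict h) '' (Subtype.val ⁻¹' O') =
        h '' U \ (fun k => h (π (κ k))) '' ((fun k => π (κ k)) ⁻¹' (U ∩ O'))ᶜ := by
      ext y
      constructor
      · rintro ⟨⟨b, hb⟩, hbO, rfl⟩
        refine ⟨⟨b, hb, rfl⟩, ?_⟩
        rintro ⟨k, hk, hky⟩
        obtain ⟨k', rfl⟩ := hpar b hb
        exact hk (by
          change π (κ k) ∈ U ∩ O'
          rw [hinj k k' hky]; exact ⟨hb, hbO⟩)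
      · rintro ⟨⟨b, hb, rfl⟩, hy⟩
        obtain ⟨k, rfl⟩ := hpar b hb
        refine ⟨⟨_, hb⟩, ?_, rfl⟩
        by_contra hO
        exact hy ⟨k, fun hk => hO hk.2, rfl⟩
    rw [e]
    exact hV.sdiff hcl

/-! ### The branched developing map -/

/-- The point of the `N`-fold branched cover with cylindrical coordinates `r`, `Θ`, `t` below. -/
def cyl (N : ℕ) (r Θ t : ℝ) : ℂ × ℝ := ((r ^ (1 / N : ℝ) : ℝ) * exp ((Θ / N : ℝ) * I), t)

section

variable {N : ℕ}

theorem branchingMap_cyl (hN0 : 0 < N) {r : ℝ} (hr : 0 ≤ r) (Θ t : ℝ) :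
    branchingMap N (cyl N r Θ t) = (r * exp (Θ * I), t) := by
  have hN' : (N : ℂ) ≠ 0 := by exact_mod_cast hN0.ne'
  unfold branchingMap cyl
  congr 1
  rw [mul_pow, ← ofReal_pow, one_div, Real.rpow_inv_natCast_pow hr hN0.ne', ← Complex.exp_nat_mul]
  congr 2
  push_cast
  field_simp

theorem norm_cyl (hN0 : 0 < N) {r : ℝ} (hr : 0 ≤ r) (Θ t : ℝ) : ‖(cyl N r Θ t).1‖ ^ N = r := by
  rw [cyl, norm_polar (by positivity), one_div, Real.rpow_inv_natCast_pow hr hN0.ne']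

theorem cyl_fst_eq_zero (hN0 : 0 < N) {r : ℝ} (hr : 0 ≤ r) (Θ t : ℝ) :
    (cyl N r Θ t).1 = 0 ↔ r = 0 := by
  rw [← norm_eq_zero, ← pow_eq_zero_iff hN0.ne', norm_cyl hN0 hr]

theorem cyl_eq_of_angleEq (hN0 : 0 < N) {r Θ Θ' : ℝ} (h : AngleEq N r Θ Θ') (t : ℝ) :
    cyl N r Θ t = cyl N r Θ' t := by
  rcases h with rfl | ⟨n, rfl⟩
  · have : (0 : ℝ) ^ (1 / N : ℝ) = 0 := Real.zero_rpow (by positivity)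
    simp only [cyl, this, ofReal_zero, zero_mul]
  · have hN' : (N : ℝ) ≠ 0 := by exact_mod_cast hN0.ne'
    rw [cyl, cyl, show (Θ + 2 * Real.pi * N * n) / N = Θ / N + 2 * Real.pi * n by field_simp,
      exp_add_two_pi]

theorem angleEq_of_cyl_eq (hN0 : 0 < N) {r r' Θ Θ' t t' : ℝ} (hr : 0 ≤ r) (hr' : 0 ≤ r')
    (h : cyl N r Θ t = cyl N r' Θ' t') : r = r' ∧ t = t' ∧ AngleEq N r Θ Θ' := by
  have hN' : (N : ℝ) ≠ 0 := by exact_mod_cast hN0.ne'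
  have h1 : r = r' := by rw [← norm_cyl hN0 hr Θ t, h, norm_cyl hN0 hr']
  subst h1
  refine ⟨rfl, congrArg Prod.snd h, ?_⟩
  rcases (eq_of_polar_eq (by positivity) (by positivity) (congrArg Prod.fst h)).2 with h0 | ⟨n, hn⟩
  · rw [one_div, Real.rpow_inv_eq hr le_rfl hN'] at h0
    exact Or.inl (by rw [h0]; simp [hN0.ne'])
  · refine Or.inr ⟨-n, ?_⟩
    field_simp at hn
    push_cast
    linarith

theorem continuous_cyl (hN0 : 0 < N) : Continuous fun x : ℝ × ℝ × ℝ => cyl N x.1 x.2.1 x.2.2 := by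
  have : Continuous fun r : ℝ => r ^ (1 / N : ℝ) :=
    Real.continuous_rpow_const (by positivity)
  unfold cyl
  fun_prop

theorem exists_cyl (hN0 : 0 < N) (ζ : ℂ) (t a : ℝ) :
    ∃ Θ, a ≤ Θ ∧ Θ ≤ a + 2 * Real.pi * N ∧ cyl N (‖ζ‖ ^ N) Θ t = (ζ, t) := by
  have hpi := Real.pi_pos
  have hN' : (0 : ℝ) < N := by exact_mod_cast hN0
  obtain ⟨n, ⟨h1, h2⟩, -⟩ := existsUnique_add_zsmul_mem_Ico
    (show 0 < 2 * Real.pi * N by positivity) (N * arg ζ) a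
  refine ⟨_, h1, h2.le, ?_⟩
  rw [cyl, one_div, Real.pow_rpow_inv_natCast (norm_nonneg _) hN0.ne', zsmul_eq_mul,
    show (N * arg ζ + n * (2 * Real.pi * N)) / N = arg ζ + 2 * Real.pi * n by field_simp,
    exp_add_two_pi, norm_mul_exp_arg_mul_I]

end

/-! ### The developing map on the bundle and its cylindrical neighbourhoods -/

section

variable {m : ℕ} {w : ZMod m → Flip} {j : ZMod m}

theorem exists_index (l n : ℕ) {r Θ : ℝ} (h1 : wedgeLo l 0 r ≤ Θ) (h2 : Θ ≤ wedgeLo l (n + 1) r) :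
    ∃ i < n + 1, wedgeLo l i r ≤ Θ ∧ Θ ≤ wedgeLo l (i + 1) r := by
  induction n with
  | zero => exact ⟨0, by omega, h1, h2⟩
  | succ n ih =>
    rcases le_total Θ (wedgeLo l (n + 1) r) with h | h
    · obtain ⟨i, hi, h3⟩ := ih h
      exact ⟨i, by omega, h3⟩
    · exact ⟨n + 1, by omega, h, h2⟩

theorem continuous_wedgeLo (l i : ℕ) : Continuous (wedgeLo l i) := by
  have := continuous_chordAngle
  rcases i with _ | _ | _ | s <;> unfold wedgeLo <;> fun_prop

variable (hj : w j = Flip.R) (hk : w (j + gap w j + 1) = Flip.R)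

/-- Points in a wedge at distance less than `ε` from the edge, at height within `ε` of `t₀`. -/
def NearEdge (ε t₀ : ℝ) (x : Pieces w) : Prop :=
  ∃ i r Θ t, InWedge hj hk i x r Θ t ∧ r < ε ∧ |t - t₀| < ε

open Classical in
/-- The branched developing map on the cells. -/
def devMap (N : ℕ) (x : Pieces w) : ℂ × ℝ :=
  if h : ∃ p : ℕ × ℝ × ℝ × ℝ, InWedge hj hk p.1 x p.2.1 p.2.2.1 p.2.2.2 then
    cyl N h.choose.2.1 h.choose.2.2.1 h.choose.2.2.2 else 0

variable {hj hk} {N : ℕ}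

theorem devMap_eq [NeZero m] (hN0 : 0 < N) {i : ℕ} {x : Pieces w} {r Θ t : ℝ}
    (h : InWedge hj hk i x r Θ t) : devMap hj hk N x = cyl N r Θ t := by
  have h' : ∃ p : ℕ × ℝ × ℝ × ℝ, InWedge hj hk p.1 x p.2.1 p.2.2.1 p.2.2.2 := ⟨(i, r, Θ, t), h⟩
  rw [devMap, dif_pos h']
  obtain ⟨-, h2, h3, h4⟩ := h'.choose_spec.unique h
  rw [h3]
  rcases h4 with h4 | h4
  · rw [← h2]
    exact cyl_eq_of_angleEq hN0 (Or.inl h4) _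
  · rw [h2, h4]

/-- Points outside all wedges have the default value 0; this is consistent because, by
`InWedge.glue_symm`, a point outside the wedges is never glued to one inside. -/
theorem devMap_glue [NeZero m] (hN0 : 0 < N) (hN : IsTotalAngle (gap w j) N) {x y : Pieces w}
    (h : Glue w x y) : devMap hj hk N x = devMap hj hk N y := by
  by_cases hx : ∃ p : ℕ × ℝ × ℝ × ℝ, InWedge hj hk p.1 x p.2.1 p.2.2.1 p.2.2.2
  · obtain ⟨⟨i, r, Θ, t⟩, hx⟩ := hx
    obtain ⟨i', Θ', hy, ha⟩ := hx.glue hN h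
    rw [devMap_eq hN0 hx, devMap_eq hN0 hy]
    exact cyl_eq_of_angleEq hN0 ha _
  · by_cases hy : ∃ p : ℕ × ℝ × ℝ × ℝ, InWedge hj hk p.1 y p.2.1 p.2.2.1 p.2.2.2
    · obtain ⟨⟨i, r, Θ, t⟩, hy⟩ := hy
      obtain ⟨i', Θ', hx', ha⟩ := hy.glue_symm hN h
      exact absurd ⟨(i', r, Θ', t), hx'⟩ hx
    · rw [devMap, devMap, dif_neg hx, dif_neg hy]

theorem nearEdge_glue {ε t₀ : ℝ} (hN : IsTotalAngle (gap w j) N) {x y : Pieces w}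
    (h : Glue w x y) : NearEdge hj hk ε t₀ x = NearEdge hj hk ε t₀ y := by
  apply propext
  constructor
  · rintro ⟨i, r, Θ, t, hx, h1, h2⟩
    obtain ⟨i', Θ', hy, -⟩ := hx.glue hN h
    exact ⟨i', r, Θ', t, hy, h1, h2⟩
  · rintro ⟨i, r, Θ, t, hx, h1, h2⟩
    obtain ⟨i', Θ', hy, -⟩ := hx.glue_symm hN h
    exact ⟨i', r, Θ', t, hy, h1, h2⟩

variable (hj hk) in
/-- The branched developing map on the bundle. -/
def bundleDev [NeZero m] (hN0 : 0 < N) (hN : IsTotalAngle (gap w j) N) : Bundle w → ℂ × ℝ :=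
  Quot.lift (devMap hj hk N) fun _ _ => devMap_glue hN0 hN

variable (hj hk) in
/-- The neighbourhood of a point of the edge on which the branched developing map is a chart. -/
def bundleNhd (ε t₀ : ℝ) (hN : IsTotalAngle (gap w j) N) : Set (Bundle w) :=
  {b | Quot.lift (NearEdge hj hk ε t₀) (fun _ _ => nearEdge_glue hN) b}

theorem mem_bundleNhd {ε t₀ : ℝ} {hN : IsTotalAngle (gap w j) N} {x : Pieces w} :
    piHat w x ∈ bundleNhd hj hk ε t₀ hN ↔ NearEdge hj hk ε t₀ x := Iff.rfl

theorem bundleDev_piHat [NeZero m] {hN0 : 0 < N} {hN : IsTotalAngle (gap w j) N} {i : ℕ}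
    {x : Pieces w} {r Θ t : ℝ} (h : InWedge hj hk i x r Θ t) :
    bundleDev hj hk hN0 hN (piHat w x) = cyl N r Θ t := devMap_eq hN0 h

theorem isQuotientMap_piHat : IsQuotientMap (piHat w) := isQuotientMap_quot_mk

/-- Parameters `ε` for which the cylinder around height `t₀` lies in the tube. -/
def Small (ε t₀ : ℝ) : Prop := 0 < ε ∧ ε < 1 / 10 ∧ √3 + 10 * ε < t₀

theorem Small.tube {ε t₀ r t : ℝ} (h : Small ε t₀) (hr : r ≤ ε) (ht : |t - t₀| ≤ ε) :
    Tube r t := by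
  obtain ⟨h1, h2, h3⟩ := h
  exact ⟨by linarith, by linarith [(abs_le.mp ht).1]⟩

/-- The open cylinder around a point of a vertical edge. -/
def openCyl (a : ℂ) (ε t₀ : ℝ) : Set CR :=
  OnePoint.some '' {p : ℂ × ℝ | ‖p.1 - a‖ < ε ∧ |height a p - t₀| < ε}

theorem isOpen_openCyl (a : ℂ) (ε t₀ : ℝ) : IsOpen (openCyl a ε t₀) := by
  refine OnePoint.isOpenMap_coe _ ?_
  have h1 : Continuous fun p : ℂ × ℝ => ‖p.1 - a‖ := by fun_prop
  have h2 : Continuous fun p : ℂ × ℝ => |height a p - t₀| := by unfold height; fun_prop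
  exact (isOpen_lt h1 continuous_const).inter (isOpen_lt h2 continuous_const)

theorem InWedge.of_mem_openCyl [NeZero m] {ε t₀ : ℝ} (hε : Small ε t₀) {i : ℕ}
    (hi : i < gap w j + 4) {x : Pieces w} (hx : x.1 = wedgeCell hj hk i)
    (h : (x.2 : CR) ∈ openCyl (wedgeBase i) ε t₀) :
    ∃ r Θ t, InWedge hj hk i x r Θ t ∧ r < ε ∧ |t - t₀| < ε := by
  obtain ⟨p, ⟨h1, h2⟩, hp⟩ := h
  obtain ⟨Θ, hΘ⟩ := InWedge.exists_of_mem hi hx hp.symm (hε.tube h1.le h2.le)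
  exact ⟨_, Θ, _, hΘ, h1, h2⟩

theorem InWedge.mem_openCyl {ε t₀ : ℝ} {i : ℕ} {x : Pieces w} {r Θ t : ℝ}
    (h : InWedge hj hk i x r Θ t) (hr : r < ε) (ht : |t - t₀| < ε) :
    (x.2 : CR) ∈ openCyl (wedgeBase i) ε t₀ := by
  refine ⟨_, ⟨?_, ?_⟩, h.eq.symm⟩
  · rw [norm_place_sub _ _ _ h.nonneg]; exact hr
  · rw [height_place]; exact ht

/-- In each cell the preimage is the union of the open cylinders about those rays at which the cell
occurs as a wedge, possibly more than one. -/
theorem isOpen_bundleNhd [NeZero m] {ε t₀ : ℝ} (hε : Small ε t₀)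
    {hN : IsTotalAngle (gap w j) N} : IsOpen (bundleNhd hj hk ε t₀ hN) := by
  rw [← isQuotientMap_piHat.isOpen_preimage, isOpen_sigma_iff]
  intro c
  have : Sigma.mk c ⁻¹' (piHat w ⁻¹' bundleNhd hj hk ε t₀ hN) =
      ⋃ i ∈ {i : ℕ | i < gap w j + 4 ∧ c = wedgeCell hj hk i},
        (Subtype.val ⁻¹' openCyl (wedgeBase i) ε t₀ : Set c.ideal) := by
    ext x
    simp only [Set.mem_iUnion, Set.mem_preimage, exists_prop, mem_bundleNhd]
    constructor
    · rintro ⟨i, r, Θ, t, h, h1, h2⟩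
      exact ⟨i, ⟨h.lt, h.cell⟩, h.mem_openCyl h1 h2⟩
    · rintro ⟨i, ⟨h1, h2⟩, h3⟩
      exact ⟨i, InWedge.of_mem_openCyl hε h1 (x := ⟨c, x⟩) h2 h3⟩
  rw [this]
  exact isOpen_biUnion fun i _ => (isOpen_openCyl _ _ _).preimage continuous_subtype_val

/-- The parameter space of the closed cylinder around a point of the edge. -/
abbrev Params (n : ℕ) (ε t₀ : ℝ) : Type :=
  Σ _ : Fin n, Set.Icc (0 : ℝ) ε × Set.Icc (0 : ℝ) 1 × Set.Icc (t₀ - ε) (t₀ + ε)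

/-- The developed angle of a parameter. -/
def paramAngle (l i : ℕ) (r s : ℝ) : ℝ :=
  wedgeLo l i r + s * (wedgeLo l (i + 1) r - wedgeLo l i r)

theorem paramAngle_mem {l i : ℕ} {r s : ℝ} (hr : 0 ≤ r) (hr' : r < 1 / 10) (hs : 0 ≤ s)
    (hs' : s ≤ 1) :
    wedgeLo l i r ≤ paramAngle l i r s ∧ paramAngle l i r s ≤ wedgeLo l (i + 1) r := by
  have h := (wedgeLo_lt l i hr hr').1
  unfold paramAngle
  constructor <;> nlinarith

theorem exists_paramAngle {l i : ℕ} {r Θ : ℝ} (h1 : wedgeLo l i r ≤ Θ)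
    (h2 : Θ ≤ wedgeLo l (i + 1) r) : ∃ s, 0 ≤ s ∧ s ≤ 1 ∧ Θ = paramAngle l i r s := by
  rcases (h1.trans h2).eq_or_lt with h | h
  · exact ⟨0, le_rfl, zero_le_one, by simp [paramAngle]; linarith⟩
  · refine ⟨(Θ - wedgeLo l i r) / (wedgeLo l (i + 1) r - wedgeLo l i r),
      div_nonneg (by linarith) (by linarith), (div_le_one (by linarith)).mpr (by linarith), ?_⟩
    rw [paramAngle, div_mul_cancel₀ _ (by linarith)]
    ring

variable (hj hk) in
/-- The point of a `3`-cell with given parameters. -/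
def paramMap [NeZero m] {ε t₀ : ℝ} (hε : Small ε t₀) (k : Params (gap w j + 4) ε t₀) : Pieces w :=
  ⟨wedgeCell hj hk k.1, ⟨OnePoint.some (place (wedgeBase k.1)
    (paramAngle (gap w j) k.1 k.2.1 k.2.2.1 - wedgeShift (gap w j) k.1) k.2.1 k.2.2.2),
    place_mem_ideal hj hk k.2.1.2.1
      (hε.tube k.2.1.2.2 (abs_le.mpr ⟨by linarith [k.2.2.2.2.1], by linarith [k.2.2.2.2.2]⟩))
      (paramAngle_mem k.2.1.2.1 (k.2.1.2.2.trans_lt hε.2.1) k.2.2.1.2.1 k.2.2.1.2.2).1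
      (paramAngle_mem k.2.1.2.1 (k.2.1.2.2.trans_lt hε.2.1) k.2.2.1.2.1 k.2.2.1.2.2).2⟩⟩

theorem paramMap_inWedge [NeZero m] {ε t₀ : ℝ} (hε : Small ε t₀)
    (k : Params (gap w j + 4) ε t₀) : InWedge hj hk k.1 (paramMap hj hk hε k) k.2.1
      (paramAngle (gap w j) k.1 k.2.1 k.2.2.1) k.2.2.2 :=
  ⟨k.1.2, rfl, k.2.1.2.1,
    hε.tube k.2.1.2.2 (abs_le.mpr ⟨by linarith [k.2.2.2.2.1], by linarith [k.2.2.2.2.2]⟩),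
    (paramAngle_mem k.2.1.2.1 (k.2.1.2.2.trans_lt hε.2.1) k.2.2.1.2.1 k.2.2.1.2.2).1,
    (paramAngle_mem k.2.1.2.1 (k.2.1.2.2.trans_lt hε.2.1) k.2.2.1.2.1 k.2.2.1.2.2).2, rfl⟩

theorem continuous_paramAngle (l i : ℕ) : Continuous fun x : ℝ × ℝ => paramAngle l i x.1 x.2 := by
  have h1 := continuous_wedgeLo l i
  have h2 := continuous_wedgeLo l (i + 1)
  unfold paramAngle
  fun_prop

theorem continuous_paramMap [NeZero m] {ε t₀ : ℝ} (hε : Small ε t₀) :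
    Continuous (paramMap hj hk hε) := by
  rw [continuous_sigma_iff]
  intro i
  have h1 := continuous_paramAngle (gap w j) i
  have h2 := continuous_place (wedgeBase i)
  have h3 : Continuous fun a => ((paramMap hj hk hε ⟨i, a⟩).2 : CR) := by
    refine OnePoint.continuous_coe.comp
      (h2.comp (Continuous.prodMk (by fun_prop) (Continuous.prodMk ?_ (by fun_prop))))
    exact (h1.comp (Continuous.prodMk (by fun_prop) (by fun_prop))).sub
      (continuous_const (y := wedgeShift (gap w j) i))
  have h4 := Continuous.subtype_mk (p := (· ∈ (wedgeCell hj hk i).ideal)) h3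
    fun a => (paramMap hj hk hε ⟨i, a⟩).2.2
  exact (continuous_sigmaMk (σ := fun c : Cell w => c.ideal) (i := wedgeCell hj hk i)).comp h4

/-- The image is a full round cylinder because the wedges fill an interval of angles of length
exactly 2πN, which is one full turn after division by N. -/
theorem image_bundleNhd [NeZero m] {ε t₀ : ℝ} (hε : Small ε t₀) {hN0 : 0 < N}
    {hN : IsTotalAngle (gap w j) N} :
    bundleDev hj hk hN0 hN '' bundleNhd hj hk ε t₀ hN = {p | ‖p.1‖ ^ N < ε ∧ |p.2 - t₀| < ε} := by
  ext ⟨ζ, t⟩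
  constructor
  · rintro ⟨b, hb, h⟩
    obtain ⟨x, rfl⟩ := isQuotientMap_piHat.surjective b
    obtain ⟨i, r, Θ, t', hx, h1, h2⟩ := hb
    rw [bundleDev_piHat hx] at h
    rw [← h]
    refine ⟨?_, h2⟩
    rw [norm_cyl hN0 hx.nonneg]; exact h1
  · rintro ⟨h1, h2⟩
    simp only at h1 h2
    obtain ⟨Θ, h3, h4, h5⟩ := exists_cyl hN0 ζ t (wedgeLo (gap w j) 0 (‖ζ‖ ^ N))
    rw [← wedgeLo_last hN] at h4
    obtain ⟨i, hi, h6, h7⟩ := exists_index (gap w j) (gap w j + 3) h3 h4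
    obtain ⟨x, hx⟩ := exists_inWedge hj hk hi (by positivity) (hε.tube h1.le h2.le) h6 h7
    exact ⟨piHat w x, ⟨i, _, Θ, t, hx, h1, h2⟩, by rw [bundleDev_piHat hx, h5]⟩

/-- The parameters are the wedge, its radius, the relative position between its two boundary angles,
and the height, all in closed bounded ranges; this is the compact space required by
`isOpenEmbedding_of_param`. -/
theorem isOpenEmbedding_bundleDev [NeZero m] {ε t₀ : ℝ} (hε : Small ε t₀) {hN0 : 0 < N}
    {hN : IsTotalAngle (gap w j) N} :
    ContinuousOn (bundleDev hj hk hN0 hN) (bundleNhd hj hk ε t₀ hN) ∧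
    IsOpenEmbedding ((bundleNhd hj hk ε t₀ hN).domRestrict (bundleDev hj hk hN0 hN)) := by
  refine isOpenEmbedding_of_param isQuotientMap_piHat (continuous_paramMap (hj := hj) (hk := hk) hε)
    ?_ (isOpen_bundleNhd hε) ?_ ?_ ?_
  · have e : ∀ k, bundleDev hj hk hN0 hN (piHat w (paramMap hj hk hε k)) =
        cyl N k.2.1 (paramAngle (gap w j) k.1 k.2.1 k.2.2.1) k.2.2.2 := fun k =>
      bundleDev_piHat (paramMap_inWedge hε k)
    simp only [e]
    rw [continuous_sigma_iff]
    intro i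
    have h1 := continuous_paramAngle (gap w j) i
    refine (continuous_cyl hN0).comp
      (Continuous.prodMk (by fun_prop) (Continuous.prodMk ?_ (by fun_prop)))
    exact h1.comp (Continuous.prodMk (by fun_prop) (by fun_prop))
  · rintro x ⟨i, r, Θ, t, hx, h1, h2⟩
    obtain ⟨s, hs0, hs1, rfl⟩ := exists_paramAngle hx.lo hx.hi
    have h2' := abs_le.mp h2.le
    let k : Params (gap w j + 4) ε t₀ := ⟨⟨i, hx.lt⟩, ⟨r, hx.nonneg, h1.le⟩, ⟨s, hs0, hs1⟩,
      ⟨t, by linarith [h2'.1], by linarith [h2'.2]⟩⟩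
    refine ⟨k, ?_⟩
    have hk' := paramMap_inWedge (hj := hj) (hk := hk) hε k
    have e1 := hk'.cell.trans hx.cell.symm
    have e2 : ((paramMap hj hk hε k).2 : CR) = x.2 := hk'.eq.trans hx.eq.symm
    obtain ⟨c, x⟩ := x
    generalize paramMap hj hk hε k = y at *
    obtain ⟨c', y⟩ := y
    simp only at e1 e2
    subst e1
    rw [Subtype.ext e2]
  · intro k k' h
    have hk1 := paramMap_inWedge (hj := hj) (hk := hk) hε k
    have hk2 := paramMap_inWedge (hj := hj) (hk := hk) hε k'
    rw [bundleDev_piHat hk1, bundleDev_piHat hk2] at h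
    obtain ⟨h1, h2, h3⟩ := angleEq_of_cyl_eq hN0 hk1.nonneg hk2.nonneg h
    generalize paramAngle (gap w j) k'.1 k'.2.1 k'.2.2.1 = Θ' at *
    rw [← h1, ← h2] at hk2
    exact hk1.piHat_eq_of_angleEq hN hk2 h3
  · rw [image_bundleNhd hε]
    have h1 : Continuous fun p : ℂ × ℝ => ‖p.1‖ ^ N := by fun_prop
    have h2 : Continuous fun p : ℂ × ℝ => |p.2 - t₀| := by fun_prop
    exact (isOpen_lt h1 continuous_const).inter (isOpen_lt h2 continuous_const)

end

/-! ### The edge and its valence -/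

section

variable {m : ℕ} {w : ZMod m → Flip} {j : ZMod m}

/-- The `3`-cell that contains an edge of a `3`-cell. -/
def CellEdge.cell : CellEdge w → Cell w
  | CellEdge.tet j _ => Cell.tet j
  | CellEdge.slab j hj _ => Cell.slab j hj

/-- The realisation of an edge of a `3`-cell. -/
def CellEdge.realisation : CellEdge w → Set CR
  | CellEdge.tet _ e => e.realisation
  | CellEdge.slab _ _ e => e.realisation

theorem CellEdge.image_eq (e : CellEdge w) :
    e.image = piHat w '' {x | x.1 = e.cell ∧ (x.2 : CR) ∈ e.realisation} := by
  cases e <;> rfl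

theorem eq_of_mem_edge_infty {a b : ℂ} {s t : ℝ}
    (h : (OnePoint.some (a, t) : CR) ∈ edge (OnePoint.some (b, s)) P₄) : a = b ∧ s ≤ t := by
  rcases (mem_edge_infty _ _).mp h with h | ⟨u, hu, h⟩
  · exact absurd h (OnePoint.coe_ne_infty _)
  · obtain ⟨rfl, rfl⟩ := Prod.mk.inj (coe_injective h)
    exact ⟨rfl, hu⟩

theorem le_of_mem_edge_infty_left {a b : ℂ} {s t : ℝ}
    (h : (OnePoint.some (a, t) : CR) ∈ edge P₄ (OnePoint.some (b, s))) : t ≤ s := by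
  rcases of_mem_edge_infty_left h with h | ⟨u, hu, h⟩
  · exact absurd h (OnePoint.coe_ne_infty _)
  · obtain ⟨rfl, rfl⟩ := Prod.mk.inj (coe_injective h)
    exact hu

theorem one_ne_neg_om : (1 : ℂ) ≠ -om := by
  intro h; have := congrArg re h; simp [om_re] at this

theorem not_mem_edge_P₁_P₂ {a : ℂ} {t : ℝ} (ht : √3 < t) :
    (OnePoint.some (a, t) : CR) ∉ edge P₁ P₂ := by
  intro h
  obtain ⟨u, -, h⟩ := (mem_edge_P₁_P₂ _).mp h
  exact ht.ne' (Prod.mk.inj (coe_injective h)).2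

/-- Above height √3 only the edges ending at ∞ are left, and these are distinguished by the base
points 1, -ω and 0. -/
theorem TetEdge.eq_of_mem {e : TetEdge} {a : ℂ} (ha : IsBase a) {t : ℝ} (ht : √3 < t)
    (h : (OnePoint.some (a, t) : CR) ∈ e.realisation) :
    a = 1 ∧ e = e14 ∨ a = -om ∧ e = e24 := by
  cases e
  · exact absurd h (not_mem_edge_P₁_P₂ ht)
  · obtain ⟨v, hv, h⟩ := (mem_edge_P₃_P₁ _).mp h
    have := (Prod.mk.inj (coe_injective h)).2
    have := shortArc_im_le hv
    linarith
  · exact Or.inl ⟨(eq_of_mem_edge_infty h).1, rfl⟩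
  · obtain ⟨v, hv, h⟩ := (mem_edge_P₃_P₂ _).mp h
    have := (Prod.mk.inj (coe_injective h)).2
    have := shortArc_im_le hv
    linarith
  · exact Or.inr ⟨(eq_of_mem_edge_infty h).1, rfl⟩
  · have := ha.norm_eq
    rw [(eq_of_mem_edge_infty h).1] at this
    simp at this

theorem SlabEdge.eq_of_mem {e : SlabEdge} {a : ℂ} {t : ℝ} (ht : √3 < t)
    (h : (OnePoint.some (a, t) : CR) ∈ e.realisation) :
    a = 1 ∧ e = e14 ∨ a = -om ∧ e = e24 := by
  cases e
  · exact absurd h (not_mem_edge_P₁_P₂ ht)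
  · exact Or.inl ⟨(eq_of_mem_edge_infty h).1, rfl⟩
  · exact Or.inr ⟨(eq_of_mem_edge_infty h).1, rfl⟩
  · exact absurd (le_of_mem_edge_infty_left h) (not_le.mpr ht)
  · exact absurd (le_of_mem_edge_infty_left h) (not_le.mpr ht)

/-- The edges of the `3`-cells around the edge of the bundle. -/
def wedgeEdge (hj : w j = Flip.R) (hk : w (j + gap w j + 1) = Flip.R) : ℕ → CellEdge w
  | 0 => CellEdge.slab _ hk SlabEdge.e24
  | 1 => CellEdge.slab j hj SlabEdge.e14
  | 2 => CellEdge.tet j TetEdge.e14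
  | s + 3 => CellEdge.tet (j + s + 1) TetEdge.e24

variable {hj : w j = Flip.R} {hk : w (j + gap w j + 1) = Flip.R} {i : ℕ} {x : Pieces w}

theorem cell_wedgeEdge (i : ℕ) : (wedgeEdge hj hk i).cell = wedgeCell hj hk i := by
  rcases i with _ | _ | _ | s <;> rfl

theorem realisation_wedgeEdge (i : ℕ) :
    (wedgeEdge hj hk i).realisation = edge (OnePoint.some (wedgeBase i, √3)) P₄ := by
  rcases i with _ | _ | _ | s <;> rfl

theorem InWedge.of_zero [NeZero m] (hi : i < gap w j + 4) (hx : x.1 = wedgeCell hj hk i) {t : ℝ}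
    (ht : √3 < t) (h : (x.2 : CR) = OnePoint.some (wedgeBase i, t)) :
    ∃ Θ, InWedge hj hk i x 0 Θ t := by
  have e1 : ‖wedgeBase i - wedgeBase i‖ = 0 := by simp
  have e2 : height (wedgeBase i) (wedgeBase i, t) = t := by
    simp only [height]; rw [im_star_mul_self]; ring
  have := InWedge.exists_of_mem hi hx h (by
    simp only [e1, e2]; exact ⟨by norm_num, by linarith⟩)
  simpa only [e1, e2] using this

theorem InWedge.eq_zero {Θ t : ℝ} (h : InWedge hj hk i x 0 Θ t) :
    √3 < t ∧ (x.2 : CR) = OnePoint.some (wedgeBase i, t) := by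
  refine ⟨by linarith [h.tube.2], ?_⟩
  rw [h.eq, place_zero_eq (isBase_wedgeBase i).norm_eq]

theorem exists_inWedge_zero [NeZero m] (hi : i < gap w j + 4) {t : ℝ} (ht : √3 < t) :
    ∃ x Θ, InWedge hj hk i x 0 Θ t := by
  obtain ⟨x, hx⟩ := exists_inWedge hj hk hi le_rfl (t := t) ⟨by norm_num, by linarith⟩ le_rfl
    (wedgeLo_lt (gap w j) i le_rfl (by norm_num)).1
  exact ⟨x, _, hx⟩

/-- The endpoints of the ray, ∞ and the point at height √3, are removed vertices, so the ideal edge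
lies in the tube. -/
theorem of_mem_wedgeEdge [NeZero m] (hi : i < gap w j + 4)
    (hx : x.1 = (wedgeEdge hj hk i).cell) (h : (x.2 : CR) ∈ (wedgeEdge hj hk i).realisation) :
    ∃ Θ t, InWedge hj hk i x 0 Θ t := by
  rw [cell_wedgeEdge] at hx
  rw [realisation_wedgeEdge] at h
  rcases (mem_edge_infty _ _).mp h with h | ⟨t, ht, h⟩
  · obtain ⟨c, x⟩ := x
    have := x.2
    simp only at h
    rw [h] at this
    cases c
    · exact absurd this fun h => h.2 (by simp [P₄])
    · exact absurd this fun h => h.2 (by simp [P₄])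
  · refine ⟨_, t, (InWedge.of_zero hi hx (lt_of_le_of_ne ht ?_) h).choose_spec⟩
    rintro rfl
    obtain ⟨c, x⟩ := x
    have := x.2
    simp only at h
    rw [h] at this
    rcases isBase_wedgeBase i with hb | hb <;> rw [hb] at this <;> cases c
    · exact this.2 (Or.inl rfl)
    · exact this.2 (Or.inl rfl)
    · exact this.2 (Or.inr (Or.inl rfl))
    · exact this.2 (Or.inr (Or.inl rfl))

theorem onEdge_of_piHat_eq {N : ℕ} (hN : IsTotalAngle (gap w j) N) {y : Pieces w}
    (h : piHat w x = piHat w y) (hx : ∃ i Θ t, InWedge hj hk i x 0 Θ t) :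
    ∃ i Θ t, InWedge hj hk i y 0 Θ t := by
  have key : ∀ x y, Glue w x y →
      (∃ i Θ t, InWedge hj hk i x 0 Θ t) = ∃ i Θ t, InWedge hj hk i y 0 Θ t := by
    intro x y h
    apply propext
    constructor
    · rintro ⟨i, Θ, t, hx⟩
      obtain ⟨i', Θ', hy, -⟩ := hx.glue hN h
      exact ⟨i', Θ', t, hy⟩
    · rintro ⟨i, Θ, t, hx⟩
      obtain ⟨i', Θ', hy, -⟩ := hx.glue_symm hN h
      exact ⟨i', Θ', t, hy⟩
  have := congrArg (Quot.lift (fun x => ∃ i Θ t, InWedge hj hk i x 0 Θ t) key) h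
  exact this.mp hx

theorem mem_image_wedgeEdge [NeZero m] {N : ℕ} (hN : IsTotalAngle (gap w j) N)
    (hi : i < gap w j + 4) : piHat w x ∈ (wedgeEdge hj hk i).image ↔
      ∃ i Θ t, InWedge hj hk i x 0 Θ t := by
  rw [CellEdge.image_eq]
  constructor
  · rintro ⟨y, ⟨h1, h2⟩, h3⟩
    exact onEdge_of_piHat_eq hN h3 ⟨i, of_mem_wedgeEdge hi h1 h2⟩
  · rintro ⟨i', Θ, t, hx⟩
    obtain ⟨y, Θ', hy⟩ := exists_inWedge_zero (hj := hj) (hk := hk) hi hx.eq_zero.1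
    refine ⟨y, ⟨hy.cell.trans (cell_wedgeEdge i).symm, ?_⟩, hy.piHat_eq_zero hx⟩
    rw [realisation_wedgeEdge, hy.eq_zero.2]
    exact (mem_edge_infty _ _).mpr (Or.inr ⟨t, hx.eq_zero.1.le, rfl⟩)

theorem image_wedgeEdge_eq [NeZero m] {N : ℕ} (hN : IsTotalAngle (gap w j) N) {i' : ℕ}
    (hi : i < gap w j + 4) (hi' : i' < gap w j + 4) :
    (wedgeEdge hj hk i).image = (wedgeEdge hj hk i').image := by
  ext b
  obtain ⟨x, rfl⟩ := isQuotientMap_piHat.surjective b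
  rw [mem_image_wedgeEdge hN hi, mem_image_wedgeEdge hN hi']

/-- One point suffices: a preimage, on the given cell edge, of a point of e_j lies on the axis of
some wedge, and at most one edge of that cell passes through it. -/
theorem exists_wedgeEdge_eq [NeZero m] {N : ℕ} (hN : IsTotalAngle (gap w j) N)
    (hi : i < gap w j + 4) {e : CellEdge w} (h : e.image = (wedgeEdge hj hk i).image) :
    ∃ i' < gap w j + 4, wedgeEdge hj hk i' = e := by
  obtain ⟨y, Θ, hy⟩ := exists_inWedge_zero (hj := hj) (hk := hk) hi (lt_add_one √3)
  have hb : piHat w y ∈ e.image := by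
    rw [h, mem_image_wedgeEdge hN hi]; exact ⟨_, _, _, hy⟩
  rw [CellEdge.image_eq] at hb
  obtain ⟨x, ⟨h1, h2⟩, h3⟩ := hb
  obtain ⟨i', Θ', t, hx⟩ := onEdge_of_piHat_eq hN h3.symm ⟨_, _, _, hy⟩
  refine ⟨i', hx.lt, ?_⟩
  obtain ⟨ht, hp⟩ := hx.eq_zero
  have hc := hx.cell
  rw [h1] at hc
  rw [hp] at h2
  have e1 := one_ne_neg_om
  have e2 := one_ne_neg_om.symm
  rcases i' with _ | _ | _ | s <;> rcases e with ⟨a, e⟩ | ⟨a, ha, e⟩ <;>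
    simp only [wedgeCell, CellEdge.cell, reduceCtorEq, Cell.tet.injEq, Cell.slab.injEq] at hc <;>
    subst hc
  · rcases SlabEdge.eq_of_mem ht h2 with ⟨h, -⟩ | ⟨-, rfl⟩
    · exact absurd h e2
    · rfl
  · rcases SlabEdge.eq_of_mem ht h2 with ⟨-, rfl⟩ | ⟨h, -⟩
    · rfl
    · exact absurd h e1
  · rcases TetEdge.eq_of_mem (isBase_wedgeBase 2) ht h2 with ⟨-, rfl⟩ | ⟨h, -⟩
    · rfl
    · exact absurd h e1
  · rcases TetEdge.eq_of_mem (isBase_wedgeBase (s + 3)) ht h2 with ⟨h, -⟩ | ⟨-, rfl⟩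
    · exact absurd h e2
    · rfl

theorem wedgeEdge_injective [NeZero m] {i' : ℕ} (hi : i < gap w j + 4) (hi' : i' < gap w j + 4)
    (h : wedgeEdge hj hk i = wedgeEdge hj hk i') : i = i' := by
  obtain ⟨x, Θ, hx⟩ := exists_inWedge_zero (hj := hj) (hk := hk) hi (lt_add_one √3)
  have h1 := hx.cell.trans (cell_wedgeEdge i).symm
  have h2 : (x.2 : CR) ∈ (wedgeEdge hj hk i).realisation := by
    rw [realisation_wedgeEdge, hx.eq_zero.2]
    exact (mem_edge_infty _ _).mpr (Or.inr ⟨_, hx.eq_zero.1.le, rfl⟩)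
  rw [h] at h1 h2
  obtain ⟨Θ', t, hx'⟩ := of_mem_wedgeEdge hi' h1 h2
  exact (hx.unique hx').1

theorem valence_eq [NeZero m] {N : ℕ} (hN : IsTotalAngle (gap w j) N)
    (hj : w j = Flip.R) (hk : w (j + gap w j + 1) = Flip.R) :
    valence (CellEdge.tet (w := w) j TetEdge.e14).image = gap w j + 4 := by
  have h2 : 2 < gap w j + 4 := by omega
  let F : Fin (gap w j + 4) →
      {e : CellEdge w // e.image = (CellEdge.tet (w := w) j TetEdge.e14).image} :=
    fun i => ⟨wedgeEdge hj hk i, image_wedgeEdge_eq hN i.2 h2⟩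
  have hF : Function.Bijective F := by
    constructor
    · intro i i' h
      exact Fin.ext (wedgeEdge_injective i.2 i'.2 (congrArg Subtype.val h))
    · rintro ⟨e, he⟩
      obtain ⟨i, hi, rfl⟩ := exists_wedgeEdge_eq (hj := hj) (hk := hk) hN h2 he
      exact ⟨⟨i, hi⟩, rfl⟩
  rw [valence, ← Nat.card_congr (Equiv.ofBijective F hF), Nat.card_fin]

end

/-! ### The chart around a point of the edge -/

section

variable {m : ℕ} {w : ZMod m → Flip} {j : ZMod m}
  {hj : w j = Flip.R} {hk : w (j + gap w j + 1) = Flip.R} {N : ℕ}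

/-- The CR transformation that realises the wedge with given developed coordinates. -/
def wedgeMatrix (l i : ℕ) : Matrix (Fin 3) (Fin 3) ℂ :=
  placeMatrix (wedgeBase i) (exp ((-wedgeShift l i : ℝ) * I))

theorem isU21_wedgeMatrix (l i : ℕ) : IsU21 (wedgeMatrix l i) :=
  isU21_placeMatrix (isBase_wedgeBase i).norm_eq (norm_exp_ofReal_mul_I _)

theorem InWedge.eq_act {i : ℕ} {x : Pieces w} {r Θ t : ℝ} (h : InWedge hj hk i x r Θ t) :
    (x.2 : CR) = act (wedgeMatrix (gap w j) i) ((r * exp (Θ * I), t) : ℂ × ℝ) := by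
  rw [wedgeMatrix, act_placeMatrix_polar (isBase_wedgeBase i).norm_eq, h.eq, sub_eq_add_neg]

variable (hj hk) in
/-- The chart given by the branched developing map. -/
def bundleChart [NeZero m] (hN0 : 0 < N) (hN : IsTotalAngle (gap w j) N) (b : Bundle w) : CR :=
  OnePoint.some (branchingMap N (bundleDev hj hk hN0 hN b))

theorem bundleChart_piHat [NeZero m] {hN0 : 0 < N} {hN : IsTotalAngle (gap w j) N} {i : ℕ}
    {x : Pieces w} {r Θ t : ℝ} (h : InWedge hj hk i x r Θ t) :
    bundleChart hj hk hN0 hN (piHat w x) = OnePoint.some (r * exp (Θ * I), t) := by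
  rw [bundleChart, bundleDev_piHat h, branchingMap_cyl hN0 h.nonneg]

theorem continuous_branchingMap (N : ℕ) : Continuous (branchingMap N) := by
  unfold branchingMap; fun_prop

/-- On a wedge the developed coordinates differ from the realisation only by a translation and a
rotation, a CR transformation; its inverse is the matrix required of a chart. -/
theorem isChart_bundleChart [NeZero m] {ε t₀ : ℝ} (hε : Small ε t₀) {hN0 : 0 < N}
    {hN : IsTotalAngle (gap w j) N} :
    IsChart (bundleNhd hj hk ε t₀ hN) (bundleChart hj hk hN0 hN) := by
  refine ⟨isOpen_bundleNhd hε, ?_, ?_⟩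
  · exact (OnePoint.continuous_coe.comp (continuous_branchingMap N)).comp_continuousOn
      (isOpenEmbedding_bundleDev hε).1
  · rintro c x ⟨i, r, Θ, t, hx, h1, h2⟩
    obtain ⟨B, hB, hBM, -⟩ := (isU21_wedgeMatrix (gap w j) i).exists_inv
    refine ⟨B, hB, ?_⟩
    have ho : IsOpen (Subtype.val ⁻¹' openCyl (wedgeBase i) ε t₀ : Set c.ideal) :=
      (isOpen_openCyl _ _ _).preimage continuous_subtype_val
    filter_upwards [ho.mem_nhds (hx.mem_openCyl h1 h2)] with y hy
    obtain ⟨r', Θ', t', hy', -, -⟩ := InWedge.of_mem_openCyl hε hx.lt (x := ⟨c, y⟩) hx.cell hy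
    have e : (y : CR) = _ := hy'.eq_act
    rw [bundleChart_piHat hy', e, ← (isU21_wedgeMatrix (gap w j) i).act_mul, hBM, act_one]

theorem mem_edge_iff_bundleDev [NeZero m] {ε t₀ : ℝ} {hN0 : 0 < N}
    {hN : IsTotalAngle (gap w j) N} {b : Bundle w} (hb : b ∈ bundleNhd hj hk ε t₀ hN) :
    b ∈ (CellEdge.tet (w := w) j TetEdge.e14).image ↔ (bundleDev hj hk hN0 hN b).1 = 0 := by
  obtain ⟨x, rfl⟩ := isQuotientMap_piHat.surjective b
  obtain ⟨i, r, Θ, t, hx, -, -⟩ := hb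
  rw [bundleDev_piHat hx, cyl_fst_eq_zero hN0 hx.nonneg]
  refine (mem_image_wedgeEdge (hj := hj) (hk := hk) (i := 2) hN (by omega)).trans ?_
  constructor
  · rintro ⟨i', Θ', t', hx'⟩
    exact (hx.unique hx').2.1
  · rintro rfl
    exact ⟨i, Θ, t, hx⟩

theorem exists_small {t₀ : ℝ} (h : √3 < t₀) : ∃ ε, Small ε t₀ := by
  refine ⟨min (1 / 20) ((t₀ - √3) / 20), lt_min (by norm_num) (by linarith),
    (min_le_left _ _).trans_lt (by norm_num), ?_⟩
  linarith [min_le_right (1 / 20) ((t₀ - √3) / 20)]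

theorem hasRamificationOrder_of_isTotalAngle [NeZero m] (hN0 : 0 < N)
    (hN : IsTotalAngle (gap w j) N) (hj : w j = Flip.R) (hk : w (j + gap w j + 1) = Flip.R) :
    HasRamificationOrder (CellEdge.tet (w := w) j TetEdge.e14).image N := by
  refine ⟨hN0, fun p hp => ?_⟩
  obtain ⟨x, rfl⟩ := isQuotientMap_piHat.surjective p
  obtain ⟨i, Θ, t₀, hx⟩ :=
    (mem_image_wedgeEdge (hj := hj) (hk := hk) (i := 2) hN (by omega)).mp hp
  obtain ⟨ε, hε⟩ := exists_small hx.eq_zero.1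
  exact ⟨bundleNhd hj hk ε t₀ hN, bundleChart hj hk hN0 hN, bundleDev hj hk hN0 hN,
    ⟨i, 0, Θ, t₀, hx, hε.1, by simpa using hε.1⟩, isChart_bundleChart hε,
    (isOpenEmbedding_bundleDev hε).2, fun _ _ => rfl, fun _ hb => mem_edge_iff_bundleDev hb⟩

end

/-! ### Rigidity of CR transformations -/

theorem IsU21.mulVec_eq_of_act {D : Matrix (Fin 3) (Fin 3) ℂ} (hD : IsU21 D) {P Q : CR}
    (h : act D P = Q) : ∃ c : ℂ, c ≠ 0 ∧ D *ᵥ lift P = c • lift Q := by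
  rw [← h]; exact hD.exists_smul_lift_act P

/-- Three fixed points on the axis give a quadratic equation with three roots, so with the Hermitian
form D becomes diag(λ, μ, λ). Such a D still may rotate about the axis; the fixed point off the axis
forces μ = λ. -/
theorem IsU21.act_eq_self {D : Matrix (Fin 3) (Fin 3) ℂ} (hD : IsU21 D) {t₁ t₂ t₃ : ℝ}
    (h12 : t₁ ≠ t₂) (h13 : t₁ ≠ t₃) (h23 : t₂ ≠ t₃)
    (h : ∀ t, t = t₁ ∨ t = t₂ ∨ t = t₃ → act D ((0, t) : ℂ × ℝ) = OnePoint.some (0, t))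
    {z : ℂ} {s : ℝ} (hz : z ≠ 0) (hzs : act D ((z, s) : ℂ × ℝ) = OnePoint.some (z, s)) (P : CR) :
    act D P = P := by
  have key : ∀ t, t = t₁ ∨ t = t₂ ∨ t = t₃ → D 1 0 * (I * t / 2) + D 1 2 = 0 ∧
      D 0 0 * (I * t / 2) + D 0 2 = (D 2 0 * (I * t / 2) + D 2 2) * (I * t / 2) := by
    intro t ht
    obtain ⟨c, -, hc⟩ := hD.mulVec_eq_of_act (h t ht)
    have e0 := congrFun hc 0
    have e1 := congrFun hc 1
    have e2 := congrFun hc 2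
    simp [lift, mulVec, dotProduct, Fin.sum_univ_three] at e0 e1 e2
    exact ⟨e1, by rw [e0, e2]⟩
  obtain ⟨a1, b1⟩ := key t₁ (Or.inl rfl)
  obtain ⟨a2, b2⟩ := key t₂ (Or.inr (Or.inl rfl))
  obtain ⟨-, b3⟩ := key t₃ (Or.inr (Or.inr rfl))
  have c12 : I * t₁ / 2 - I * t₂ / 2 ≠ 0 := by
    rw [← sub_div, ← mul_sub, ← ofReal_sub]
    simp [sub_ne_zero, h12]
  have c13 : I * t₁ / 2 - I * t₃ / 2 ≠ 0 := by
    rw [← sub_div, ← mul_sub, ← ofReal_sub]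
    simp [sub_ne_zero, h13]
  have c23 : I * t₂ / 2 - I * t₃ / 2 ≠ 0 := by
    rw [← sub_div, ← mul_sub, ← ofReal_sub]
    simp [sub_ne_zero, h23]
  generalize I * t₁ / 2 = τ₁ at *
  generalize I * t₂ / 2 = τ₂ at *
  generalize I * t₃ / 2 = τ₃ at *
  have d10 : D 1 0 = 0 := by
    refine (mul_eq_zero.mp ?_).resolve_right c12
    linear_combination a1 - a2
  have d12 : D 1 2 = 0 := by simpa [d10] using a1
  have q12 : D 2 0 * (τ₁ + τ₂) + (D 2 2 - D 0 0) = 0 := by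
    refine (mul_eq_zero.mp ?_).resolve_right c12
    linear_combination b2 - b1
  have q13 : D 2 0 * (τ₁ + τ₃) + (D 2 2 - D 0 0) = 0 := by
    refine (mul_eq_zero.mp ?_).resolve_right c13
    linear_combination b3 - b1
  have d20 : D 2 0 = 0 := by
    refine (mul_eq_zero.mp ?_).resolve_right c23
    linear_combination q12 - q13
  have d22 : D 2 2 = D 0 0 := by
    rw [d20] at q12; linear_combination q12
  have d02 : D 0 2 = 0 := by
    rw [d20, d22] at b1; linear_combination b1
  have hU : Dᴴ * formJ * D = formJ := hD
  have u02 := congrFun (congrFun hU 0) 2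
  have u01 := congrFun (congrFun hU 0) 1
  have u21 := congrFun (congrFun hU 2) 1
  simp [Matrix.mul_apply, Fin.sum_univ_three, formJ, conjTranspose_apply, d10, d12, d20, d22, d02]
    at u02 u01 u21
  have hne : D 0 0 ≠ 0 := by
    intro h0
    simp [h0] at u02
  have d21 : D 2 1 = 0 := u01.resolve_left hne
  have d01 : D 0 1 = 0 := u21.resolve_left hne
  have d11 : D 1 1 = D 0 0 := by
    obtain ⟨c, -, hc⟩ := hD.mulVec_eq_of_act hzs
    have e1 := congrFun hc 1
    have e2 := congrFun hc 2
    simp [lift, mulVec, dotProduct, Fin.sum_univ_three, d10, d12, d20, d22, d21] at e1 e2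
    rw [e2]
    exact e1.resolve_right hz
  have e : D *ᵥ lift P = D 0 0 • lift P := by
    ext i
    fin_cases i <;>
      simp [mulVec, dotProduct, Fin.sum_univ_three, d10, d12, d20, d22, d21, d01, d02, d11]
  rw [act, e, proj_smul hne, proj_lift]

theorem act_eq_act_of_axis {C C' : Matrix (Fin 3) (Fin 3) ℂ} (hC : IsU21 C) (hC' : IsU21 C')
    {t₀ δ : ℝ} (hδ : 0 < δ)
    (h : ∀ t, |t - t₀| < δ → act C' ((0, t) : ℂ × ℝ) = act C ((0, t) : ℂ × ℝ))
    {z : ℂ} {s : ℝ} (hz : z ≠ 0) (hzs : act C' ((z, s) : ℂ × ℝ) = act C ((z, s) : ℂ × ℝ))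
    (P : CR) : act C' P = act C P := by
  obtain ⟨B, hB, hBC, hCB⟩ := hC.exists_inv
  have key : ∀ Q, act C' Q = act C Q → act (B * C') Q = Q := by
    intro Q hQ
    rw [hC'.act_mul, hQ, ← hC.act_mul, hBC, act_one]
  have := (hB.mul hC').act_eq_self (t₁ := t₀) (t₂ := t₀ + δ / 2) (t₃ := t₀ - δ / 2)
    (by linarith) (by linarith) (by linarith) (fun t ht => key _ (h t ?_)) hz (key _ hzs) P
  · calc act C' P = act (C * (B * C')) P := by rw [← Matrix.mul_assoc, hCB, Matrix.one_mul]
      _ = act C P := by rw [(hB.mul hC').act_mul, this]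
  · rcases ht with rfl | rfl | rfl
    · simpa using hδ
    · rw [add_sub_cancel_left, abs_of_pos] <;> linarith
    · rw [sub_sub_cancel_left, abs_neg, abs_of_pos] <;> linarith

/-! ### Counting fibres of branching maps -/

theorem isOpen_image_of_domRestrict {B Y : Type*} [TopologicalSpace B] [TopologicalSpace Y]
    {U V : Set B} {h : B → Y} (hh : IsOpenEmbedding (U.domRestrict h)) (hV : IsOpen V)
    (hVU : V ⊆ U) : IsOpen (h '' V) := by
  have := hh.isOpenMap _ (hV.preimage continuous_subtype_val)
  convert this using 1
  ext y
  constructor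
  · rintro ⟨b, hb, rfl⟩
    exact ⟨⟨b, hVU hb⟩, hb, rfl⟩
  · rintro ⟨b, hb, rfl⟩
    exact ⟨b, hb, rfl⟩

theorem injOn_of_domRestrict {B Y : Type*} [TopologicalSpace B] [TopologicalSpace Y]
    {U : Set B} {h : B → Y} (hh : IsOpenEmbedding (U.domRestrict h)) : Set.InjOn h U :=
  Set.injOn_iff_injective.mpr hh.injective

/-- Near `p` there are N points of V whose h-coordinates differ by N-th roots of unity. They have
the same image under the first branching map, hence under the second, and their h'-coordinates are N
distinct N'-th roots of one number. -/
theorem le_of_branchingMap {B : Type*} {V : Set B} {h h' : B → ℂ × ℝ} {N N' : ℕ} (hN : 0 < N)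
    (hN' : 0 < N') (hV : IsOpen (h '' V)) (h'i : Set.InjOn h' V) {p : B} (hp : p ∈ V)
    (hp0 : (h p).1 = 0)
    (hf : ∀ b ∈ V, ∀ b' ∈ V, branchingMap N (h b) = branchingMap N (h b') →
      branchingMap N' (h' b) = branchingMap N' (h' b')) : N ≤ N' := by
  obtain ⟨δ, hδ, hball⟩ := Metric.isOpen_iff.mp hV (h p) ⟨p, hp, rfl⟩
  have hζ := Complex.isPrimitiveRoot_exp N hN.ne'
  set ζ := exp (2 * Real.pi * I / N)
  have hζ1 : ‖ζ‖ = 1 := hζ.norm'_eq_one hN.ne'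
  have hδ2 : ((δ / 2 : ℝ) : ℂ) ≠ 0 := by exact_mod_cast (half_pos hδ).ne'
  have hmem : ∀ k : ℕ, ∃ b ∈ V, h b = ((δ / 2 : ℝ) * ζ ^ k, (h p).2) := by
    intro k
    refine hball ?_
    rw [Metric.mem_ball, Prod.dist_eq, max_lt_iff]
    refine ⟨?_, by simpa using hδ⟩
    rw [hp0, dist_zero_right, norm_mul, norm_pow, hζ1, Complex.norm_real, Real.norm_eq_abs,
      abs_of_pos (half_pos hδ), one_pow]
    linarith
  choose b hb hbk using hmem
  have hbr : ∀ k, branchingMap N' (h' (b k)) = branchingMap N' (h' (b 0)) := by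
    intro k
    refine hf _ (hb k) _ (hb 0) ?_
    rw [hbk, hbk, branchingMap, branchingMap]
    congr 1
    simp only [mul_pow]
    rw [← pow_mul, mul_comm k N, pow_mul, hζ.pow_eq_one, ← pow_mul]
    simp
  calc N = (Finset.range N).card := (Finset.card_range N).symm
    _ ≤ (Polynomial.nthRoots N' ((h' (b 0)).1 ^ N')).toFinset.card := by
      refine Finset.card_le_card_of_injOn (fun k => (h' (b k)).1) ?_ ?_
      · intro k _
        simp only [Finset.mem_coe, Multiset.mem_toFinset, Polynomial.mem_nthRoots hN']
        exact congrArg Prod.fst (hbr k)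
      · intro k hk k' hk' hkk
        have e1 : h' (b k) = h' (b k') :=
          Prod.ext hkk (congrArg Prod.snd ((hbr k).trans (hbr k').symm) :)
        have e2 := h'i (hb k) (hb k') e1
        have e3 := congrArg h e2
        rw [hbk, hbk] at e3
        have e4 := mul_left_cancel₀ hδ2 (congrArg Prod.fst e3)
        exact hζ.pow_inj (Finset.mem_range.mp hk) (Finset.mem_range.mp hk') e4
    _ ≤ Multiset.card (Polynomial.nthRoots N' ((h' (b 0)).1 ^ N')) :=
      Multiset.toFinset_card_le _
    _ ≤ N' := Polynomial.card_nthRoots _ _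

/-! ### Uniqueness of the ramification order -/

theorem exists_openCyl_subset (a : ℂ) {t₀ : ℝ} {V : Set CR}
    (hV : V ∈ 𝓝 (OnePoint.some (a, t₀) : CR)) : ∃ ε > 0, ∀ δ ≤ ε, openCyl a δ t₀ ⊆ V := by
  let F : ℂ × ℝ → CR := fun q => OnePoint.some (a + q.1, q.2 - 2 * (star a * (a + q.1)).im)
  have hF : Continuous F := OnePoint.continuous_coe.comp (by fun_prop)
  have h0 : F (0, t₀) = OnePoint.some (a, t₀) := by
    simp only [F, add_zero, im_star_mul_self, mul_zero, sub_zero]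
  have hV' : F ⁻¹' V ∈ 𝓝 ((0, t₀) : ℂ × ℝ) := hF.continuousAt (by rw [h0]; exact hV)
  obtain ⟨ε, hε, hb⟩ := Metric.mem_nhds_iff.mp hV'
  refine ⟨ε, hε, ?_⟩
  rintro δ hδ _ ⟨p, ⟨h1, h2⟩, rfl⟩
  have : ((p.1 - a, height a p) : ℂ × ℝ) ∈ Metric.ball ((0, t₀) : ℂ × ℝ) ε := by
    rw [Metric.mem_ball, Prod.dist_eq, max_lt_iff, dist_zero_right, Real.dist_eq]
    exact ⟨h1.trans_le hδ, h2.trans_le hδ⟩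
  have := hb this
  simpa [F, height] using this

section

variable {m : ℕ} {w : ZMod m → Flip} {j : ZMod m}
  {hj : w j = Flip.R} {hk : w (j + gap w j + 1) = Flip.R} {N : ℕ}

/-- The matrix supplied by the chart for this cell is composed with the one that realises the wedge,
so that on all wedges the chart is expressed in the same developed coordinates. -/
theorem IsChart.exists_near_wedge [NeZero m] {U : Set (Bundle w)} {φ : Bundle w → CR}
    (hφ : IsChart U φ) {i : ℕ} {x : Pieces w} {Θ t₀ : ℝ} (hx : InWedge hj hk i x 0 Θ t₀)
    (hxU : piHat w x ∈ U) : ∃ C, IsU21 C ∧ ∃ ε > 0, ∀ y r Θ t, InWedge hj hk i y r Θ t →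
      r < ε → |t - t₀| < ε →
        piHat w y ∈ U ∧ φ (piHat w y) = act C ((r * exp (Θ * I), t) : ℂ × ℝ) := by
  obtain ⟨c, x⟩ := x
  obtain ⟨B, hB, hev⟩ := hφ.2.2 c x hxU
  have hU : ∀ᶠ y in 𝓝 x, piHat w ⟨c, y⟩ ∈ U :=
    ((hφ.1.preimage isQuotientMap_piHat.continuous).preimage continuous_sigmaMk).mem_nhds hxU
  obtain ⟨V, hV, hVs⟩ := mem_nhds_induced _ _ _ |>.mp (hU.and hev)
  have hx2 : (x : CR) = _ := hx.eq_zero.2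
  rw [hx2] at hV
  obtain ⟨ε, hε, hsub⟩ := exists_openCyl_subset _ hV
  refine ⟨B * wedgeMatrix (gap w j) i, hB.mul (isU21_wedgeMatrix _ i), ε, hε, ?_⟩
  rintro ⟨c', y⟩ r Θ' t hy hr ht
  have hc : c' = c := hy.cell.trans hx.cell.symm
  subst hc
  obtain ⟨h1, h2⟩ := hVs (hsub ε le_rfl (hy.mem_openCyl hr ht) : (y : CR) ∈ V)
  have e : (y : CR) = _ := hy.eq_act
  refine ⟨h1, ?_⟩
  rw [h2, (isU21_wedgeMatrix _ i).act_mul, ← e]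

/-- It suffices to examine one point of the edge, taken at height √3 + 1: near it every chart is a
single CR transformation of the branched developing map, so both branching maps have the same
fibres. -/
theorem HasRamificationOrder.unique_of_isTotalAngle [NeZero m] (hN0 : 0 < N)
    (hN : IsTotalAngle (gap w j) N) (hj : w j = Flip.R) (hk : w (j + gap w j + 1) = Flip.R)
    {N' : ℕ} (h : HasRamificationOrder (CellEdge.tet (w := w) j TetEdge.e14).image N') :
    N' = N := by
  obtain ⟨hN'0, h⟩ := h
  set t₀ := √3 + 1
  have hx : ∀ i : Fin (gap w j + 4), ∃ x Θ, InWedge hj hk i x 0 Θ t₀ := fun i =>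
    exists_inWedge_zero i.2 (lt_add_one _)
  choose x Θ hx using hx
  set i₀ : Fin (gap w j + 4) := ⟨0, by omega⟩
  obtain ⟨U, φ, h', hpU, hφ, hh', hφh, heU⟩ := h (piHat w (x i₀))
    ((mem_image_wedgeEdge (hj := hj) (hk := hk) (i := 2) hN (by omega)).mpr ⟨_, _, _, hx i₀⟩)
  have hpi : ∀ i, piHat w (x i) = piHat w (x i₀) := fun i => (hx i).piHat_eq_zero (hx i₀)
  have hC := fun i => hφ.exists_near_wedge (hx i) ((hpi i).symm ▸ hpU)
  choose C hC ε hε hCε using hC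
  obtain ⟨δ, hδs, hδ⟩ : ∃ δ, Small δ t₀ ∧ ∀ i, δ ≤ ε i := by
    obtain ⟨δ, hδ⟩ := exists_small (lt_add_one √3)
    refine ⟨min δ (Finset.univ.inf' ⟨i₀, Finset.mem_univ _⟩ ε), ⟨lt_min hδ.1 ?_, ?_, ?_⟩, ?_⟩
    · exact (Finset.lt_inf'_iff _).mpr fun i _ => hε i
    · exact (min_le_left _ _).trans_lt hδ.2.1
    · have := hδ.2.2
      linarith [min_le_left δ (Finset.univ.inf' ⟨i₀, Finset.mem_univ _⟩ ε)]
    · exact fun i => (min_le_right _ _).trans (Finset.inf'_le _ (Finset.mem_univ i))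
  -- Adjacent wedges share a face, on which both expressions of the chart agree. The face contains a
  -- segment of the axis and a point off it, so rigidity identifies the transformations. Chaining
  -- from wedge 0 reaches every wedge, without closing the cycle.
  have hsucc : ∀ i (hi : i + 1 < gap w j + 4), ∀ P,
      act (C ⟨i + 1, hi⟩) P = act (C ⟨i, by omega⟩) P := by
    intro i hi
    have hface : ∀ r t, 0 ≤ r → r < δ → |t - t₀| < δ →
        act (C ⟨i + 1, hi⟩) ((r * exp (wedgeLo (gap w j) (i + 1) r * I), t) : ℂ × ℝ) =
        act (C ⟨i, by omega⟩) ((r * exp (wedgeLo (gap w j) (i + 1) r * I), t) : ℂ × ℝ) := by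
      intro r t hr hrδ htδ
      have hT := hδs.tube hrδ.le htδ.le
      obtain ⟨y, hy⟩ := exists_inWedge hj hk (i := i) (by omega) hr hT
        (wedgeLo_lt (gap w j) i hr hT.1).1 le_rfl
      obtain ⟨y', hy'⟩ := exists_inWedge hj hk hi hr hT le_rfl
        (wedgeLo_lt (gap w j) (i + 1) hr hT.1).1
      have e1 := (hCε ⟨i, by omega⟩ y _ _ _ hy (hrδ.trans_le (hδ _)) (htδ.trans_le (hδ _))).2
      have e2 := (hCε ⟨i + 1, hi⟩ y' _ _ _ hy' (hrδ.trans_le (hδ _)) (htδ.trans_le (hδ _))).2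
      rw [← e1, ← e2, hy.piHat_eq_succ hy']
    have hδ0 := hδs.1
    have hz := hface (δ / 2) t₀ (by linarith) (by linarith) (by simpa using hδ0)
    refine act_eq_act_of_axis (t₀ := t₀) (hC _) (hC _) hδ0 (fun t ht => ?_) ?_ hz
    · simpa using hface 0 t le_rfl hδ0 ht
    · refine mul_ne_zero ?_ (exp_ne_zero _)
      exact_mod_cast (half_pos hδ0).ne'
  have hall : ∀ i (hi : i < gap w j + 4), ∀ P, act (C ⟨i, hi⟩) P = act (C i₀) P := by
    intro i
    induction i with
    | zero => exact fun _ _ => rfl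
    | succ i ih => exact fun hi P => (hsucc i hi P).trans (ih _ P)
  have hVU : ∀ b ∈ bundleNhd hj hk δ t₀ hN,
      b ∈ U ∧ φ b = act (C i₀) (bundleChart hj hk hN0 hN b) := by
    intro b hb
    obtain ⟨y, rfl⟩ := isQuotientMap_piHat.surjective b
    obtain ⟨i, r, Θ, t, hy, h1, h2⟩ := hb
    have := hCε ⟨i, hy.lt⟩ y _ _ _ hy (h1.trans_le (hδ _)) (h2.trans_le (hδ _))
    exact ⟨this.1, by rw [this.2, hall, bundleChart_piHat hy]⟩
  have hpV : piHat w (x i₀) ∈ bundleNhd hj hk δ t₀ hN :=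
    ⟨i₀, 0, Θ i₀, t₀, hx i₀, hδs.1, by simpa using hδs.1⟩
  have hVo := isOpen_bundleNhd (hj := hj) (hk := hk) hδs (hN := hN)
  have hdev := (isOpenEmbedding_bundleDev (hj := hj) (hk := hk) hδs (hN0 := hN0) (hN := hN)).2
  have hp := (mem_image_wedgeEdge (hj := hj) (hk := hk) (i := 2) hN (by omega)).mpr
    ⟨_, _, _, hx i₀⟩
  have hfib : ∀ b ∈ bundleNhd hj hk δ t₀ hN, ∀ b' ∈ bundleNhd hj hk δ t₀ hN,
      branchingMap N (bundleDev hj hk hN0 hN b) = branchingMap N (bundleDev hj hk hN0 hN b') ↔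
        branchingMap N' (h' b) = branchingMap N' (h' b') := by
    intro b hb b' hb'
    obtain ⟨h1, h2⟩ := hVU b hb
    obtain ⟨h3, h4⟩ := hVU b' hb'
    rw [hφh b h1] at h2
    rw [hφh b' h3] at h4
    constructor
    · intro e
      refine coe_injective (h2.trans (Eq.trans ?_ h4.symm))
      rw [bundleChart, bundleChart, e]
    · intro e
      rw [e] at h2
      exact coe_injective ((hC i₀).act_injective (h2.symm.trans h4))
  have hsub : bundleNhd hj hk δ t₀ hN ⊆ U := fun b hb => (hVU b hb).1
  refine le_antisymm ?_ ?_
  · exact le_of_branchingMap hN'0 hN0 (isOpen_image_of_domRestrict hh' hVo hsub)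
      (injOn_of_domRestrict hdev) hpV ((heU _ hpU).mp hp)
      fun b hb b' hb' => (hfib b hb b' hb').mpr
  · exact le_of_branchingMap hN0 hN'0 (isOpen_image_of_domRestrict hdev hVo subset_rfl)
      ((injOn_of_domRestrict hh').mono hsub) hpV ((mem_edge_iff_bundleDev hpV).mp hp)
      fun b hb b' hb' => (hfib b hb b' hb').mp

/-! ### The total angle -/

/-- The residue of 1 - l modulo 6 is the least nonnegative number whose sum with l + 5 is divisible
by 6, so the sum is 6⌈(l + 5)/6⌉. -/
theorem exists_isTotalAngle (l : ℕ) :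
    ∃ N : ℕ, 0 < N ∧ IsTotalAngle l N ∧ (N : ℤ) = ⌈((l : ℝ) + 5) / 6⌉ := by
  have h0 := Int.emod_nonneg (1 - (l : ℤ)) (show (6 : ℤ) ≠ 0 by norm_num)
  have h1 := Int.emod_lt_of_pos (1 - (l : ℤ)) (show (0 : ℤ) < 6 by norm_num)
  obtain ⟨N, hN⟩ : ∃ N : ℕ, (1 - (l : ℤ)) % 6 + (l + 5) = 6 * N :=
    ⟨(((1 - (l : ℤ)) % 6 + (l + 5)) / 6).toNat, by omega⟩
  refine ⟨N, by omega, ?_, ?_⟩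
  · have : ((((1 - (l : ℤ)) % 6 : ℤ) : ℝ)) + (l + 5) = 6 * N := by exact_mod_cast hN
    unfold IsTotalAngle bigonAngle
    linear_combination this * (Real.pi / 3)
  · symm
    rw [Int.ceil_eq_iff]
    have h2 : (6 * N : ℤ) < l + 11 := by omega
    have h3 : (l + 5 : ℤ) ≤ 6 * N := by omega
    have h2' : (6 * N : ℝ) < l + 11 := by exact_mod_cast h2
    have h3' : (l + 5 : ℝ) ≤ 6 * N := by exact_mod_cast h3
    push_cast
    constructor <;> linarith

/-- Without flips the triangulation is unchanged, so f is conjugate to the identity, which has trace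
2. -/
theorem IsFlipSequence.ne_zero {f : SpecialLinearGroup (Fin 2) ℤ}
    (hf : 2 < (f : Matrix (Fin 2) (Fin 2) ℤ).trace) (hw : IsFlipSequence f w) : m ≠ 0 := by
  rintro rfl
  obtain ⟨g, hg, h⟩ := hw
  have h1 := congrArg PosTriangulation.lo h
  have h2 := congrArg PosTriangulation.hi h
  have hg1 : g = 1 := by
    have h00 := congrFun h1 0
    have h10 := congrFun h1 1
    have h01 := congrFun h2 0
    have h11 := congrFun h2 1
    simp [flipped, PosTriangulation.std, mulVec, dotProduct] at h00 h10 h01 h11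
    ext a b
    fin_cases a <;> fin_cases b <;> simp [← h00, ← h10, ← h01, ← h11]
  rw [hg1, isConj_one_left] at hg
  subst hg
  simp at hf

end

end

end TorusBundleCR

theorem mainTheorem5 (f : Matrix.SpecialLinearGroup (Fin 2) ℤ)
    (hf : 2 < (f : Matrix (Fin 2) (Fin 2) ℤ).trace)
    {m : ℕ} (w : ZMod m → TorusBundleCR.Flip) (hw : TorusBundleCR.IsFlipSequence f w)
    (j : ZMod m) (hj : w j = TorusBundleCR.Flip.R) :
    ∃ n : ℕ,
      TorusBundleCR.valence
        (TorusBundleCR.CellEdge.tet (w := w) j TorusBundleCR.TetEdge.e14).image = n + 4 ∧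
      ∀ N : ℕ,
        TorusBundleCR.HasRamificationOrder
          (TorusBundleCR.CellEdge.tet (w := w) j TorusBundleCR.TetEdge.e14).image N ↔
        (N : ℤ) = ⌈((n : ℝ) + 5) / 6⌉ := by
  have : NeZero m := ⟨hw.ne_zero hf⟩
  have hk := TorusBundleCR.gap_spec hj
  obtain ⟨N₀, hN0, hN, hceil⟩ := TorusBundleCR.exists_isTotalAngle (TorusBundleCR.gap w j)
  -- The integer n_j is the number of letters L that follow w_j before the next letter R.
  refine ⟨TorusBundleCR.gap w j, TorusBundleCR.valence_eq hN hj hk, fun N => ⟨fun h => ?_, ?_⟩⟩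
  · rw [h.unique_of_isTotalAngle hN0 hN hj hk, hceil]
  · intro h
    rw [← hceil] at h
    rw [Nat.cast_injective h]
    exact TorusBundleCR.hasRamificationOrder_of_isTotalAngle hN0 hN hj hk
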